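/- Let $m\ge 1$ and $d\ge 2$. Let $\mathbf Y=(Y_1,\dots,Y_m)$ be the homogenized Kostlan--Shub--Smale system of degree $d$: for $t=(t_0,\dots,t_m)\in\mathbb R^{m+1}$, $$Y_\ell(t)=\sum_{\boldsymbol j\in\mathbb N^{m+1},\ |\boldsymbol j|=d}a^{(\ell)}_{\boldsymbol j}t^{\boldsymbol j},\qquad \ell=1,\dots,m,$$ where the $a^{(\ell)}_{\boldsymbol j}$ are independent centered Gaussian random variables with variances $\frac{d!}{j_0!\cdots j_m!}$. Let $N^{\mathbf Y}_d$ be the number of roots of $\mathbf Y$ on the unit sphere $S^m\subset\mathbb R^{m+1}$. Let $Y'_\ell(t)$ be the spherical derivative of $Y_\ell$ at $t\in S^m$, that is, the orthogonal projection of the gradient of $Y_\ell$ at $t$ onto $t^\perp$. For each $t\in S^m$ choose an arbitrary orthonormal basis of $t^\perp$, let $Y'_{\ell k}(t)$ be the $k$-th coordinate of $Y'_\ell(t)$ in it, and put $\overline{\mathbf Y}'(t)=(Y'_{\ell k}(t)/\sqrt d)_{\ell,k=1,\dots,m}$. Let $H_0=1$, $H_1(x)=x$, $H_{n+1}(x)=xH_n(x)-nH_{n-1}(x)$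 be the Hermite polynomials. For $\boldsymbol\alpha\in\mathbb N^m$, $\boldsymbol\beta\in\mathbb N^{m\times m}$ put $\mathbf H_{\boldsymbol\alpha}(\mathbf y)=\prod_{\ell}H_{\alpha_\ell}(y_\ell)$, $\overline{\mathbf H}_{\boldsymbol\beta}(\mathbf y')=\prod_{\ell,k}H_{\beta_{\ell k}}(y'_{\ell k})$, $|\boldsymbol\alpha|=\sum_\ell\alpha_\ell$, $|\boldsymbol\beta|=\sum_{\ell,k}\beta_{\ell k}$, $\boldsymbol\beta!=\prod_{\ell,k}\beta_{\ell k}!$. Let $$f_{\boldsymbol\beta}=\frac1{\boldsymbol\beta!}\int_{\mathbb R^{m\times m}}|\det \mathbf y'|\,\overline{\mathbf H}_{\boldsymbol\beta}(\mathbf y')\,\phi(d\mathbf y'),$$ with $\phi$ the standard Gaussian measure on $\mathbb R^{m\times m}$, be the Hermite coefficients of $|\det|$, and let $b_{\boldsymbol\alpha}=\prod_{\ell=1}^m b_{\alpha_\ell}$, where $b_{2j}=\frac1{\sqrt{2\pi}}\left(-\frac12\right)^j\frac1{j!}$ and $b_{2j+1}=0$ are the Hermite coefficients of the Dirac delta $\delta_0$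 on $\mathbb R$. For $q\ge1$ put $$I_{q,d}=\frac{d^{m/4}}2\int_{S^m}\ \sum_{|\boldsymbol\alpha|+|\boldsymbol\beta|=q}b_{\boldsymbol\alpha}f_{\boldsymbol\beta}\,\mathbf H_{\boldsymbol\alpha}(\mathbf Y(t))\,\overline{\mathbf H}_{\boldsymbol\beta}(\overline{\mathbf Y}'(t))\,dt,$$ where $dt$ is the $m$-dimensional geometric measure on $S^m$. Then $N^{\mathbf Y}_d$ is almost surely finite and square integrable, the integrals defining $I_{q,d}$ exist, each $I_{q,d}$ is square integrable and belongs to the $q$-th Wiener chaos of the coefficients (the closed linear span in $L^2$ of the products $\prod_i H_{k_i}(x_i)$ with $\sum_i k_i=q$ and $(x_i)$ a finite orthonormal family in the closed linear span of the $a^{(\ell)}_{\boldsymbol j}$), and $$\frac{N^{\mathbf Y}_d-2d^{m/2}}{2d^{m/4}}=\sum_{q=1}^\infty I_{q,d}\qquad\text{in } L^2 .$$ -/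

import Mathlib

open MeasureTheory ProbabilityTheory Filter Topology
open scoped ENNReal InnerProductSpace

noncomputable section

namespace KSS

/-- The multi-indices `j ∈ ℕ^n` with `|j| = ∑ i, j i = d`. -/
abbrev DegIndex (n d : ℕ) : Type :=
  {j : Fin n → ℕ // j ∈ Finset.piAntidiag Finset.univ d}

/-- The family `a` of random coefficients `a^{(ℓ)}_j`, `ℓ = 1, …, m`, `j ∈ ℕ^{m+1}`, `|j| = d`, has
the Kostlan-Shub-Smale distribution: the coefficients are independent centered Gaussian variables
and the variance of `a^{(ℓ)}_j` is the multinomial coefficient `d! / (j_0! ⋯ j_m!)`. -/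
structure IsKSS {Ω : Type*} [MeasurableSpace Ω] (P : Measure Ω) {m d : ℕ}
    (a : Fin m × DegIndex (m + 1) d → Ω → ℝ) : Prop where
  hasLaw : ∀ p, HasLaw (a p) (gaussianReal 0 (Nat.multinomial Finset.univ p.2.1 : NNReal)) P
  indep : iIndepFun a P

/-- The homogeneous polynomial `∑_{|j| = d} c_j t^j` in the `m + 1` variables `t_0, …, t_m`. -/
def homPoly {m d : ℕ} (c : DegIndex (m + 1) d → ℝ) (t : EuclideanSpace ℝ (Fin (m + 1))) : ℝ :=
  ∑ j, c j * ∏ i, t i ^ j.1 i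

/-- The unit sphere `S^m` of `ℝ^{m+1}`. -/
abbrev Sph (m : ℕ) : Type := Metric.sphere (0 : EuclideanSpace ℝ (Fin (m + 1))) 1

/-- The `m`-dimensional geometric (surface) measure on `S^m`. -/
def surf (m : ℕ) : Measure (Sph m) :=
  (volume : Measure (EuclideanSpace ℝ (Fin (m + 1)))).toSphere

/-- The tangent space `t^⊥` of `S^m` at `t`. -/
abbrev Tangent {m : ℕ} (t : Sph m) : Submodule ℝ (EuclideanSpace ℝ (Fin (m + 1))) :=
  (Submodule.span ℝ {(t : EuclideanSpace ℝ (Fin (m + 1)))})ᗮ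

/-- A choice, at every point `t` of `S^m`, of an orthonormal basis of the tangent space `t^⊥`. -/
abbrev Frame (m : ℕ) : Type := ∀ t : Sph m, OrthonormalBasis (Fin m) ℝ (Tangent t)

/-- The spherical derivative of `F` at `t`: the orthogonal projection of the free gradient onto the
tangent space `t^⊥`. -/
def sphDeriv {m : ℕ} (F : EuclideanSpace ℝ (Fin (m + 1)) → ℝ) (t : Sph m) : Tangent t :=
  (Tangent t).orthogonalProjectionOnto (gradient F t)

/-- The value `Y_ℓ(t)` of the `ℓ`-th polynomial of the system with coefficients `c`. -/
def sysVal {m d : ℕ} (c : Fin m × DegIndex (m + 1) d → ℝ) (t : Sph m) (l : Fin m) : ℝ :=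
  homPoly (fun j => c (l, j)) t

/-- The standardized derivative `Y'_{ℓk}(t) / √d`, the `k`-th component being taken in the
orthonormal basis `e t` of the tangent space at `t`. -/
def sysDeriv {m d : ℕ} (c : Fin m × DegIndex (m + 1) d → ℝ) (e : Frame m) (t : Sph m)
    (p : Fin m × Fin m) : ℝ :=
  (e t).repr (sphDeriv (homPoly fun j => c (p.1, j)) t) p.2 / √(d : ℝ)

/-- The set of roots on `S^m` of the system with coefficients `c`. -/
def roots {m d : ℕ} (c : Fin m × DegIndex (m + 1) d → ℝ) : Set (Sph m) :=
  {t | ∀ l, sysVal c t l = 0}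

/-- The normalized number of roots `(N - 2 d^{m/2}) / (2 d^{m/4})`. -/
def normCount {m d : ℕ} (c : Fin m × DegIndex (m + 1) d → ℝ) : ℝ :=
  (((roots c).ncard : ℝ) - 2 * (d : ℝ) ^ ((m : ℝ) / 2)) / (2 * (d : ℝ) ^ ((m : ℝ) / 4))

/-- The (probabilists') Hermite polynomial `H_n`, as a function on `ℝ`. -/
def herm (n : ℕ) (x : ℝ) : ℝ := Polynomial.aeval x (Polynomial.hermite n)

/-- The multi-dimensional Hermite polynomial `∏_i H_{α_i}(y_i)`. -/
def hermProd {ι : Type*} [Fintype ι] (α : ι → ℕ) (y : ι → ℝ) : ℝ := ∏ i, herm (α i) (y i)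

/-- The Hermite coefficients of the Dirac delta at `0`:
`b_{2j} = (2π)^{-1/2} (-1/2)^j / j!`, and `b_n = 0` for odd `n`. -/
def diracCoeff (n : ℕ) : ℝ :=
  if Even n then (√(2 * Real.pi))⁻¹ * (-1 / 2 : ℝ) ^ (n / 2) / ((n / 2).factorial : ℝ) else 0

/-- The Hermite coefficients `b_α = ∏_j b_{α_j}` of `∏_j δ_0(y_j)`. -/
def bCoeff {m : ℕ} (α : Fin m → ℕ) : ℝ := ∏ j, diracCoeff (α j)

/-- The Hermite coefficients of `y' ↦ |det y'|`:
`f_β = (1/β!) ∫ |det y'| H_β(y') φ(dy')`, with `φ` the standard Gaussian measure on `ℝ^{m²}`. -/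
def fCoeff {m : ℕ} (β : Fin m × Fin m → ℕ) : ℝ :=
  (∏ p, ((β p).factorial : ℝ))⁻¹ *
    ∫ y : Fin m × Fin m → ℝ, |(Matrix.of fun l k => y (l, k)).det| * hermProd β y
      ∂(Measure.pi fun _ => gaussianReal 0 1)

/-- The integrand
`∑_{|α| + |β| = q} b_α f_β H_α(Y(t)) H_β(Y'(t) / √d)` of the `q`-th component. -/
def chaosIntegrand {m d : ℕ} (q : ℕ) (e : Frame m) (c : Fin m × DegIndex (m + 1) d → ℝ)
    (t : Sph m) : ℝ :=
  ∑ n ∈ Finset.HasAntidiagonal.antidiagonal q,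
    ∑ α ∈ Finset.piAntidiag (Finset.univ : Finset (Fin m)) n.1,
      ∑ β ∈ Finset.piAntidiag (Finset.univ : Finset (Fin m × Fin m)) n.2,
        bCoeff α * fCoeff β * hermProd α (sysVal c t) * hermProd β (sysDeriv c e t)

/-- The component
`I_{q,d} = (d^{m/4} / 2) ∫_{S^m} ∑_{|α| + |β| = q} b_α f_β H_α(Y(t)) H_β(Y'(t) / √d) dt`. -/
def chaosTerm {m d : ℕ} (q : ℕ) (e : Frame m) (c : Fin m × DegIndex (m + 1) d → ℝ) : ℝ :=
  (d : ℝ) ^ ((m : ℝ) / 4) / 2 * ∫ t, chaosIntegrand q e c t ∂(surf m)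

/-- The closed linear subspace of `L²(P)` generated by the random variables `a i`
(the Gaussian Hilbert space when the `a i` are jointly Gaussian and centered). -/
def gaussSpace {Ω ι : Type*} [MeasurableSpace Ω] (P : Measure Ω) (a : ι → Ω → ℝ) :
    Submodule ℝ (Lp ℝ 2 P) :=
  (Submodule.span ℝ {x : Lp ℝ 2 P | ∃ i, x =ᵐ[P] a i}).topologicalClosure

/-- The `q`-th Wiener chaos of a Gaussian Hilbert space `G`: the closed linear span in `L²(P)` of the
products `∏_i H_{k_i}(x_i)` with `∑_i k_i = q`, where the `x_i` are finitely many orthonormal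
elements of `G`. -/
def wienerChaos {Ω : Type*} [MeasurableSpace Ω] (P : Measure Ω) (G : Submodule ℝ (Lp ℝ 2 P))
    (q : ℕ) : Submodule ℝ (Lp ℝ 2 P) :=
  (Submodule.span ℝ {h : Lp ℝ 2 P | ∃ (n : ℕ) (k : Fin n → ℕ) (x : Fin n → Lp ℝ 2 P),
    (∀ i, x i ∈ G) ∧ Orthonormal ℝ x ∧ ∑ i, k i = q ∧
      h =ᵐ[P] fun ω => hermProd k fun i => x i ω}).topologicalClosure

end KSS

end

noncomputable section
namespace KSS

/-! ### Hermite polynomials and the one-dimensional Gaussian measure -/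

/-! Dividing each coefficient by its standard deviation turns the system into a function of a
standard Gaussian vector `z`, and the number of roots into a random variable `N(z)`. The closed
spans `polyL2` of the polynomials in `z` of degree at most `Q` increase to a dense subspace of `L²`.
Hence convergence follows once the partial sum `S_Q` of the series for `N`, term `q = 0` included,
is known to be the orthogonal projection of `N` onto the `Q`-th of these spaces
(`tendsto_eLpNorm_of_polyL2`). Membership holds because for fixed `t` the integrand is a polynomial
of degree at most `Q`. The rest is the identity `E[N h] = E[S_Q h]` for every polynomial `h` of
degree at most `Q` (`integral_numRoots_mul`). The Dirac mass needs no approximation: `δ₀` and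
`|det|` are only paired with polynomials, and there their truncated Hermite expansions are exact.

The identity rests on the Kac-Rice formula (`lintegral_numRoots_mul`): `E[N h(z)]` is the integral
over `t` of the expectation of `(2π)^{-m/2} |det Y'(t)| h`, with `z` projected onto the systems
vanishing at `t`. The covariance of `Y_ℓ` is `⟨s, t⟩^d`, so `Y(t)` and `Y'(t)/√d` are orthonormal
linear forms in `z` (`jetRow_gram`). In orthonormal coordinates that extend them, the projection
sets the value coordinates to zero, and `integral_absDet_dropVal` evaluates the expectation. The
formula itself is obtained by moving the level: subtract `y_ℓ t_0^d` from `Y_ℓ`, average over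
Gaussian `y`, and apply the area formula to `t ↦ Y(t)/t_0^d` off the equator (`lintegral_quotJac`).

Three further ingredients complete the argument. A Macaulay matrix bounds `N` almost surely by a
constant (`encard_roots_le`). The tangent frame is arbitrary, possibly non-measurable, but each
order of the expansion of `|det|` is invariant under orthogonal matrices (`detPart_rightMul`), so a
measurable frame gives the same integrand. Finally the term `q = 0` is a constant that can be read
off from `d = 1`, where there are exactly two roots (`surf_mul_chaosPoly_zero`); it produces the
centering `2 d^{m/2}`. -/

theorem derivative_hermite (n : ℕ) :
    Polynomial.derivative (Polynomial.hermite n) =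
      (n : Polynomial ℤ) * Polynomial.hermite (n - 1) := by
  induction n with
  | zero => simp
  | succ n ih =>
    rw [Polynomial.hermite_succ, Polynomial.derivative_sub, Polynomial.derivative_mul, ih]
    rcases n with _ | n
    · simp
    · simp only [Nat.add_sub_cancel, Polynomial.derivative_X, Polynomial.derivative_mul,
        Polynomial.derivative_natCast]
      rw [Polynomial.hermite_succ]
      push_cast
      ring

@[simp] theorem herm_zero (x : ℝ) : herm 0 x = 1 := by simp [herm]

theorem mul_herm (n : ℕ) (x : ℝ) : x * herm n x = herm (n + 1) x + n * herm (n - 1) x := by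
  simp only [herm, Polynomial.hermite_succ, derivative_hermite, map_sub, map_mul,
    Polynomial.aeval_X, map_natCast]
  ring

theorem continuous_herm (n : ℕ) : Continuous (herm n) := Polynomial.continuous_aeval _

theorem integrable_eval_gaussian (p : Polynomial ℝ) :
    Integrable (fun x => p.eval x) (gaussianReal 0 1) := by
  have h : ∀ n : ℕ, Integrable (fun x : ℝ => x ^ n) (gaussianReal 0 1) := fun n => by
    have := (memLp_id_gaussianReal (μ := 0) (v := 1) n).integrable_norm_pow'
    rw [← integrable_norm_iff (by fun_prop)]
    simpa using this
  simp_rw [Polynomial.eval_eq_sum_range]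
  exact integrable_finsetSum _ fun i _ => (h i).const_mul _

theorem hasDerivAt_gaussianPDF (x : ℝ) :
    HasDerivAt (gaussianPDFReal 0 1) (-x * gaussianPDFReal 0 1 x) x := by
  have h : gaussianPDFReal 0 1 = fun x => (√(2 * Real.pi * (1 : NNReal)))⁻¹ *
      Real.exp (-(x - 0) ^ 2 / (2 * (1 : NNReal))) := by
    funext x; rfl
  rw [h]
  have h1 : HasDerivAt (fun x : ℝ => -(x - 0) ^ 2 / (2 * ((1 : NNReal) : ℝ))) (-x) x := by
    refine (((((hasDerivAt_id x).sub_const 0).pow 2).neg).div_const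
      (2 * ((1 : NNReal) : ℝ))).congr_deriv ?_
    simp; ring
  refine (h1.exp.const_mul (√(2 * Real.pi * (1 : NNReal)))⁻¹).congr_deriv ?_
  ring

/-- Gaussian integration by parts: the density satisfies `φ' = -x φ`, and polynomials times `φ` are
integrable, so there are no boundary terms. -/
theorem integral_id_mul_eval_gaussian (p : Polynomial ℝ) :
    ∫ x, x * p.eval x ∂(gaussianReal 0 1) =
      ∫ x, p.derivative.eval x ∂(gaussianReal 0 1) := by
  have hI : ∀ q : Polynomial ℝ, Integrable (fun x => q.eval x * gaussianPDFReal 0 1 x) := by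
    intro q
    have := integrable_eval_gaussian q
    rw [gaussianReal_of_var_ne_zero _ one_ne_zero, integrable_withDensity_iff
      (measurable_gaussianPDF _ _) (by simp [gaussianPDF])] at this
    simpa [toReal_gaussianPDF] using this
  rw [integral_gaussianReal_eq_integral_smul one_ne_zero,
    integral_gaussianReal_eq_integral_smul one_ne_zero]
  have key := integral_mul_deriv_eq_deriv_mul_of_integrable
    (u := fun x => p.eval x) (v := gaussianPDFReal 0 1)
    (u' := fun x => p.derivative.eval x) (v' := fun x => -x * gaussianPDFReal 0 1 x)
    (fun x _ => p.hasDerivAt x) (fun x _ => hasDerivAt_gaussianPDF x) ?_ ?_ ?_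
  · have e1 : ∫ x, gaussianPDFReal 0 1 x • (x * p.eval x) =
        - ∫ x, p.eval x * (-x * gaussianPDFReal 0 1 x) := by
      rw [← integral_neg]; congr 1; funext x; simp only [smul_eq_mul]; ring
    rw [e1, key, neg_neg]
    congr 1; funext x; simp only [smul_eq_mul]; ring
  · refine (hI (-(Polynomial.X * p))).congr (ae_of_all _ fun x => ?_)
    simp; ring
  · exact hI _
  · exact hI _

/-- Hermite polynomial with real coefficients. -/
def hermR (n : ℕ) : Polynomial ℝ := (Polynomial.hermite n).map (Int.castRingHom ℝ)

theorem eval_hermR (n : ℕ) (x : ℝ) : (hermR n).eval x = herm n x := by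
  rw [hermR, herm, Polynomial.eval_map, Polynomial.aeval_def]; rfl

theorem hermR_succ (n : ℕ) :
    hermR (n + 1) = Polynomial.X * hermR n - Polynomial.derivative (hermR n) := by
  simp [hermR, Polynomial.hermite_succ, Polynomial.derivative_map]

theorem derivative_hermR (n : ℕ) :
    Polynomial.derivative (hermR n) = (n : Polynomial ℝ) * hermR (n - 1) := by
  simp [hermR, Polynomial.derivative_map, derivative_hermite]

/-- Since `H_{n+1} = x H_n - H_n'`, integration by parts of `x H_n p` moves one derivative onto `p`.
Iterating this gives the orthogonality relations. -/
theorem integral_herm_succ_mul (n : ℕ) (p : Polynomial ℝ) :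
    ∫ x, herm (n + 1) x * p.eval x ∂(gaussianReal 0 1) =
      ∫ x, herm n x * p.derivative.eval x ∂(gaussianReal 0 1) := by
  have h := integral_id_mul_eval_gaussian (hermR n * p)
  have h1 : ∀ x, herm (n + 1) x * p.eval x =
      x * (hermR n * p).eval x - ((hermR n).derivative * p).eval x := by
    intro x
    rw [← eval_hermR, hermR_succ]; simp; ring
  simp_rw [h1]
  rw [integral_sub, h, ← integral_sub]
  · congr 1; funext x; simp [eval_hermR]
  · exact integrable_eval_gaussian _
  · exact integrable_eval_gaussian _
  · exact (integrable_eval_gaussian (Polynomial.X * (hermR n * p))).congr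
      (ae_of_all _ fun x => by simp)
  · exact integrable_eval_gaussian _

theorem integral_herm_mul_herm (n k : ℕ) :
    ∫ x, herm n x * herm k x ∂(gaussianReal 0 1) = if n = k then (n.factorial : ℝ) else 0 := by
  induction n generalizing k with
  | zero =>
    rcases k with _ | k
    · simp
    · have := integral_herm_succ_mul k 1
      simp only [Polynomial.eval_one, mul_one, Polynomial.derivative_one, Polynomial.eval_zero,
        mul_zero, integral_zero] at this
      simpa using this
  | succ n ih =>
    have := integral_herm_succ_mul n (hermR k)
    simp only [eval_hermR, derivative_hermR, Polynomial.eval_mul, Polynomial.eval_natCast] at this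
    rw [this]
    rcases k with _ | k
    · simp
    · have e : ∀ x, herm n x * (((k + 1 : ℕ) : ℝ) * herm (k + 1 - 1) x) =
          ((k + 1 : ℕ) : ℝ) * (herm n x * herm k x) := by
        intro x; simp; ring
      simp_rw [e]
      rw [integral_const_mul, ih]
      by_cases h : n = k
      · subst h; simp [Nat.factorial_succ]
      · simp [h]

/-- Justifies the name of `diracCoeff`: pairing `δ₀` with `H_n` against the Gaussian measure gives
`φ(0) H_n(0)`, and dividing by `‖H_n‖² = n!` must give the prescribed coefficient. The explicit
constant term of `H_{2k}` is a double factorial. -/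
theorem herm_apply_zero (n : ℕ) :
    (√(2 * Real.pi))⁻¹ * herm n 0 = diracCoeff n * n.factorial := by
  have h0 : herm n 0 = ((Polynomial.hermite n).coeff 0 : ℝ) := by
    rw [← eval_hermR, ← Polynomial.coeff_zero_eq_eval_zero, hermR]; simp
  rw [h0, diracCoeff]
  split_ifs with h
  · obtain ⟨k, rfl⟩ := h
    have h2 : (k + k) / 2 = k := by omega
    have e := Polynomial.coeff_hermite_explicit k 0
    rw [add_zero] at e
    rw [h2, ← two_mul, e]
    have e2 : ((2 * k).factorial : ℝ) = 2 ^ k * k.factorial * (Nat.doubleFactorial (2 * k - 1)) := by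
      rcases k with _ | k
      · simp
      · have := Nat.factorial_eq_mul_doubleFactorial (2 * k + 1)
        rw [show 2 * (k + 1) = 2 * k + 1 + 1 by ring, this,
          show 2 * k + 1 + 1 = 2 * (k + 1) by ring, Nat.doubleFactorial_two_mul]
        rw [show 2 * (k + 1) - 1 = 2 * k + 1 by omega]
        push_cast
        ring
    rw [e2]
    have : (k.factorial : ℝ) ≠ 0 := by positivity
    push_cast
    rw [div_pow]
    field_simp
    simp
  · rw [Polynomial.coeff_hermite_of_odd_add]
    · simp
    · simpa using h

end KSS
end

noncomputable section
namespace KSS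

/-! ### Polynomial functions of bounded degree and the standard Gaussian measure -/

/-- The standard Gaussian measure on `ι → ℝ`. -/
abbrev stdG (ι : Type*) [Fintype ι] : Measure (ι → ℝ) := Measure.pi fun _ => gaussianReal 0 1

/-- The affine functions on `ι → ℝ`. -/
def affineFun (ι : Type*) : Submodule ℝ ((ι → ℝ) → ℝ) :=
  Submodule.span ℝ (insert 1 (Set.range fun (i : ι) (x : ι → ℝ) => x i))

/-- The polynomial functions of degree at most `Q` on `ι → ℝ`. -/
def polyLE (ι : Type*) (Q : ℕ) : Submodule ℝ ((ι → ℝ) → ℝ) := affineFun ι ^ Q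

section
variable {ι κ : Type*}

theorem one_mem_affineFun : (1 : (ι → ℝ) → ℝ) ∈ affineFun ι :=
  Submodule.subset_span (Set.mem_insert _ _)

theorem coord_mem_affineFun (i : ι) : (fun x : ι → ℝ => x i) ∈ affineFun ι :=
  Submodule.subset_span (Set.mem_insert_of_mem _ ⟨i, rfl⟩)

theorem mul_mem_polyLE {a b : ℕ} {f g : (ι → ℝ) → ℝ} (hf : f ∈ polyLE ι a)
    (hg : g ∈ polyLE ι b) : f * g ∈ polyLE ι (a + b) := by
  rw [polyLE, pow_add]; exact Submodule.mul_mem_mul hf hg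

theorem polyLE_mono {a b : ℕ} (h : a ≤ b) : polyLE ι a ≤ polyLE ι b := by
  obtain ⟨c, rfl⟩ := Nat.exists_eq_add_of_le h
  induction c with
  | zero => exact le_rfl
  | succ c ih =>
    refine (ih (by omega)).trans ?_
    intro f hf
    have := mul_mem_polyLE hf (b := 1) (by rw [polyLE, pow_one]; exact one_mem_affineFun)
    simpa [add_assoc] using this

theorem one_mem_polyLE (Q : ℕ) : (1 : (ι → ℝ) → ℝ) ∈ polyLE ι Q :=
  polyLE_mono (Nat.zero_le Q) (by rw [polyLE, pow_zero]; exact Submodule.one_le.1 le_rfl)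

theorem mem_polyLE_one {f : (ι → ℝ) → ℝ} (hf : f ∈ affineFun ι) : f ∈ polyLE ι 1 := by
  rwa [polyLE, pow_one]

theorem pow_mem_polyLE {f : (ι → ℝ) → ℝ} (hf : f ∈ affineFun ι) (n : ℕ) : f ^ n ∈ polyLE ι n :=
  Submodule.pow_mem_pow _ hf n

theorem sum_mul_mem_affineFun [Fintype ι] (u : ι → ℝ) :
    (fun x : ι → ℝ => ∑ i, u i * x i) ∈ affineFun ι := by
  have : (fun x : ι → ℝ => ∑ i, u i * x i) = ∑ i, u i • (fun x : ι → ℝ => x i) := by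
    funext x; simp
  rw [this]
  exact Submodule.sum_mem _ fun i _ => Submodule.smul_mem _ _ (coord_mem_affineFun i)

/-- Composition with a family of affine functions, as an algebra homomorphism. -/
def compHom (u : (ι → ℝ) → (κ → ℝ)) : ((κ → ℝ) → ℝ) →ₐ[ℝ] ((ι → ℝ) → ℝ) where
  toFun f := f ∘ u
  map_one' := rfl
  map_mul' _ _ := rfl
  map_zero' := rfl
  map_add' _ _ := rfl
  commutes' _ := rfl

/-- Composition with `u` is an algebra homomorphism that maps affine functions to affine functions,
hence the `Q`-th power of the one space into the `Q`-th power of the other. -/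
theorem comp_mem_polyLE {u : (ι → ℝ) → (κ → ℝ)} (hu : ∀ k, (fun x => u x k) ∈ affineFun ι)
    {Q : ℕ} {f : (κ → ℝ) → ℝ} (hf : f ∈ polyLE κ Q) : (fun x => f (u x)) ∈ polyLE ι Q := by
  have hA : (affineFun κ).map (compHom u).toLinearMap ≤ affineFun ι := by
    rw [affineFun, Submodule.map_span, Submodule.span_le]
    rintro _ ⟨g, hg, rfl⟩
    rcases hg with rfl | ⟨k, rfl⟩
    · exact one_mem_affineFun
    · exact hu k
  have : compHom u f ∈ (affineFun κ ^ Q).map (compHom u).toLinearMap :=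
    Submodule.mem_map_of_mem hf
  rw [Submodule.map_pow] at this
  exact pow_le_pow_left' hA Q this

theorem herm_comp_mem_polyLE {f : (ι → ℝ) → ℝ} (hf : f ∈ affineFun ι) (n : ℕ) :
    (fun x => herm n (f x)) ∈ polyLE ι n := by
  have h : (fun x => herm n (f x)) = ∑ k ∈ Finset.range (n + 1), (hermR n).coeff k • f ^ k := by
    funext x
    rw [← eval_hermR, Polynomial.eval_eq_sum_range' (n := n + 1)]
    · simp
    · rw [hermR]
      exact Nat.lt_succ_of_le ((Polynomial.natDegree_map_le).trans
        (Polynomial.natDegree_hermite).le)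
  rw [h]
  refine Submodule.sum_mem _ fun k hk => Submodule.smul_mem _ _ ?_
  exact polyLE_mono (by simpa [Nat.lt_succ_iff] using hk) (pow_mem_polyLE hf k)

theorem hermProd_comp_mem_polyLE [Fintype κ] {f : κ → (ι → ℝ) → ℝ}
    (hf : ∀ k, f k ∈ affineFun ι) (α : κ → ℕ) :
    (fun x => hermProd α fun k => f k x) ∈ polyLE ι (∑ k, α k) := by
  classical
  have : ∀ s : Finset κ, (fun x => ∏ k ∈ s, herm (α k) (f k x)) ∈ polyLE ι (∑ k ∈ s, α k) := by
    intro s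
    induction s using Finset.induction_on with
    | empty => simpa using! one_mem_polyLE (ι := ι) 0
    | insert k s hk ih =>
      rw [Finset.sum_insert hk]
      have := mul_mem_polyLE (herm_comp_mem_polyLE (hf k) (α k)) ih
      convert this using 1
      funext x
      simp [Finset.prod_insert hk]
  exact this Finset.univ

variable [Fintype ι]

theorem hermProd_mem_polyLE (α : ι → ℕ) : hermProd α ∈ polyLE ι (∑ i, α i) :=
  hermProd_comp_mem_polyLE (f := fun i x => x i) coord_mem_affineFun α

/-- The three-term recurrence in one variable. When `α i = 0` the truncated `α i - 1` is harmless
because its coefficient vanishes. -/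
theorem coord_mul_hermProd [DecidableEq ι] (i : ι) (α : ι → ℕ) (x : ι → ℝ) :
    x i * hermProd α x = hermProd (Function.update α i (α i + 1)) x +
      α i * hermProd (Function.update α i (α i - 1)) x := by
  have h : ∀ n, hermProd (Function.update α i n) x =
      herm n (x i) * ∏ j ∈ Finset.univ.erase i, herm (α j) (x j) := by
    intro n
    rw [hermProd, ← Finset.mul_prod_erase _ _ (Finset.mem_univ i)]
    simp only [Function.update_self]
    congr 1
    refine Finset.prod_congr rfl fun j hj => ?_
    rw [Function.update_of_ne (Finset.ne_of_mem_erase hj)]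
  have h0 := h (α i)
  rw [Function.update_eq_self] at h0
  rw [h0, h, h, ← mul_assoc, mul_herm]
  ring

/-- Multiplying by a coordinate stays in the span at the cost of one degree, by the three-term
recurrence. Every linear statement about polynomials is thereby reduced to Hermite products, which
are orthogonal. -/
theorem polyLE_le_span_hermProd (Q : ℕ) :
    polyLE ι Q ≤ Submodule.span ℝ (hermProd '' {α : ι → ℕ | ∑ i, α i ≤ Q}) := by
  classical
  induction Q with
  | zero =>
    rw [polyLE, pow_zero, Submodule.one_le]
    refine Submodule.subset_span ⟨0, by simp, ?_⟩
    funext x; simp [hermProd]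
  | succ Q ih =>
    rw [polyLE, pow_succ']
    refine (mul_le_mul' le_rfl ih).trans ?_
    rw [affineFun, Submodule.span_mul_span, Submodule.span_le]
    rintro _ ⟨f, hf, _, ⟨α, hα, rfl⟩, rfl⟩
    have hα' : ∑ i, α i ≤ Q := hα
    rcases hf with rfl | ⟨i, rfl⟩
    · exact Submodule.subset_span ⟨α, Nat.le_succ_of_le hα', by simp⟩
    · have e : ((fun x : ι → ℝ => x i) * hermProd α) =
          hermProd (Function.update α i (α i + 1)) +
            (α i : ℝ) • hermProd (Function.update α i (α i - 1)) := by
        funext x; exact coord_mul_hermProd i α x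
      have hs : ∀ n, ∑ j, Function.update α i n j = n + ∑ j ∈ Finset.univ.erase i, α j := by
        intro n
        rw [← Finset.add_sum_erase _ _ (Finset.mem_univ i), Function.update_self]
        congr 1
        exact Finset.sum_congr rfl fun j hj => by
          rw [Function.update_of_ne (Finset.ne_of_mem_erase hj)]
      have h1 := hs (α i)
      rw [Function.update_eq_self] at h1
      simp only [SetLike.mem_coe]
      rw [e]
      refine Submodule.add_mem _ (Submodule.subset_span ⟨_, ?_, rfl⟩)
        (Submodule.smul_mem _ _ (Submodule.subset_span ⟨_, ?_, rfl⟩))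
      · simp only [Set.mem_ofPred_eq, hs]; omega
      · simp only [Set.mem_ofPred_eq, hs]; omega

theorem integrable_herm (n : ℕ) : Integrable (herm n) (gaussianReal 0 1) :=
  (integrable_eval_gaussian (hermR n)).congr (ae_of_all _ fun x => eval_hermR n x)

theorem integrable_hermProd (α : ι → ℕ) : Integrable (hermProd α) (stdG ι) :=
  Integrable.fintype_prod (f := fun i => herm (α i)) fun i => integrable_herm (α i)

theorem integrable_of_mem_polyLE {Q : ℕ} {f : (ι → ℝ) → ℝ} (hf : f ∈ polyLE ι Q) :
    Integrable f (stdG ι) := by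
  have := polyLE_le_span_hermProd Q hf
  clear hf
  induction this using Submodule.span_induction with
  | mem x h => obtain ⟨α, -, rfl⟩ := h; exact integrable_hermProd α
  | zero => exact integrable_zero _ _ _
  | add f g _ _ h1 h2 => exact h1.add h2
  | smul a f _ h1 => exact h1.smul a

theorem continuous_of_mem_polyLE {Q : ℕ} {f : (ι → ℝ) → ℝ} (hf : f ∈ polyLE ι Q) :
    Continuous f := by
  have := polyLE_le_span_hermProd Q hf
  clear hf
  induction this using Submodule.span_induction with
  | mem x h =>
    obtain ⟨α, -, rfl⟩ := h
    exact continuous_finsetProd _ fun i _ => (continuous_herm _).comp (continuous_apply i)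
  | zero => exact continuous_const
  | add f g _ _ h1 h2 => exact h1.add h2
  | smul a f _ h1 => exact h1.const_smul a

theorem memLp_two_of_mem_polyLE {Q : ℕ} {f : (ι → ℝ) → ℝ} (hf : f ∈ polyLE ι Q) :
    MemLp f 2 (stdG ι) := by
  rw [memLp_two_iff_integrable_sq (continuous_of_mem_polyLE hf).aestronglyMeasurable]
  have := integrable_of_mem_polyLE (mul_mem_polyLE hf hf)
  simpa only [sq] using! this

theorem integral_hermProd_mul_hermProd (α β : ι → ℕ) :
    ∫ x, hermProd α x * hermProd β x ∂(stdG ι) =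
      if α = β then ∏ i, ((α i).factorial : ℝ) else 0 := by
  simp only [hermProd, ← Finset.prod_mul_distrib]
  rw [integral_fintype_prod_eq_prod (f := fun i x => herm (α i) x * herm (β i) x)]
  simp only [integral_herm_mul_herm]
  split_ifs with h
  · subst h; simp
  · obtain ⟨i, hi⟩ := Function.ne_iff.1 h
    exact Finset.prod_eq_zero (Finset.mem_univ i) (by simp [hi])

end

end KSS
end

noncomputable section
namespace KSS

/-! ### Invariance of the standard Gaussian measure and product formulas -/

theorem prod_coord_mem_polyLE {ι σ : Type*} (s : Finset σ) (f : σ → ι) :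
    (fun x : ι → ℝ => ∏ i ∈ s, x (f i)) ∈ polyLE ι s.card := by
  classical
  induction s using Finset.induction_on with
  | empty => simpa using! one_mem_polyLE (ι := ι) 0
  | insert k s hk ih =>
    rw [Finset.card_insert_of_notMem hk, add_comm]
    have := mul_mem_polyLE (mem_polyLE_one (coord_mem_affineFun (f k))) ih
    convert this using 1
    funext x
    simp [Finset.prod_insert hk]

section
variable {ι κ : Type*} [Fintype ι] [Fintype κ]

/-- The rows of `A` are orthonormal, so `‖Aᵀ t‖ = ‖t‖` and the characteristic functions agree. As
`A` need not be square, this covers both orthogonal changes of coordinates and the law of the jet of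
the system at a point. -/
theorem measurePreserving_of_gram_eq_one [DecidableEq κ] (A : κ → ι → ℝ)
    (hA : ∀ k k', ∑ i, A k i * A k' i = if k = k' then 1 else 0) :
    MeasurePreserving (fun (z : ι → ℝ) (k : κ) => ∑ i, A k i * z i) (stdG ι) (stdG κ) := by
  have hm : Measurable (fun (z : ι → ℝ) (k : κ) => ∑ i, A k i * z i) := by fun_prop
  refine ⟨hm, ?_⟩
  -- The characteristic function uses the Euclidean inner product, so both measures are first pushed
  -- to `EuclideanSpace`; this loses no information.
  have hinj : Function.Injective
      (fun μ : Measure (κ → ℝ) => μ.map (MeasurableEquiv.toLp 2 (κ → ℝ))) := by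
    intro μ ν h
    have h' := congrArg (Measure.map (MeasurableEquiv.toLp 2 (κ → ℝ)).symm) h
    simpa [MeasurableEquiv.map_map_symm, MeasurableEquiv.map_symm_map] using h'
  refine hinj ?_
  simp only [MeasurableEquiv.coe_toLp]
  rw [Measure.map_map (by fun_prop) hm]
  have : IsFiniteMeasure ((stdG ι).map
      (WithLp.toLp 2 ∘ fun (z : ι → ℝ) (k : κ) => ∑ i, A k i * z i)) :=
    Measure.isFiniteMeasure_map _ _
  have : IsFiniteMeasure ((stdG κ).map (WithLp.toLp 2)) := Measure.isFiniteMeasure_map _ _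
  apply Measure.ext_of_charFun (E := EuclideanSpace ℝ κ)
  funext t
  rw [map_pi_eq_stdGaussian, charFun_stdGaussian, charFun_apply,
    integral_map (Measurable.comp (by fun_prop) hm).aemeasurable (by fun_prop)]
  have h1 := charFun_stdGaussian (E := EuclideanSpace ℝ ι)
    (WithLp.toLp 2 fun i => ∑ k, A k i * t k)
  rw [← map_pi_eq_stdGaussian, charFun_apply, integral_map (by fun_prop) (by fun_prop)] at h1
  have e1 : ∀ z : ι → ℝ, inner ℝ ((WithLp.toLp 2 ∘ fun (z : ι → ℝ) (k : κ) => ∑ i, A k i * z i) z :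
      EuclideanSpace ℝ κ) t =
      inner ℝ (WithLp.toLp 2 z : EuclideanSpace ℝ ι) (WithLp.toLp 2 fun i => ∑ k, A k i * t k) := by
    intro z
    simp only [PiLp.inner_apply, Function.comp, Real.inner_apply, Finset.sum_mul, Finset.mul_sum]
    rw [Finset.sum_comm]
    refine Finset.sum_congr rfl fun i _ => Finset.sum_congr rfl fun k _ => by ring
  have e2 : ‖(WithLp.toLp 2 fun i => ∑ k, A k i * t k : EuclideanSpace ℝ ι)‖ ^ 2 = ‖t‖ ^ 2 := by
    rw [EuclideanSpace.real_norm_sq_eq, EuclideanSpace.real_norm_sq_eq]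
    simp only [sq, Finset.sum_mul_sum]
    rw [Finset.sum_comm]
    have : ∀ k ∈ Finset.univ, ∑ i, ∑ k', A k i * t k * (A k' i * t k') = t k * t k := by
      intro k _
      rw [Finset.sum_comm]
      have : ∀ k', ∑ i, A k i * t k * (A k' i * t k') = t k * t k' * if k = k' then 1 else 0 := by
        intro k'
        rw [← hA, Finset.mul_sum]
        exact Finset.sum_congr rfl fun i _ => by ring
      simp [this]
    rw [Finset.sum_congr rfl this]
  simp only [e1, h1, ← Complex.ofReal_pow, e2]

theorem stdG_sum_prod :
    MeasurePreserving (MeasurableEquiv.sumPiEquivProdPi fun _ : ι ⊕ κ => ℝ) (stdG (ι ⊕ κ))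
      ((stdG ι).prod (stdG κ)) :=
  measurePreserving_sumPiEquivProdPi fun _ : ι ⊕ κ => gaussianReal 0 1

theorem integral_stdG_sum_mul (F : (ι → ℝ) → ℝ) (G : (κ → ℝ) → ℝ) :
    ∫ x, F (fun i => x (Sum.inl i)) * G (fun k => x (Sum.inr k)) ∂(stdG (ι ⊕ κ)) =
      (∫ x, F x ∂(stdG ι)) * ∫ x, G x ∂(stdG κ) := by
  rw [← integral_prod_mul, ← stdG_sum_prod.integral_comp' (g := fun p => F p.1 * G p.2)]
  rfl

theorem hermProd_sum (α : ι ⊕ κ → ℕ) (x : ι ⊕ κ → ℝ) :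
    hermProd α x = hermProd (fun i => α (Sum.inl i)) (fun i => x (Sum.inl i)) *
      hermProd (fun i => α (Sum.inr i)) (fun i => x (Sum.inr i)) := by
  simp [hermProd, Fintype.prod_sum_type]

/-- Full support turns an almost everywhere identity between polynomials into a pointwise one. -/
instance : (stdG ι).IsOpenPosMeasure := by
  have : (gaussianReal 0 1).IsOpenPosMeasure :=
    (gaussianReal_absolutelyContinuous' 0 one_ne_zero).isOpenPosMeasure
  infer_instance

theorem det_mem_polyLE {m : ℕ} :
    (fun y : Fin m × Fin m → ℝ => (Matrix.of fun l k => y (l, k)).det) ∈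
      polyLE (Fin m × Fin m) m := by
  have : (fun y : Fin m × Fin m → ℝ => (Matrix.of fun l k => y (l, k)).det) =
      ∑ σ : Equiv.Perm (Fin m), ((Equiv.Perm.sign σ : ℤ) : ℝ) • fun y : Fin m × Fin m → ℝ =>
        ∏ i, y (σ i, i) := by
    funext y
    simp [Matrix.det_apply, Units.smul_def]
  rw [this]
  refine Submodule.sum_mem _ fun σ _ => Submodule.smul_mem _ _ ?_
  simpa using prod_coord_mem_polyLE (Finset.univ : Finset (Fin m)) fun i => (σ i, i)

theorem integrable_abs_mul_of_mem_polyLE {a b : ℕ} {f g : (ι → ℝ) → ℝ} (hf : f ∈ polyLE ι a)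
    (hg : g ∈ polyLE ι b) : Integrable (fun x => |f x| * g x) (stdG ι) := by
  refine (integrable_of_mem_polyLE (mul_mem_polyLE hf hg)).mono
    (((continuous_of_mem_polyLE hf).abs.mul (continuous_of_mem_polyLE hg)).aestronglyMeasurable)
    (ae_of_all _ fun x => ?_)
  simp

end

/-! ### The Hermite expansion of `|det|` -/

section
variable {m : ℕ}

/-- The component of order `k` of the Hermite expansion of `|det|`. -/
def detPart (m k : ℕ) (y : Fin m × Fin m → ℝ) : ℝ :=
  ∑ β ∈ Finset.piAntidiag (Finset.univ : Finset (Fin m × Fin m)) k, fCoeff β * hermProd β y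

/-- The absolute value of the determinant. -/
def absDet (y : Fin m × Fin m → ℝ) : ℝ := |(Matrix.of fun l k => y (l, k)).det|

theorem detPart_mem_polyLE (k : ℕ) : detPart m k ∈ polyLE (Fin m × Fin m) k := by
  have : detPart m k = ∑ β ∈ Finset.piAntidiag (Finset.univ : Finset (Fin m × Fin m)) k,
      fCoeff β • hermProd β := by
    funext y; simp [detPart]
  rw [this]
  refine Submodule.sum_mem _ fun β hβ => Submodule.smul_mem _ _ ?_
  have := hermProd_mem_polyLE β
  rwa [(Finset.mem_piAntidiag.1 hβ).1] at this

theorem fCoeff_mul_factorial (β : Fin m × Fin m → ℕ) :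
    fCoeff β * ∏ p, ((β p).factorial : ℝ) = ∫ y, absDet y * hermProd β y ∂(stdG (Fin m × Fin m)) := by
  have : (∏ p, ((β p).factorial : ℝ)) ≠ 0 :=
    Finset.prod_ne_zero_iff.2 fun p _ => by positivity
  rw [fCoeff, mul_comm, mul_inv_cancel_left₀ this]
  rfl

theorem integrable_absDet_mul {Q : ℕ} {g : (Fin m × Fin m → ℝ) → ℝ}
    (hg : g ∈ polyLE (Fin m × Fin m) Q) :
    Integrable (fun y => absDet y * g y) (stdG (Fin m × Fin m)) :=
  integrable_abs_mul_of_mem_polyLE det_mem_polyLE hg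

theorem integrable_detPart_mul {k Q : ℕ} {g : (Fin m × Fin m → ℝ) → ℝ}
    (hg : g ∈ polyLE (Fin m × Fin m) Q) :
    Integrable (fun y => detPart m k y * g y) (stdG (Fin m × Fin m)) :=
  integrable_of_mem_polyLE (mul_mem_polyLE (detPart_mem_polyLE k) hg)

theorem integral_detPart_mul_hermProd (k : ℕ) (γ : Fin m × Fin m → ℕ) :
    ∫ y, detPart m k y * hermProd γ y ∂(stdG (Fin m × Fin m)) =
      if ∑ p, γ p = k then ∫ y, absDet y * hermProd γ y ∂(stdG (Fin m × Fin m)) else 0 := by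
  simp only [detPart, Finset.sum_mul, mul_assoc]
  rw [integral_finsetSum]
  · simp only [integral_const_mul, integral_hermProd_mul_hermProd]
    simp only [mul_ite, mul_zero, Finset.sum_ite_eq', Finset.mem_piAntidiag, Finset.mem_univ,
      implies_true, and_true]
    split_ifs with h
    · exact fCoeff_mul_factorial γ
    · rfl
  · intro β _
    exact (integrable_of_mem_polyLE
      (mul_mem_polyLE (hermProd_mem_polyLE β) (hermProd_mem_polyLE γ))).const_mul _

/-- The truncated Hermite expansion is the orthogonal projection of `|det|` onto the polynomials of
degree at most `Q`, so both have the same pairings with these. No convergence of the full expansion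
is needed. -/
theorem integral_absDet_mul {Q : ℕ} {g : (Fin m × Fin m → ℝ) → ℝ}
    (hg : g ∈ polyLE (Fin m × Fin m) Q) :
    ∫ y, absDet y * g y ∂(stdG (Fin m × Fin m)) =
      ∫ y, (∑ k ∈ Finset.range (Q + 1), detPart m k y) * g y ∂(stdG (Fin m × Fin m)) := by
  have hle := polyLE_le_span_hermProd (ι := Fin m × Fin m) Q
  have hint : ∀ g ∈ polyLE (Fin m × Fin m) Q, Integrable
      (fun y => (∑ k ∈ Finset.range (Q + 1), detPart m k y) * g y) (stdG (Fin m × Fin m)) := by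
    intro g hg
    simp only [Finset.sum_mul]
    exact integrable_finsetSum _ fun k _ => integrable_detPart_mul hg
  have hge : ∀ α ∈ hermProd '' {α : Fin m × Fin m → ℕ | ∑ i, α i ≤ Q},
      α ∈ polyLE (Fin m × Fin m) Q := by
    rintro _ ⟨α, hα, rfl⟩
    have hα' : ∑ p, α p ≤ Q := hα
    exact polyLE_mono hα' (hermProd_mem_polyLE α)
  have hsp := hle hg
  clear hg
  induction hsp using Submodule.span_induction with
  | mem x h =>
    obtain ⟨γ, hγ, rfl⟩ := h
    simp only [Finset.sum_mul]
    rw [integral_finsetSum _ fun k _ => integrable_detPart_mul (hermProd_mem_polyLE γ)]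
    simp only [integral_detPart_mul_hermProd]
    rw [Finset.sum_ite_eq, if_pos]
    simpa [Nat.lt_succ_iff] using hγ
  | zero => simp
  | add f g hf hg h1 h2 =>
    have hf' := Submodule.span_le.2 hge hf
    have hg' := Submodule.span_le.2 hge hg
    simp only [Pi.add_apply, mul_add]
    rw [integral_add (integrable_absDet_mul hf') (integrable_absDet_mul hg'),
      integral_add (hint _ hf') (hint _ hg'), h1, h2]
  | smul a f hf h1 =>
    simp only [Pi.smul_apply, smul_eq_mul, mul_left_comm _ a]
    rw [integral_const_mul, integral_const_mul, h1]

/-- Right multiplication by a matrix. -/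
def rightMul (O : Matrix (Fin m) (Fin m) ℝ) (y : Fin m × Fin m → ℝ) (p : Fin m × Fin m) : ℝ :=
  ∑ j, y (p.1, j) * O j p.2

theorem rightMul_apply_mem_affineFun (O : Matrix (Fin m) (Fin m) ℝ) (p : Fin m × Fin m) :
    (fun y => rightMul O y p) ∈ affineFun (Fin m × Fin m) := by
  have : (fun y => rightMul O y p) =
      ∑ j, O j p.2 • fun y : Fin m × Fin m → ℝ => y (p.1, j) := by
    funext y; simp [rightMul, mul_comm]
  rw [this]
  exact Submodule.sum_mem _ fun i _ => Submodule.smul_mem _ _ (coord_mem_affineFun _)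

theorem of_rightMul (O : Matrix (Fin m) (Fin m) ℝ) (y : Fin m × Fin m → ℝ) :
    (Matrix.of fun l k => rightMul O y (l, k)) = (Matrix.of fun l k => y (l, k)) * O := by
  ext l k; simp [rightMul, Matrix.mul_apply]

theorem rightMul_rightMul (O O' : Matrix (Fin m) (Fin m) ℝ) (y : Fin m × Fin m → ℝ) :
    rightMul O (rightMul O' y) = rightMul (O' * O) y := by
  funext ⟨l, k⟩
  simp only [rightMul, Matrix.mul_apply, Finset.sum_mul, Finset.mul_sum]
  rw [Finset.sum_comm]
  exact Finset.sum_congr rfl fun i _ => Finset.sum_congr rfl fun j _ => by ring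

theorem rightMul_one (y : Fin m × Fin m → ℝ) : rightMul 1 y = y := by
  funext ⟨l, k⟩; simp [rightMul, Matrix.one_apply]

theorem absDet_rightMul {O : Matrix (Fin m) (Fin m) ℝ} (hO : O.transpose * O = 1)
    (y : Fin m × Fin m → ℝ) : absDet (rightMul O y) = absDet y := by
  have h := congrArg Matrix.det hO
  rw [Matrix.det_mul, Matrix.det_transpose, Matrix.det_one] at h
  have h' : |O.det| = 1 := by
    have : |O.det| * |O.det| = 1 := by rw [← abs_mul, h, abs_one]
    nlinarith [abs_nonneg O.det]
  rw [absDet, of_rightMul, Matrix.det_mul, abs_mul, h', mul_one]; rfl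

theorem measurePreserving_rightMul {O : Matrix (Fin m) (Fin m) ℝ} (hO : O.transpose * O = 1) :
    MeasurePreserving (rightMul O) (stdG (Fin m × Fin m)) (stdG (Fin m × Fin m)) := by
  have := measurePreserving_of_gram_eq_one (ι := Fin m × Fin m) (κ := Fin m × Fin m)
    (fun p q => if p.1 = q.1 then O q.2 p.2 else 0) ?_
  · convert this using 1
    funext y p
    simp [rightMul, Fintype.sum_prod_type, mul_comm]
  · rintro ⟨l, k⟩ ⟨l', k'⟩
    have h := congrFun (congrFun hO k) k'
    simp only [Matrix.mul_apply, Matrix.transpose_apply, Matrix.one_apply] at h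
    by_cases hl : l = l'
    · subst hl
      simp only [Fintype.sum_prod_type, mul_ite, ite_mul, zero_mul, mul_zero]
      rw [Finset.sum_eq_single l (fun b _ hb => by simp [Ne.symm hb]) (by simp)]
      simp [h]
    · simp only [Fintype.sum_prod_type, Prod.mk.injEq, hl, false_and, if_false]
      refine Finset.sum_eq_zero fun i _ => Finset.sum_eq_zero fun j _ => ?_
      by_cases h1 : l = i
      · subst h1; simp [Ne.symm hl]
      · simp [h1]

/-- The truncated expansion `S` is determined by its pairings with polynomials of degree at most
`Q`, which are those of `|det|`. Both `|det|` and the Gaussian measure are invariant under `y ↦ y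
O`, so `S ∘ O` has the same pairings. -/
theorem sum_detPart_rightMul {O : Matrix (Fin m) (Fin m) ℝ} (hO : O.transpose * O = 1) (Q : ℕ)
    (y : Fin m × Fin m → ℝ) :
    ∑ k ∈ Finset.range (Q + 1), detPart m k (rightMul O y) =
      ∑ k ∈ Finset.range (Q + 1), detPart m k y := by
  set S : (Fin m × Fin m → ℝ) → ℝ := fun y => ∑ k ∈ Finset.range (Q + 1), detPart m k y with hS
  have hSm : S ∈ polyLE (Fin m × Fin m) Q := by
    have : S = ∑ k ∈ Finset.range (Q + 1), detPart m k := by funext y; simp [hS]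
    rw [this]
    exact Submodule.sum_mem _ fun k hk =>
      polyLE_mono (by simpa [Nat.lt_succ_iff] using hk) (detPart_mem_polyLE k)
  have hO' : O.transpose.transpose * O.transpose = 1 := by
    rw [Matrix.transpose_transpose]; exact mul_eq_one_comm.1 hO
  have hinv : ∀ y, rightMul O.transpose (rightMul O y) = y := fun y => by
    rw [rightMul_rightMul, mul_eq_one_comm.1 hO, rightMul_one]
  have hcomp : ∀ (O : Matrix (Fin m) (Fin m) ℝ), ∀ g ∈ polyLE (Fin m × Fin m) Q,
      (fun y => g (rightMul O y)) ∈ polyLE (Fin m × Fin m) Q := fun O g hg =>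
    comp_mem_polyLE (rightMul_apply_mem_affineFun O) hg
  have key : ∀ g ∈ polyLE (Fin m × Fin m) Q,
      ∫ y, S (rightMul O y) * g y ∂(stdG (Fin m × Fin m)) =
        ∫ y, S y * g y ∂(stdG (Fin m × Fin m)) := by
    intro g hg
    have mp := measurePreserving_rightMul hO
    have mv : ∀ F : (Fin m × Fin m → ℝ) → ℝ, Continuous F →
        ∫ y, F (rightMul O y) ∂(stdG (Fin m × Fin m)) = ∫ y, F y ∂(stdG (Fin m × Fin m)) := by
      intro F hF
      rw [← integral_map mp.aemeasurable hF.aestronglyMeasurable, mp.map_eq]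
    have cS := continuous_of_mem_polyLE hSm
    have hg' := hcomp O.transpose g hg
    have cg := continuous_of_mem_polyLE hg'
    have e1 := mv (fun y => S y * g (rightMul O.transpose y)) (cS.mul cg)
    have e2 := mv (fun y => absDet y * g (rightMul O.transpose y))
      ((continuous_of_mem_polyLE det_mem_polyLE).abs.mul cg)
    simp only [hinv] at e1 e2
    rw [e1, ← integral_absDet_mul hg', ← e2]
    simp only [absDet_rightMul hO]
    rw [integral_absDet_mul hg]
  have hD : (fun y => S (rightMul O y) - S y) ∈ polyLE (Fin m × Fin m) Q :=
    Submodule.sub_mem _ (hcomp O S hSm) hSm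
  -- The difference is itself an admissible test polynomial, so its `L²` norm vanishes; continuity
  -- and full support then make it vanish everywhere.
  have h0 : ∫ y, (S (rightMul O y) - S y) * (S (rightMul O y) - S y) ∂(stdG (Fin m × Fin m)) = 0 := by
    simp only [sub_mul (S (rightMul O _)) (S _)]
    rw [integral_sub, key _ hD, sub_self]
    · exact integrable_of_mem_polyLE (mul_mem_polyLE (hcomp O S hSm) hD)
    · exact integrable_of_mem_polyLE (mul_mem_polyLE hSm hD)
  rw [integral_eq_zero_iff_of_nonneg (fun y => mul_self_nonneg _)
    (integrable_of_mem_polyLE (mul_mem_polyLE hD hD))] at h0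
  have hc := continuous_of_mem_polyLE hD
  have := (hc.mul hc).ae_eq_iff_eq (stdG (Fin m × Fin m)) continuous_const |>.1 h0
  have h1 := congrFun this y
  have h2 : S (rightMul O y) - S y = 0 := mul_self_eq_zero.1 h1
  exact sub_eq_zero.1 h2

/-- A single order is the difference of two consecutive partial sums. This is what makes the
integrand independent of the tangent frame. -/
theorem detPart_rightMul {O : Matrix (Fin m) (Fin m) ℝ} (hO : O.transpose * O = 1) (k : ℕ)
    (y : Fin m × Fin m → ℝ) : detPart m k (rightMul O y) = detPart m k y := by
  have h1 := sum_detPart_rightMul hO k y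
  rcases k with _ | k
  · simpa using h1
  · have h2 := sum_detPart_rightMul hO k y
    rw [Finset.sum_range_succ, Finset.sum_range_succ _ (k + 1), h2] at h1
    exact add_left_cancel h1

end

end KSS
end

noncomputable section
namespace KSS

/-! ### The chaos components in orthonormal coordinates -/

section
variable {m : ℕ}

/-- The component of order `k` of the Hermite expansion of the Dirac mass at `0`. -/
def diracPart (m k : ℕ) (y : Fin m → ℝ) : ℝ :=
  ∑ α ∈ Finset.piAntidiag (Finset.univ : Finset (Fin m)) k, bCoeff α * hermProd α y

/-- The polynomial whose integral over the sphere is the chaos component of order `q`. -/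
def chaosPoly (m q : ℕ) (y : Fin m → ℝ) (y' : Fin m × Fin m → ℝ) : ℝ :=
  ∑ n ∈ Finset.HasAntidiagonal.antidiagonal q, diracPart m n.1 y * detPart m n.2 y'

theorem chaosIntegrand_eq {d : ℕ} (q : ℕ) (e : Frame m) (c : Fin m × DegIndex (m + 1) d → ℝ)
    (t : Sph m) : chaosIntegrand q e c t = chaosPoly m q (sysVal c t) (sysDeriv c e t) := by
  simp only [chaosIntegrand, chaosPoly, diracPart, detPart, Finset.sum_mul_sum]
  refine Finset.sum_congr rfl fun n _ => Finset.sum_congr rfl fun α _ =>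
    Finset.sum_congr rfl fun β _ => by ring

theorem diracPart_mem_polyLE (k : ℕ) : diracPart m k ∈ polyLE (Fin m) k := by
  have : diracPart m k = ∑ α ∈ Finset.piAntidiag (Finset.univ : Finset (Fin m)) k,
      bCoeff α • hermProd α := by
    funext y; simp [diracPart]
  rw [this]
  refine Submodule.sum_mem _ fun β hβ => Submodule.smul_mem _ _ ?_
  have := hermProd_mem_polyLE β
  rwa [(Finset.mem_piAntidiag.1 hβ).1] at this

theorem chaosPoly_comp_mem_polyLE {ι : Type*} (q : ℕ) {f : Fin m → (ι → ℝ) → ℝ}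
    {g : Fin m × Fin m → (ι → ℝ) → ℝ} (hf : ∀ i, f i ∈ affineFun ι)
    (hg : ∀ i, g i ∈ affineFun ι) :
    (fun x => chaosPoly m q (fun i => f i x) (fun i => g i x)) ∈ polyLE ι q := by
  have : (fun x => chaosPoly m q (fun i => f i x) (fun i => g i x)) =
      ∑ n ∈ Finset.HasAntidiagonal.antidiagonal q,
        (fun x => diracPart m n.1 fun i => f i x) * fun x => detPart m n.2 fun i => g i x := by
    funext x; simp [chaosPoly]
  rw [this]
  refine Submodule.sum_mem _ fun n hn => ?_
  have := mul_mem_polyLE (comp_mem_polyLE (u := fun x i => f i x) hf (diracPart_mem_polyLE n.1))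
    (comp_mem_polyLE (u := fun x i => g i x) hg (detPart_mem_polyLE n.2))
  rwa [Finset.HasAntidiagonal.mem_antidiagonal.1 hn] at this

theorem continuous_chaosPoly (q : ℕ) :
    Continuous fun p : (Fin m → ℝ) × (Fin m × Fin m → ℝ) => chaosPoly m q p.1 p.2 := by
  refine continuous_finsetSum _ fun n _ => ?_
  exact ((continuous_of_mem_polyLE (diracPart_mem_polyLE n.1)).comp continuous_fst).mul
    ((continuous_of_mem_polyLE (detPart_mem_polyLE n.2)).comp continuous_snd)

/-- Orthogonality keeps only the coefficient of `α`, and `herm_apply_zero` identifies it: against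
polynomials `diracPart` acts as evaluation at `0` times the Gaussian density there. -/
theorem integral_diracPart_mul_hermProd (k : ℕ) (α : Fin m → ℕ) :
    ∫ y, diracPart m k y * hermProd α y ∂(stdG (Fin m)) =
      if ∑ i, α i = k then (√(2 * Real.pi))⁻¹ ^ m * hermProd α 0 else 0 := by
  simp only [diracPart, Finset.sum_mul, mul_assoc]
  rw [integral_finsetSum]
  · simp only [integral_const_mul, integral_hermProd_mul_hermProd]
    simp only [mul_ite, mul_zero, Finset.sum_ite_eq', Finset.mem_piAntidiag, Finset.mem_univ,
      implies_true, and_true]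
    split_ifs with h
    · rw [bCoeff, ← Finset.prod_mul_distrib, hermProd,
        show (√(2 * Real.pi))⁻¹ ^ m = ∏ _i : Fin m, (√(2 * Real.pi))⁻¹ by simp,
        ← Finset.prod_mul_distrib]
      exact Finset.prod_congr rfl fun i _ => (herm_apply_zero _).symm
    · rfl
  · intro β _
    exact (integrable_of_mem_polyLE
      (mul_mem_polyLE (hermProd_mem_polyLE β) (hermProd_mem_polyLE α))).const_mul _

variable {ρ : Type*}

/-- The coordinates of a system at a point: values, normalized derivatives, and the remaining
ones. -/
abbrev Coord (m : ℕ) (ρ : Type*) : Type _ := Fin m ⊕ ((Fin m × Fin m) ⊕ ρ)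

/-- Set the value coordinates to zero. -/
def dropVal (x : Coord m ρ → ℝ) : Coord m ρ → ℝ := Sum.elim 0 fun i => x (Sum.inr i)

/-- The derivative coordinates. -/
def derivCoord (x : Coord m ρ → ℝ) : Fin m × Fin m → ℝ := fun p => x (Sum.inr (Sum.inl p))

/-- The value coordinates. -/
def valCoord (x : Coord m ρ → ℝ) : Fin m → ℝ := fun p => x (Sum.inl p)

theorem dropVal_mem_affineFun (i : Coord m ρ) :
    (fun x : Coord m ρ → ℝ => dropVal x i) ∈ affineFun (Coord m ρ) := by
  rcases i with i | i
  · exact Submodule.zero_mem _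
  · exact coord_mem_affineFun _

theorem chaosPoly_coord_mem_polyLE (q : ℕ) :
    (fun x : Coord m ρ → ℝ => chaosPoly m q (valCoord x) (derivCoord x)) ∈
      polyLE (Coord m ρ) q :=
  chaosPoly_comp_mem_polyLE q (fun _ => coord_mem_affineFun _) (fun _ => coord_mem_affineFun _)

variable [Fintype ρ]

theorem absDet_derivCoord_mul_integrable {Q : ℕ} {g : (Coord m ρ → ℝ) → ℝ}
    (hg : g ∈ polyLE (Coord m ρ) Q) :
    Integrable (fun x => absDet (derivCoord x) * g (dropVal x)) (stdG (Coord m ρ)) := by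
  have h1 : (fun x : Coord m ρ → ℝ => (Matrix.of fun l k => derivCoord x (l, k)).det) ∈
      polyLE (Coord m ρ) m :=
    comp_mem_polyLE (u := derivCoord) (fun _ => coord_mem_affineFun _) det_mem_polyLE
  exact integrable_abs_mul_of_mem_polyLE h1 (comp_mem_polyLE dropVal_mem_affineFun hg)

/-- The Gaussian measure factors over values, derivatives and remaining coordinates. The first two
factors each select one order, and the third contributes the same integral to both sides; hence the
condition involves only the degrees in the first two groups. -/
theorem integral_chaosPoly_mul_hermProd (q : ℕ) (κ : Coord m ρ → ℕ) :
    ∫ x, chaosPoly m q (valCoord x) (derivCoord x) * hermProd κ x ∂(stdG (Coord m ρ)) =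
      if ∑ i, κ (Sum.inl i) + ∑ p, κ (Sum.inr (Sum.inl p)) = q then
        (√(2 * Real.pi))⁻¹ ^ m *
          ∫ x, absDet (derivCoord x) * hermProd κ (dropVal x) ∂(stdG (Coord m ρ)) else 0 := by
  set a := ∑ i, κ (Sum.inl i)
  set b := ∑ p, κ (Sum.inr (Sum.inl p))
  have hfac : ∀ (F : (Fin m → ℝ) → ℝ) (G : (Fin m × Fin m → ℝ) → ℝ) (H : (ρ → ℝ) → ℝ),
      ∫ x : Coord m ρ → ℝ, F (valCoord x) * (G (derivCoord x) * H fun i => x (Sum.inr (Sum.inr i)))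
        ∂(stdG (Coord m ρ)) =
      (∫ y, F y ∂(stdG _)) * ((∫ y, G y ∂(stdG _)) * ∫ y, H y ∂(stdG _)) := by
    intro F G H
    rw [← integral_stdG_sum_mul G H]
    exact integral_stdG_sum_mul F
      (fun y : (Fin m × Fin m) ⊕ ρ → ℝ => G (fun p => y (Sum.inl p)) * H fun i => y (Sum.inr i))
  set H0 := ∫ y, hermProd (fun i => κ (Sum.inr (Sum.inr i))) y ∂(stdG ρ) with hH0
  set D0 := ∫ y, absDet y * hermProd (fun p => κ (Sum.inr (Sum.inl p))) y
    ∂(stdG (Fin m × Fin m)) with hD0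
  have hR : ∫ x, absDet (derivCoord x) * hermProd κ (dropVal x) ∂(stdG (Coord m ρ)) =
      hermProd (fun i => κ (Sum.inl i)) 0 * (D0 * H0) := by
    have := hfac (fun _ => hermProd (fun i => κ (Sum.inl i)) 0)
      (fun y => absDet y * hermProd (fun p => κ (Sum.inr (Sum.inl p))) y)
      (hermProd fun i => κ (Sum.inr (Sum.inr i)))
    rw [integral_const, probReal_univ, one_smul] at this
    rw [← hD0, ← hH0] at this
    rw [← this]
    congr 1
    funext x
    have h1 : hermProd κ (dropVal x) = hermProd (fun i => κ (Sum.inl i)) 0 *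
        (hermProd (fun p => κ (Sum.inr (Sum.inl p))) (derivCoord x) *
          hermProd (fun i => κ (Sum.inr (Sum.inr i))) fun i => x (Sum.inr (Sum.inr i))) := by
      rw [hermProd_sum κ, hermProd_sum fun i => κ (Sum.inr i)]; rfl
    rw [h1]
    ring
  have hterm : ∀ n : ℕ × ℕ, ∫ x, diracPart m n.1 (valCoord x) * detPart m n.2 (derivCoord x) *
      hermProd κ x ∂(stdG (Coord m ρ)) =
      if (a, b) = n then (√(2 * Real.pi))⁻¹ ^ m *
          ∫ x, absDet (derivCoord x) * hermProd κ (dropVal x) ∂(stdG (Coord m ρ)) else 0 := by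
    intro n
    have := hfac (fun y => diracPart m n.1 y * hermProd (fun i => κ (Sum.inl i)) y)
      (fun y => detPart m n.2 y * hermProd (fun p => κ (Sum.inr (Sum.inl p))) y)
      (hermProd fun i => κ (Sum.inr (Sum.inr i)))
    rw [integral_diracPart_mul_hermProd, integral_detPart_mul_hermProd, ← hH0, ← hD0] at this
    have e : (fun x : Coord m ρ → ℝ => diracPart m n.1 (valCoord x) *
        detPart m n.2 (derivCoord x) * hermProd κ x) = fun x =>
        diracPart m n.1 (valCoord x) * hermProd (fun i => κ (Sum.inl i)) (valCoord x) *
          (detPart m n.2 (derivCoord x) *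
            hermProd (fun p => κ (Sum.inr (Sum.inl p))) (derivCoord x) *
            hermProd (fun i => κ (Sum.inr (Sum.inr i))) fun i => x (Sum.inr (Sum.inr i))) := by
      funext x
      have h1 : hermProd κ x = hermProd (fun i => κ (Sum.inl i)) (valCoord x) *
          (hermProd (fun p => κ (Sum.inr (Sum.inl p))) (derivCoord x) *
            hermProd (fun i => κ (Sum.inr (Sum.inr i))) fun i => x (Sum.inr (Sum.inr i))) := by
        rw [hermProd_sum κ, hermProd_sum fun i => κ (Sum.inr i)]; rfl
      rw [h1]
      ring
    rw [e, this, hR]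
    rcases n with ⟨n1, n2⟩
    simp only [Prod.mk.injEq]
    by_cases h1 : a = n1
    · by_cases h2 : b = n2
      · rw [if_pos h1, if_pos h2, if_pos ⟨h1, h2⟩]; ring
      · rw [if_neg h2, if_neg (show ¬(a = n1 ∧ b = n2) from fun h => h2 h.2)]; ring
    · rw [if_neg h1, if_neg (show ¬(a = n1 ∧ b = n2) from fun h => h1 h.1)]; ring
  simp only [chaosPoly, Finset.sum_mul]
  rw [integral_finsetSum]
  · simp only [hterm, Finset.sum_ite_eq, Finset.HasAntidiagonal.mem_antidiagonal]
  · intro n _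
    refine integrable_of_mem_polyLE (Q := n.1 + n.2 + ∑ i, κ i)
      (mul_mem_polyLE (mul_mem_polyLE ?_ ?_) (hermProd_mem_polyLE κ))
    · exact comp_mem_polyLE (u := valCoord) (fun _ => coord_mem_affineFun _)
        (diracPart_mem_polyLE n.1)
    · exact comp_mem_polyLE (u := derivCoord) (fun _ => coord_mem_affineFun _)
        (detPart_mem_polyLE n.2)

/-- The algebraic core of the expansion: the expectation with the values set to zero, weighted by
`|det|`, equals the pairing with the chaos polynomials of order at most `Q`. For a Hermite product
exactly one `q` contributes, namely its degree in values and derivatives, and this is at most its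
total degree, hence at most `Q`. -/
theorem integral_absDet_dropVal {Q : ℕ} {g : (Coord m ρ → ℝ) → ℝ}
    (hg : g ∈ polyLE (Coord m ρ) Q) :
    (√(2 * Real.pi))⁻¹ ^ m *
        ∫ x, absDet (derivCoord x) * g (dropVal x) ∂(stdG (Coord m ρ)) =
      ∫ x, (∑ q ∈ Finset.range (Q + 1), chaosPoly m q (valCoord x) (derivCoord x)) * g x
        ∂(stdG (Coord m ρ)) := by
  have hle := polyLE_le_span_hermProd (ι := Coord m ρ) Q
  have hint : ∀ g ∈ polyLE (Coord m ρ) Q, Integrable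
      (fun x => (∑ q ∈ Finset.range (Q + 1), chaosPoly m q (valCoord x) (derivCoord x)) * g x)
      (stdG (Coord m ρ)) := by
    intro g hg
    simp only [Finset.sum_mul]
    exact integrable_finsetSum _ fun k _ =>
      integrable_of_mem_polyLE (mul_mem_polyLE (chaosPoly_coord_mem_polyLE k) hg)
  have hge : ∀ α ∈ hermProd '' {α : Coord m ρ → ℕ | ∑ i, α i ≤ Q},
      α ∈ polyLE (Coord m ρ) Q := by
    rintro _ ⟨α, hα, rfl⟩
    have hα' : ∑ p, α p ≤ Q := hα
    exact polyLE_mono hα' (hermProd_mem_polyLE α)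
  have hsp := hle hg
  clear hg
  induction hsp using Submodule.span_induction with
  | mem x h =>
    obtain ⟨κ, hκ, rfl⟩ := h
    simp only [Finset.sum_mul]
    rw [integral_finsetSum _ fun k _ => by
      exact integrable_of_mem_polyLE
        (mul_mem_polyLE (chaosPoly_coord_mem_polyLE k) (hermProd_mem_polyLE κ))]
    simp only [integral_chaosPoly_mul_hermProd]
    rw [Finset.sum_ite_eq, if_pos]
    have hκ' : ∑ i, κ i ≤ Q := hκ
    rw [Fintype.sum_sum_type, Fintype.sum_sum_type] at hκ'
    rw [Finset.mem_range]
    omega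
  | zero => simp
  | add f g hf hg h1 h2 =>
    have hf' := Submodule.span_le.2 hge hf
    have hg' := Submodule.span_le.2 hge hg
    simp only [Pi.add_apply, mul_add]
    rw [integral_add (absDet_derivCoord_mul_integrable hf') (absDet_derivCoord_mul_integrable hg'),
      integral_add (hint _ hf') (hint _ hg'), mul_add, h1, h2]
  | smul a f hf h1 =>
    simp only [Pi.smul_apply, smul_eq_mul, mul_left_comm _ a]
    rw [integral_const_mul, integral_const_mul, ← h1]
    ring

end

end KSS
end

noncomputable section
namespace KSS

/-! ### A bound for the number of roots of a generic system -/

section Lagrange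

variable {n : ℕ}

/-- A space of functions on a finite set of points that contains the constants and is stable under
multiplication by the coordinates contains all functions. -/
theorem eq_top_of_coord_mul_mem (F : Finset (Fin n → ℝ)) (W : Submodule ℝ (F → ℝ))
    (h1 : (fun _ => 1 : F → ℝ) ∈ W)
    (hW : ∀ i, ∀ f ∈ W, (fun x : F => (x : Fin n → ℝ) i * f x) ∈ W) : W = ⊤ := by
  classical
  have key : ∀ (x : F) (S : Finset F), x ∉ S → ∃ f ∈ W, f x ≠ 0 ∧ ∀ y ∈ S, f y = 0 := by
    intro x S
    induction S using Finset.induction_on with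
    | empty => exact fun _ => ⟨_, h1, one_ne_zero, by simp⟩
    | insert y S hy ih =>
      intro hx
      rw [Finset.mem_insert, not_or] at hx
      obtain ⟨f, hf, hfx, hfS⟩ := ih hx.2
      have hne : (x : Fin n → ℝ) ≠ y := fun h => hx.1 (Subtype.ext h)
      obtain ⟨i, hi⟩ := Function.ne_iff.1 hne
      -- Multiplication by `z i - y i`, with `i` a coordinate separating `x` from `y`, creates a
      -- zero at `y`, keeps the zeros on `S` and keeps the value at `x` nonzero.
      refine ⟨(fun z : F => (z : Fin n → ℝ) i * f z) - (y : Fin n → ℝ) i • f,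
        Submodule.sub_mem _ (hW i f hf) (Submodule.smul_mem _ _ hf), ?_, ?_⟩
      · have : (x : Fin n → ℝ) i * f x - (y : Fin n → ℝ) i * f x ≠ 0 := by
          rw [← sub_mul]; exact mul_ne_zero (sub_ne_zero.2 hi) hfx
        simpa using this
      · intro z hz
        rcases Finset.mem_insert.1 hz with rfl | hz
        · simp
        · simp [hfS z hz]
  rw [eq_top_iff]
  intro g _
  have hs : ∀ x : F, Pi.single x (1 : ℝ) ∈ W := by
    intro x
    obtain ⟨f, hf, hfx, hfS⟩ := key x (Finset.univ.erase x) (by simp)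
    have : Pi.single x (1 : ℝ) = (f x)⁻¹ • f := by
      funext y
      by_cases hy : y = x
      · subst hy; simp [hfx]
      · simp [hy, hfS y (by simp [hy])]
    rw [this]
    exact Submodule.smul_mem _ _ hf
  have : g = ∑ x, g x • Pi.single x (1 : ℝ) := by
    funext y; simp [Finset.sum_apply, Pi.single_apply]
  rw [this]
  exact Submodule.sum_mem _ fun x _ => Submodule.smul_mem _ _ (hs x)

/-- On `X` the span of the `f k` contains `1` and is stable under the coordinates, so on any finite
subset of `X` it is the whole function space. Comparing dimensions bounds the size of that subset.
-/
theorem encard_le_of_coord_mul_mem {ι : Type*} [Fintype ι] (X : Set (Fin n → ℝ))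
    (f : ι → (Fin n → ℝ) → ℝ)
    (h1 : ∃ a : ι → ℝ, ∀ x ∈ X, ∑ k, a k * f k x = 1)
    (hf : ∀ i k, ∃ a : ι → ℝ, ∀ x ∈ X, ∑ k', a k' * f k' x = x i * f k x) :
    X.encard ≤ Fintype.card ι := by
  by_contra! hlt
  -- A subset with exactly one point too many is enough, and is finite even when `X` is not.
  obtain ⟨Y, hYX, hY⟩ := Set.exists_subset_encard_eq (Order.add_one_le_of_lt hlt)
  have hfin : Y.Finite := Set.finite_of_encard_eq_coe (k := Fintype.card ι + 1) (by exact_mod_cast hY)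
  set F := hfin.toFinset with hF
  have hFX : ∀ x : F, (x : Fin n → ℝ) ∈ X := fun x => hYX (hfin.mem_toFinset.1 x.2)
  let g : ι → F → ℝ := fun k x => f k x
  have hmem : ∀ a : ι → ℝ, (fun x : F => ∑ k, a k * f k x) ∈ Submodule.span ℝ (Set.range g) := by
    intro a
    have : (fun x : F => ∑ k, a k * f k x) = ∑ k, a k • g k := by
      funext x; simp [g]
    rw [this]
    exact Submodule.sum_mem _ fun k _ => Submodule.smul_mem _ _ (Submodule.subset_span ⟨k, rfl⟩)
  have htop : Submodule.span ℝ (Set.range g) = ⊤ := by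
    apply eq_top_of_coord_mul_mem
    · obtain ⟨a, ha⟩ := h1
      convert hmem a using 2 with x
      exact (ha _ (hFX x)).symm
    · intro i h hh
      induction hh using Submodule.span_induction with
      | mem h hh =>
        obtain ⟨k, rfl⟩ := hh
        obtain ⟨a, ha⟩ := hf i k
        convert hmem a using 2 with x
        exact (ha _ (hFX x)).symm
      | zero => simp only [Pi.zero_apply, mul_zero]; exact Submodule.zero_mem _
      | add u v _ _ hu hv =>
        simp only [Pi.add_apply, mul_add]; exact Submodule.add_mem _ hu hv
      | smul b u _ hu =>
        simp only [Pi.smul_apply, smul_eq_mul, mul_left_comm _ b]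
        exact Submodule.smul_mem _ b hu
  have h2 : Fintype.card F ≤ Fintype.card ι := by
    have := finrank_range_le_card (R := ℝ) g
    rwa [Set.finrank, htop, finrank_top, Module.finrank_fintype_fun_eq_card] at this
  have h3 : Y.encard = Fintype.card F := by
    rw [Fintype.card_coe, hF, ← Set.encard_coe_eq_coe_finsetCard, Set.Finite.coe_toFinset]
  rw [hY] at h3
  have h4 : Fintype.card ι + 1 = Fintype.card F := by exact_mod_cast h3
  omega

end Lagrange

/-! ### Macaulay matrices and roots of generic systems. -/

section Generic

variable {m d : ℕ}

/-- The monomial `t^j`. -/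
def mon {n : ℕ} (j : Fin n → ℕ) (t : Fin n → ℝ) : ℝ := ∏ i, t i ^ j i

theorem mon_add {n : ℕ} (j k : Fin n → ℕ) (t : Fin n → ℝ) :
    mon (j + k) t = mon j t * mon k t := by
  simp [mon, pow_add, Finset.prod_mul_distrib]

theorem mon_single {n : ℕ} (i : Fin n) (a : ℕ) (t : Fin n → ℝ) :
    mon (Pi.single i a) t = t i ^ a := by
  rw [mon, Finset.prod_eq_single i]
  · simp
  · intro b _ hb; simp [hb]
  · simp

theorem mem_piAntidiag_univ {n d : ℕ} {j : Fin n → ℕ} :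
    j ∈ Finset.piAntidiag Finset.univ d ↔ ∑ i, j i = d := by
  simp [Finset.mem_piAntidiag]

/-- The degree in which the Macaulay matrix is taken. -/
def macDeg (m d : ℕ) : ℕ := m * (d - 1) + 1

/-- Pigeonhole: `m` exponents below `d` add up to at most `m (d - 1)`, one less than `macDeg m d`.
Thus every monomial of this degree without `t_0` is divisible by some `t_l^d`, and this `l` defines
a row of `macMat`. -/
theorem exists_le_of_zero (κ : DegIndex (m + 1) (macDeg m d)) (h0 : κ.1 0 = 0) :
    ∃ l : Fin m, d ≤ κ.1 l.succ := by
  by_contra! h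
  have h1 : ∑ i, κ.1 i = macDeg m d := mem_piAntidiag_univ.1 κ.2
  rw [Fin.sum_univ_succ, h0, zero_add] at h1
  have h2 : ∑ l : Fin m, κ.1 l.succ ≤ ∑ _l : Fin m, (d - 1) :=
    Finset.sum_le_sum fun l _ => Nat.le_sub_one_of_lt (h l)
  rw [h1] at h2
  simp [macDeg] at h2

/-- The Macaulay matrix of a system with respect to the hyperplane `t_0 = 0`. -/
def macMat (c : Fin m × DegIndex (m + 1) d → ℝ) :
    Matrix (DegIndex (m + 1) (macDeg m d)) (DegIndex (m + 1) (macDeg m d)) ℝ :=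
  Matrix.of fun κ κ' =>
    if h : κ.1 0 = 0 then
      ∑ j, c ((exists_le_of_zero κ h).choose, j) *
        if κ.1 - Pi.single (exists_le_of_zero κ h).choose.succ d + j.1 = κ'.1 then 1 else 0
    else if κ = κ' then 1 else 0

/-- The system `t_1^d, …, t_m^d`. -/
def diagSys (m d : ℕ) : Fin m × DegIndex (m + 1) d → ℝ :=
  fun p => if p.2.1 = Pi.single p.1.succ d then 1 else 0

theorem sub_single_add {n d : ℕ} {κ : Fin n → ℕ} {l : Fin n} (h : d ≤ κ l) :
    κ - Pi.single l d + Pi.single l d = κ := by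
  funext i
  by_cases hi : i = l
  · subst hi; simp [h]
  · simp [hi]

/-- For this system the row of `κ` expands `t^{κ - d e_l} t_l^d = t^κ`. It shows that the
determinant is not identically zero as a function of the coefficients. -/
theorem macMat_diagSys : macMat (diagSys m d) = 1 := by
  ext κ κ'
  simp only [macMat, Matrix.of_apply, Matrix.one_apply]
  split_ifs with h h' h'
  · subst h'
    set l := (exists_le_of_zero κ h).choose
    have hl : d ≤ κ.1 l.succ := (exists_le_of_zero κ h).choose_spec
    let j0 : DegIndex (m + 1) d := ⟨Pi.single l.succ d, mem_piAntidiag_univ.2 (by simp)⟩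
    rw [Finset.sum_eq_single j0]
    · simp [diagSys, j0, sub_single_add hl]
    · intro j _ hj
      have : j.1 ≠ Pi.single l.succ d := fun h => hj (Subtype.ext h)
      simp [diagSys, this]
    · simp
  · set l := (exists_le_of_zero κ h).choose
    have hl : d ≤ κ.1 l.succ := (exists_le_of_zero κ h).choose_spec
    refine Finset.sum_eq_zero fun j _ => ?_
    by_cases hj : j.1 = Pi.single l.succ d
    · rw [hj, sub_single_add hl, if_neg (fun e => h' (Subtype.ext e)), mul_zero]
    · simp [diagSys, hj]
  · rfl
  · rfl

theorem macMat_line (c v : Fin m × DegIndex (m + 1) d → ℝ) (s : ℝ) :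
    macMat (c + s • v) = macMat c + s • (macMat (c + v) - macMat c) := by
  ext κ κ'
  simp only [macMat, Matrix.of_apply, Matrix.add_apply, Matrix.smul_apply, Matrix.sub_apply,
    smul_eq_mul, Pi.add_apply, Pi.smul_apply]
  split_ifs with h h'
  · simp only [add_mul, Finset.sum_add_distrib, add_sub_cancel_left, Finset.mul_sum, mul_assoc]
  · simp
  · simp

/-- The entries of the matrix are affine in the coefficients, so on a line the determinant is a
polynomial in `s`; it equals `1` at `s = 0`. -/
theorem finite_det_macMat_line (v : Fin m × DegIndex (m + 1) d → ℝ) :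
    {s : ℝ | (macMat (diagSys m d + s • v)).det = 0}.Finite := by
  set A := macMat (diagSys m d)
  set B := macMat (diagSys m d + v) - A
  let M : Matrix (DegIndex (m + 1) (macDeg m d)) (DegIndex (m + 1) (macDeg m d)) (Polynomial ℝ) :=
    Matrix.of fun i j => Polynomial.C (A i j) + Polynomial.X * Polynomial.C (B i j)
  have he : ∀ s, M.det.eval s = (macMat (diagSys m d + s • v)).det := by
    intro s
    rw [macMat_line, ← Polynomial.coe_evalRingHom, RingHom.map_det]
    congr 1
    ext i j
    simp [M, A, B]
  have hne : M.det ≠ 0 := by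
    intro h
    have := he 0
    rw [h] at this
    simp [macMat_diagSys] at this
  refine (Polynomial.finite_setOfPred_isRoot hne).subset fun s hs => ?_
  have hs' : (macMat (diagSys m d + s • v)).det = 0 := hs
  rw [← he] at hs'
  exact hs'

theorem continuous_det_macMat :
    Continuous fun c : Fin m × DegIndex (m + 1) d → ℝ => (macMat c).det := by
  refine Continuous.matrix_det ?_
  refine continuous_matrix fun i j => ?_
  simp only [macMat, Matrix.of_apply]
  split_ifs with h h'
  · fun_prop
  · exact continuous_const
  · exact continuous_const

/-- A closed set that meets every line through a given point in a finite set is negligible. -/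
theorem volume_eq_zero_of_finite_lines {ι : Type*} [Fintype ι] {S : Set (ι → ℝ)} (hS : IsClosed S)
    (c₀ : ι → ℝ) (h : ∀ v : ι → ℝ, {s : ℝ | c₀ + s • v ∈ S}.Finite) : volume S = 0 := by
  have h1 : ∀ᵐ v : ι → ℝ, ∀ᵐ s : ℝ, c₀ + s • v ∉ S := by
    refine ae_of_all _ fun v => ?_
    rw [ae_iff]
    simpa using (h v).measure_zero volume
  have hm : MeasurableSet {p : (ι → ℝ) × ℝ | c₀ + p.2 • p.1 ∉ S} := by
    have : Continuous fun p : (ι → ℝ) × ℝ => c₀ + p.2 • p.1 := by fun_prop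
    exact (hS.preimage this).measurableSet.compl
  -- By Fubini, almost every scale `s` gives a null set of directions; one such `s ≠ 0` suffices,
  -- since `S` is the image of that set under a scaling and a translation.
  rw [Measure.ae_ae_comm hm] at h1
  have h2 : ∀ᵐ s : ℝ, s ≠ 0 := Measure.ae_ne volume 0
  obtain ⟨s, hs, hs0⟩ := (h1.and h2).exists
  have h3 : volume {v : ι → ℝ | c₀ + s • v ∈ S} = 0 := by
    rw [ae_iff] at hs
    simpa using hs
  have h4 : {v : ι → ℝ | c₀ + s • v ∈ S} = (fun v => s • v) ⁻¹' ((fun v => c₀ + v) ⁻¹' S) := rfl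
  rw [h4, Measure.addHaar_preimage_smul _ hs0, measure_preimage_add] at h3
  simpa [hs0] using h3

theorem ae_det_macMat_ne_zero :
    ∀ᵐ c : Fin m × DegIndex (m + 1) d → ℝ, (macMat c).det ≠ 0 := by
  rw [ae_iff]
  simp only [not_not]
  exact volume_eq_zero_of_finite_lines (isClosed_eq continuous_det_macMat continuous_const)
    (diagSys m d) finite_det_macMat_line

theorem homPoly_eq_sum_mon (c : DegIndex (m + 1) d → ℝ) (t : EuclideanSpace ℝ (Fin (m + 1))) :
    homPoly c t = ∑ j, c j * mon j.1 t := rfl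

/-- The rows of the Macaulay matrix at a common zero. -/
theorem macMat_mulVec {c : Fin m × DegIndex (m + 1) d → ℝ} {t : EuclideanSpace ℝ (Fin (m + 1))}
    (ht : ∀ l, homPoly (fun j => c (l, j)) t = 0) (κ : DegIndex (m + 1) (macDeg m d)) :
    ∑ κ', macMat c κ κ' * mon κ'.1 t = if κ.1 0 = 0 then 0 else mon κ.1 t := by
  simp only [macMat, Matrix.of_apply]
  split_ifs with h
  · set l := (exists_le_of_zero κ h).choose
    have hl : d ≤ κ.1 l.succ := (exists_le_of_zero κ h).choose_spec
    simp only [Finset.sum_mul]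
    rw [Finset.sum_comm]
    -- The row of `κ` lists the coefficients of `t^{κ - d e_l} Y_l(t)`, which vanishes at a common
    -- zero.
    have : ∀ j : DegIndex (m + 1) d, ∑ κ' : DegIndex (m + 1) (macDeg m d),
        c (l, j) * (if κ.1 - Pi.single l.succ d + j.1 = κ'.1 then 1 else 0) * mon κ'.1 t =
        mon (κ.1 - Pi.single l.succ d) t * (c (l, j) * mon j.1 t) := by
      intro j
      have hdeg : ∑ i, (κ.1 - (Pi.single l.succ d : Fin (m + 1) → ℕ) + j.1) i = macDeg m d := by
        have h1 : ∑ i, κ.1 i = macDeg m d := mem_piAntidiag_univ.1 κ.2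
        have h2 : ∑ i, j.1 i = d := mem_piAntidiag_univ.1 j.2
        have h3 := congrArg (fun f : Fin (m + 1) → ℕ => ∑ i, f i) (sub_single_add hl)
        simp only [Pi.add_apply, Finset.sum_add_distrib, h1, Finset.sum_pi_single',
          Finset.mem_univ, if_true] at h3
        simp only [Pi.add_apply, Finset.sum_add_distrib, h2]
        exact h3
      rw [Finset.sum_eq_single ⟨_, mem_piAntidiag_univ.2 hdeg⟩]
      · simp only [if_true, mon_add]; ring
      · intro b _ hb
        rw [if_neg]
        · ring
        · intro e; exact hb (Subtype.ext e.symm)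
      · simp
    simp only [this, ← Finset.mul_sum]
    rw [← homPoly_eq_sum_mon (fun j => c (l, j)), ht l, mul_zero]
  · simp

/-- Inverting the Macaulay matrix at a common zero expresses every monomial of degree `macDeg m d`
through those divisible by `t_0`. -/
theorem mon_eq_of_det_ne_zero {c : Fin m × DegIndex (m + 1) d → ℝ} (hc : (macMat c).det ≠ 0)
    {t : EuclideanSpace ℝ (Fin (m + 1))} (ht : ∀ l, homPoly (fun j => c (l, j)) t = 0)
    (κ : DegIndex (m + 1) (macDeg m d)) :
    mon κ.1 t = ∑ κ', (macMat c)⁻¹ κ κ' * if κ'.1 0 = 0 then 0 else mon κ'.1 t := by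
  have h1 : (macMat c).mulVec (fun κ' => mon κ'.1 t) =
      fun κ => if κ.1 0 = 0 then 0 else mon κ.1 t := funext fun κ => macMat_mulVec ht κ
  have h2 := congrArg ((macMat c)⁻¹).mulVec h1
  rw [Matrix.mulVec_mulVec, Matrix.nonsing_inv_mul _ (isUnit_iff_ne_zero.2 hc),
    Matrix.one_mulVec] at h2
  exact congrFun h2 κ

/-- If `t 0 = 0`, all monomials divisible by `t_0` vanish, hence all monomials of degree `macDeg m
d`, in particular the pure powers `t_i^{macDeg m d}`. A generic system therefore has no roots on the
equator. -/
theorem zero_coord_ne_zero {c : Fin m × DegIndex (m + 1) d → ℝ} (hc : (macMat c).det ≠ 0)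
    {t : EuclideanSpace ℝ (Fin (m + 1))} (ht : ∀ l, homPoly (fun j => c (l, j)) t = 0)
    (h : t ≠ 0) : t 0 ≠ 0 := by
  intro h0
  apply h
  ext i
  have hm := mon_eq_of_det_ne_zero hc ht ⟨Pi.single i (macDeg m d), mem_piAntidiag_univ.2 (by simp)⟩
  have hz := hm.trans (Finset.sum_eq_zero fun κ' _ => ?_)
  · simp only [mon_single] at hz
    simpa using eq_zero_of_pow_eq_zero hz
  · by_cases hk : κ'.1 0 = 0
    · rw [if_pos hk, mul_zero]
    · have : mon κ'.1 t = 0 :=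
        Finset.prod_eq_zero (Finset.mem_univ 0) (by rw [h0, zero_pow hk])
      rw [if_neg hk, this, mul_zero]

/-- In the chart `t 0 = 1` the monomials of degree `m (d - 1)` meet the criterion
`encard_le_of_coord_mul_mem`. The constant is the power of `t_0`, and `t_i t^k` has degree `macDeg m
d`, so at a root it is a combination of monomials divisible by `t_0`, from which one factor `t_0 =
1` can be removed. -/
theorem encard_affine_roots_le {c : Fin m × DegIndex (m + 1) d → ℝ} (hc : (macMat c).det ≠ 0) :
    {t : EuclideanSpace ℝ (Fin (m + 1)) | t 0 = 1 ∧ ∀ l, homPoly (fun j => c (l, j)) t = 0}.encard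
      ≤ Fintype.card (DegIndex (m + 1) (m * (d - 1))) := by
  set X := {t : EuclideanSpace ℝ (Fin (m + 1)) |
    t 0 = 1 ∧ ∀ l, homPoly (fun j => c (l, j)) t = 0} with hX
  rw [← (WithLp.ofLp_injective 2).encard_image X]
  refine encard_le_of_coord_mul_mem _ (fun κ : DegIndex (m + 1) (m * (d - 1)) => mon κ.1) ?_ ?_
  · refine ⟨Pi.single ⟨Pi.single 0 (m * (d - 1)), mem_piAntidiag_univ.2 (by simp)⟩ 1, ?_⟩
    rintro _ ⟨t, ⟨ht, -⟩, rfl⟩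
    rw [Finset.sum_eq_single ⟨Pi.single 0 (m * (d - 1)), mem_piAntidiag_univ.2 (by simp)⟩]
    · simp [mon_single, ht]
    · intro b _ hb; simp [hb]
    · simp
  · intro i k
    have hk : ∑ i, k.1 i = m * (d - 1) := mem_piAntidiag_univ.1 k.2
    have hdeg : ∑ i', (k.1 + (Pi.single i 1 : Fin (m + 1) → ℕ)) i' = macDeg m d := by
      simp [Finset.sum_add_distrib, hk, macDeg]
    have hk' : ∀ κ' : DegIndex (m + 1) (macDeg m d), κ'.1 0 ≠ 0 →
        ∑ i', (κ'.1 - (Pi.single 0 1 : Fin (m + 1) → ℕ)) i' = m * (d - 1) := by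
      intro κ' h0
      have h1 : ∑ i, κ'.1 i = macDeg m d := mem_piAntidiag_univ.1 κ'.2
      rw [← sub_single_add (d := 1) (Nat.one_le_iff_ne_zero.2 h0)] at h1
      simp only [Pi.add_apply, Finset.sum_add_distrib] at h1
      simp only [Finset.sum_pi_single', Finset.mem_univ, if_true, macDeg] at h1
      omega
    refine ⟨fun κ => ∑ κ' : DegIndex (m + 1) (macDeg m d),
      (macMat c)⁻¹ ⟨_, mem_piAntidiag_univ.2 hdeg⟩ κ' *
        if κ'.1 0 ≠ 0 ∧ κ.1 = κ'.1 - Pi.single 0 1 then 1 else 0, ?_⟩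
    rintro _ ⟨t, ⟨ht, ht'⟩, rfl⟩
    have hm := mon_eq_of_det_ne_zero hc ht' ⟨_, mem_piAntidiag_univ.2 hdeg⟩
    simp only [mon_add, mon_single, pow_one] at hm
    change _ = t i * mon k.1 t
    refine Eq.trans ?_ (hm.symm.trans (mul_comm _ _))
    simp only [Finset.sum_mul]
    rw [Finset.sum_comm]
    refine Finset.sum_congr rfl fun κ' _ => ?_
    by_cases h0 : κ'.1 0 = 0
    · simp [h0]
    · rw [Finset.sum_eq_single ⟨_, mem_piAntidiag_univ.2 (hk' κ' h0)⟩]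
      · simp only [h0, ne_eq, not_false_eq_true, and_self, if_true, if_false, mul_one]
        congr 1
        conv_rhs => rw [← sub_single_add (d := 1) (Nat.one_le_iff_ne_zero.2 h0)]
        rw [mon_add, mon_single, ht]
        simp
      · intro b _ hb
        rw [if_neg]
        · ring
        · exact fun e => hb (Subtype.ext e.2)
      · simp

theorem homPoly_smul (c : DegIndex (m + 1) d → ℝ) (a : ℝ) (t : EuclideanSpace ℝ (Fin (m + 1))) :
    homPoly c (a • t) = a ^ d * homPoly c t := by
  rw [homPoly, homPoly, Finset.mul_sum]
  refine Finset.sum_congr rfl fun j _ => ?_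
  have hj : ∑ i, j.1 i = d := mem_piAntidiag_univ.1 j.2
  simp only [PiLp.smul_apply, smul_eq_mul, mul_pow, Finset.prod_mul_distrib,
    Finset.prod_pow_eq_pow_sum, hj]
  ring

/-- Every root lies off the equator, so it is plus or minus the normalization of a root in the chart
`t 0 = 1`; hence the factor `2`. -/
theorem encard_roots_le {c : Fin m × DegIndex (m + 1) d → ℝ} (hc : (macMat c).det ≠ 0) :
    (roots c).encard ≤ 2 * Fintype.card (DegIndex (m + 1) (m * (d - 1))) := by
  set X := {t : EuclideanSpace ℝ (Fin (m + 1)) |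
    t 0 = 1 ∧ ∀ l, homPoly (fun j => c (l, j)) t = 0} with hX
  have hle : X.encard ≤ _ := encard_affine_roots_le hc
  rw [← Subtype.val_injective.encard_image]
  have hsub : Subtype.val '' roots c ⊆
      ((fun x => ‖x‖⁻¹ • x) '' X) ∪ ((fun x => -(‖x‖⁻¹ • x)) '' X) := by
    rintro _ ⟨t, ht, rfl⟩
    have ht' : ∀ l, homPoly (fun j => c (l, j)) t = 0 := ht
    have hn : ‖(t : EuclideanSpace ℝ (Fin (m + 1)))‖ = 1 := by simp
    have h0 := zero_coord_ne_zero hc ht' (by intro h; rw [h] at hn; simp at hn)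
    set a := (t : EuclideanSpace ℝ (Fin (m + 1))) 0
    have hx : a⁻¹ • (t : EuclideanSpace ℝ (Fin (m + 1))) ∈ X := by
      refine ⟨by simp [a, h0], fun l => ?_⟩
      rw [homPoly_smul, ht' l, mul_zero]
    have hnorm : ‖a⁻¹ • (t : EuclideanSpace ℝ (Fin (m + 1)))‖ = |a|⁻¹ := by
      rw [norm_smul, hn, mul_one, norm_inv, Real.norm_eq_abs]
    rcases lt_or_gt_of_ne h0 with h | h
    · refine Or.inr ⟨_, hx, ?_⟩
      simp only [hnorm, abs_of_neg h, inv_inv, smul_smul]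
      rw [neg_mul, mul_inv_cancel₀ h0]
      simp
    · refine Or.inl ⟨_, hx, ?_⟩
      simp only [hnorm, abs_of_pos h, inv_inv, smul_smul]
      rw [mul_inv_cancel₀ h0, one_smul]
  refine (Set.encard_le_encard hsub).trans ((Set.encard_union_le _ _).trans ?_)
  rw [two_mul]
  exact add_le_add ((Set.encard_image_le _ _).trans hle) ((Set.encard_image_le _ _).trans hle)

end Generic

end KSS
end

noncomputable section
namespace KSS

/-! ### Measurability of the number of points in a section -/

section Count

/-- Finitely many distinct points have mutual distances at least `1 / (n + 1)` for some `n`. For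
fixed `n` this separation is a closed condition, and projecting along the compact space of
`k`-tuples keeps the set closed. -/
theorem measurableSet_le_encard_section {V S : Type*} [TopologicalSpace V] [MeasurableSpace V]
    [BorelSpace V] [MetricSpace S] [CompactSpace S] {R : Set (V × S)} (hR : IsClosed R) (k : ℕ) :
    MeasurableSet {c : V | (k : ℕ∞) ≤ {t | (c, t) ∈ R}.encard} := by
  have h : {c : V | (k : ℕ∞) ≤ {t | (c, t) ∈ R}.encard} = ⋃ n : ℕ, Prod.fst ''
      {p : V × (Fin k → S) | (∀ i, (p.1, p.2 i) ∈ R) ∧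
        ∀ i j, i ≠ j → 1 / ((n : ℝ) + 1) ≤ dist (p.2 i) (p.2 j)} := by
    ext c
    simp only [Set.mem_ofPred_eq, Set.mem_iUnion, Set.mem_image, Prod.exists, exists_and_right,
      exists_eq_right]
    constructor
    · intro hc
      obtain ⟨T, hT, hTk⟩ := Set.exists_subset_encard_eq hc
      have hfin : T.Finite := Set.finite_of_encard_eq_coe hTk
      have hcard : hfin.toFinset.card = k := by
        have : T.encard = hfin.toFinset.card := by
          rw [← Set.encard_coe_eq_coe_finsetCard, Set.Finite.coe_toFinset]
        rw [hTk] at this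
        exact_mod_cast this.symm
      let e := hfin.toFinset.equivFinOfCardEq hcard
      let f : Fin k → S := fun i => (e.symm i : S)
      have hf : Function.Injective f := Subtype.val_injective.comp e.symm.injective
      have hpos : ∀ p : Fin k × Fin k, ∃ n : ℕ, p.1 ≠ p.2 →
          1 / ((n : ℝ) + 1) ≤ dist (f p.1) (f p.2) := by
        intro p
        by_cases hp : p.1 = p.2
        · exact ⟨0, fun h => absurd hp h⟩
        · obtain ⟨n, hn⟩ := exists_nat_one_div_lt (dist_pos.2 (hf.ne hp))
          exact ⟨n, fun _ => hn.le⟩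
      choose N hN using hpos
      refine ⟨Finset.univ.sup N, f, fun i => hT (hfin.mem_toFinset.1 (e.symm i).2), ?_⟩
      intro i j hij
      refine le_trans ?_ (hN (i, j) hij)
      have : N (i, j) ≤ Finset.univ.sup N := Finset.le_sup (Finset.mem_univ _)
      have : (N (i, j) : ℝ) ≤ (Finset.univ.sup N : ℕ) := by exact_mod_cast this
      gcongr
    · rintro ⟨n, f, hfR, hf⟩
      have hinj : Function.Injective f := by
        intro i j hij
        by_contra hne
        have := hf i j hne
        rw [hij, dist_self] at this
        have h2 : (0 : ℝ) < 1 / ((n : ℝ) + 1) := by positivity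
        linarith
      have hsub : Set.range f ⊆ {t | (c, t) ∈ R} := by
        rintro _ ⟨i, rfl⟩; exact hfR i
      refine le_trans ?_ (Set.encard_le_encard hsub)
      rw [← Set.image_univ, hinj.encard_image]
      simp
  rw [h]
  refine MeasurableSet.iUnion fun n => IsClosed.measurableSet ?_
  refine isClosedMap_fst_of_compactSpace _ ?_
  have he : {p : V × (Fin k → S) | (∀ i, (p.1, p.2 i) ∈ R) ∧
        ∀ i j, i ≠ j → 1 / ((n : ℝ) + 1) ≤ dist (p.2 i) (p.2 j)} =
      (⋂ i, (fun p : V × (Fin k → S) => (p.1, p.2 i)) ⁻¹' R) ∩ ⋂ i, ⋂ j, ⋂ _ : i ≠ j,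
        {p : V × (Fin k → S) | 1 / ((n : ℝ) + 1) ≤ dist (p.2 i) (p.2 j)} := by
    ext p; simp
  rw [he]
  refine (isClosed_iInter fun i => hR.preimage (by fun_prop)).inter ?_
  exact isClosed_iInter fun i => isClosed_iInter fun j => isClosed_iInter fun _ =>
    isClosed_le continuous_const (by fun_prop)

/-- The cardinality is the supremum of `k` over those `k` that it reaches, so measurability of the
superlevel sets is enough. -/
theorem measurable_count_section {V S : Type*} [TopologicalSpace V] [MeasurableSpace V]
    [BorelSpace V] [MetricSpace S] [CompactSpace S] [MeasurableSpace S] [BorelSpace S]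
    {R : Set (V × S)} (hR : IsClosed R) :
    Measurable fun c : V => Measure.count {t | (c, t) ∈ R} := by
  have h : (fun c : V => Measure.count {t | (c, t) ∈ R}) = fun c => ⨆ k : ℕ,
      {c : V | (k : ℕ∞) ≤ {t | (c, t) ∈ R}.encard}.indicator (fun _ => (k : ℝ≥0∞)) c := by
    funext c
    have hm : MeasurableSet {t | (c, t) ∈ R} := (hR.preimage (by fun_prop)).measurableSet
    rw [Measure.count_apply hm]
    apply le_antisymm
    · rcases eq_or_ne ({t | (c, t) ∈ R}.encard) ⊤ with htop | htop
      · have : ∀ k : ℕ, c ∈ {c : V | (k : ℕ∞) ≤ {t | (c, t) ∈ R}.encard} := fun k => by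
          simp only [Set.mem_ofPred_eq] at htop ⊢
          rw [htop]; exact le_top
        simp only [Set.indicator_of_mem (this _)]
        rw [ENNReal.iSup_natCast]
        exact le_top
      · obtain ⟨N, hN⟩ := ENat.ne_top_iff_exists.1 htop
        refine le_trans ?_ (le_iSup _ N)
        rw [Set.indicator_of_mem (by simp only [Set.mem_ofPred_eq]; exact hN.le), ← hN]
        simp
    · refine iSup_le fun k => ?_
      by_cases hk : c ∈ {c : V | (k : ℕ∞) ≤ {t | (c, t) ∈ R}.encard}
      · rw [Set.indicator_of_mem hk]
        have : (k : ℕ∞) ≤ {t | (c, t) ∈ R}.encard := hk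
        have h2 := ENat.toENNReal_le.2 this
        simpa using h2
      · rw [Set.indicator_of_notMem hk]; exact zero_le
  rw [h]
  exact Measurable.iSup fun k =>
    measurable_const.indicator (measurableSet_le_encard_section hR k)

end Count

/-! ### The area formula with multiplicity -/

section Area

variable {E : Type*} [NormedAddCommGroup E] [NormedSpace ℝ E] [FiniteDimensional ℝ E]

/-- The tolerance `δ` depends on `A` alone, as the partition theorem for approximately linear maps
requires; for singular `A` any value serves. -/
theorem exists_injOn_of_approximatesLinearOn (A : E →L[ℝ] E) :
    ∃ δ : NNReal, δ ≠ 0 ∧ (A.det ≠ 0 → ∀ (f : E → E) (s : Set E), ApproximatesLinearOn f A s δ →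
      Set.InjOn f s) := by
  by_cases hA : A.det ≠ 0
  · let B := A.toContinuousLinearEquivOfDetNeZero hA
    have hB : (B : E →L[ℝ] E) = A := A.coe_toContinuousLinearEquivOfDetNeZero hA
    rcases subsingleton_or_nontrivial E with hE | hE
    · exact ⟨1, one_ne_zero, fun _ f s _ => Set.injOn_of_injective (Function.injective_of_subsingleton f)⟩
    · have hpos : 0 < ‖(B.symm : E →L[ℝ] E)‖₊⁻¹ := inv_pos.2 B.nnnorm_symm_pos
      refine ⟨‖(B.symm : E →L[ℝ] E)‖₊⁻¹ / 2, (half_pos hpos).ne', fun _ f s hf => ?_⟩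
      rw [← hB] at hf
      exact hf.injOn (Or.inr (half_lt_self hpos))
  · exact ⟨1, one_ne_zero, fun h => absurd h hA⟩

variable [MeasurableSpace E] [BorelSpace E] (μ : Measure E) [μ.IsAddHaarMeasure]

/-- Away from the critical points the domain splits into countably many measurable pieces on which
`f` is injective. The injective change of variables applies to each piece, and the number of pieces
whose image contains `y` is the size of the fibre, provided `y` is not a critical value. Critical
values form a null set by Sard. -/
theorem lintegral_abs_det_mul_comp_eq_count {U : Set E} (hU : MeasurableSet U) {f : E → E}
    {f' : E → E →L[ℝ] E} (hf : ∀ x ∈ U, HasFDerivAt f (f' x) x)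
    (hdet : MeasurableSet {x | (f' x).det = 0}) {H : E → ℝ≥0∞} (hH : Measurable H) :
    ∫⁻ x in U, ENNReal.ofReal |(f' x).det| * H (f x) ∂μ =
      ∫⁻ y, Measure.count (U ∩ f ⁻¹' {y}) * H y ∂μ := by
  set C := U ∩ {x | (f' x).det = 0} with hC
  set N := U \ {x | (f' x).det = 0} with hN
  have hCm : MeasurableSet C := hU.inter hdet
  have hNm : MeasurableSet N := hU.diff hdet
  have hfN : ∀ x ∈ N, HasFDerivAt f (f' x) x := fun x hx => hf x hx.1
  choose r hr0 hr using exists_injOn_of_approximatesLinearOn (E := E)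
  obtain ⟨t, A, hdisj, htm, hcov, happ, hA⟩ :=
    exists_partition_approximatesLinearOn_of_hasFDerivWithinAt f N f'
      (fun x hx => (hfN x hx).hasFDerivWithinAt) r hr0
  have hinj : ∀ n, Set.InjOn f (N ∩ t n) := by
    intro n
    rcases N.eq_empty_or_nonempty with he | hne
    · rw [he, Set.empty_inter]; exact Set.injOn_empty _
    · obtain ⟨y, hy, hAy⟩ := hA hne n
      -- Each `A n` is the derivative at some point of `N`, hence invertible.
      exact hr (A n) (by rw [hAy]; exact hy.2) f _ (happ n)
  have hpm : ∀ n, MeasurableSet (N ∩ t n) := fun n => hNm.inter (htm n)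
  have hpd : Pairwise (Function.onFun Disjoint fun n => N ∩ t n) := fun i j hij =>
    (hdisj hij).mono Set.inter_subset_right Set.inter_subset_right
  have hNU : N = ⋃ n, N ∩ t n := by
    rw [← Set.inter_iUnion, Set.inter_eq_left.2 hcov]
  have hpf : ∀ n, ∀ x ∈ N ∩ t n, HasFDerivWithinAt f (f' x) (N ∩ t n) x := fun n x hx =>
    (hfN x hx.1).hasFDerivWithinAt
  have him : ∀ n, MeasurableSet (f '' (N ∩ t n)) := fun n =>
    measurable_image_of_fderivWithin (hpm n) (hpf n) (hinj n)
  -- the critical values are negligible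
  have hcrit : μ (f '' C) = 0 :=
    addHaar_image_eq_zero_of_det_fderivWithin_eq_zero μ
      (fun x hx => (hf x hx.1).hasFDerivWithinAt) (fun x hx => hx.2)
  have hL : ∫⁻ x in U, ENNReal.ofReal |(f' x).det| * H (f x) ∂μ =
      ∑' n, ∫⁻ x in N ∩ t n, ENNReal.ofReal |(f' x).det| * H (f x) ∂μ := by
    rw [← lintegral_iUnion hpm hpd, ← hNU]
    rw [← lintegral_inter_add_sdiff _ U hdet]
    rw [setLIntegral_congr_fun (g := fun _ => 0) hCm (fun x hx => by
      have : (f' x).det = 0 := hx.2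
      simp [this])]
    simp [hN]
  have hcount : ∀ y, y ∉ f '' C → Measure.count (U ∩ f ⁻¹' {y}) =
      ∑' n, (f '' (N ∩ t n)).indicator (fun _ => (1 : ℝ≥0∞)) y := by
    intro y hy
    have hs : ∀ n, (N ∩ t n ∩ f ⁻¹' {y}).Subsingleton := by
      intro n a ha b hb
      have h1 : f a = y := ha.2
      have h2 : f b = y := hb.2
      exact hinj n ha.1 hb.1 (h1.trans h2.symm)
    have he : U ∩ f ⁻¹' {y} = ⋃ n, N ∩ t n ∩ f ⁻¹' {y} := by
      rw [← Set.iUnion_inter, ← hNU]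
      ext x
      constructor
      · rintro ⟨hx, hxy⟩
        refine ⟨⟨hx, fun h => hy ⟨x, ⟨hx, h⟩, hxy⟩⟩, hxy⟩
      · rintro ⟨hx, hxy⟩; exact ⟨hx.1, hxy⟩
    rw [he, measure_iUnion (fun i j hij => (hpd hij).mono Set.inter_subset_left
      Set.inter_subset_left) (fun n => (hs n).measurableSet)]
    refine tsum_congr fun n => ?_
    rcases (hs n).eq_empty_or_singleton with h0 | ⟨x, hx⟩
    · rw [h0, measure_empty, Set.indicator_of_notMem]
      rintro ⟨x, hx, hxy⟩
      have : x ∈ (∅ : Set E) := h0 ▸ ⟨hx, hxy⟩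
      exact this
    · rw [hx, Measure.count_singleton, Set.indicator_of_mem]
      have : x ∈ N ∩ t n ∩ f ⁻¹' {y} := hx ▸ rfl
      exact ⟨x, this.1, this.2⟩
  rw [hL]
  have hR : ∫⁻ y, Measure.count (U ∩ f ⁻¹' {y}) * H y ∂μ =
      ∫⁻ y, ∑' n, (f '' (N ∩ t n)).indicator H y ∂μ := by
    apply lintegral_congr_ae
    have : ∀ᵐ y ∂μ, y ∉ f '' C := measure_eq_zero_iff_ae_notMem.1 hcrit
    filter_upwards [this] with y hy
    rw [hcount y hy, ← ENNReal.tsum_mul_right]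
    refine tsum_congr fun n => ?_
    by_cases h : y ∈ f '' (N ∩ t n)
    · simp [Set.indicator_of_mem h]
    · simp [Set.indicator_of_notMem h]
  rw [hR, lintegral_tsum fun n => (hH.indicator (him n)).aemeasurable]
  refine tsum_congr fun n => ?_
  rw [lintegral_indicator (him n),
    lintegral_image_eq_lintegral_abs_det_fderiv_mul μ (hpm n) (hpf n) (hinj n)]

end Area

/-! ### Polar coordinates -/

section Polar

theorem lintegral_volumeIoiPow (n : ℕ) {f : Set.Ioi (0 : ℝ) → ℝ≥0∞} (hf : Measurable f) :
    ∫⁻ r, f r ∂(Measure.volumeIoiPow n) =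
      ∫⁻ r : Set.Ioi (0 : ℝ), ENNReal.ofReal (r.1 ^ n) * f r ∂(Measure.comap Subtype.val volume) := by
  rw [Measure.volumeIoiPow, lintegral_withDensity_eq_lintegral_mul _ (by fun_prop) hf]
  rfl

theorem lintegral_polar {E : Type*} [NormedAddCommGroup E] [NormedSpace ℝ E]
    [FiniteDimensional ℝ E] [MeasurableSpace E] [BorelSpace E] [Nontrivial E] (μ : Measure E)
    [μ.IsAddHaarMeasure] {f : E → ℝ≥0∞} (hf : Measurable f) :
    ∫⁻ x, f x ∂μ = ∫⁻ t : Metric.sphere (0 : E) 1, (∫⁻ r in Set.Ioi (0 : ℝ),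
      ENNReal.ofReal (r ^ (Module.finrank ℝ E - 1)) * f (r • (t : E))) ∂μ.toSphere := by
  have h1 : ∫⁻ x, f x ∂μ = ∫⁻ x : ({0}ᶜ : Set E), f x ∂(μ.comap (↑)) := by
    rw [lintegral_subtype_comap (measurableSet_singleton _).compl, restrict_compl_singleton]
  have h2 := μ.measurePreserving_homeomorphUnitSphereProd.symm
    (homeomorphUnitSphereProd E).toMeasurableEquiv
  have h3 := h2.lintegral_comp (f := fun x : ({0}ᶜ : Set E) => f x) (by fun_prop)
  rw [h1, ← h3, lintegral_prod _ (by
    refine Measurable.aemeasurable ?_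
    exact hf.comp (measurable_subtype_coe.comp (MeasurableEquiv.measurable _)))]
  refine lintegral_congr fun t => ?_
  rw [← lintegral_subtype_comap measurableSet_Ioi fun r : ℝ =>
    ENNReal.ofReal (r ^ (Module.finrank ℝ E - 1)) * f (r • (t : E))]
  rw [lintegral_volumeIoiPow]
  · refine lintegral_congr fun r => ?_
    rfl
  · exact hf.comp (measurable_subtype_coe.comp ((MeasurableEquiv.measurable _).comp
      (measurable_const.prodMk measurable_id)))

end Polar

end KSS
end

noncomputable section
namespace KSS

/-! ### Derivatives of homogeneous polynomials -/

section Deriv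

variable {m d : ℕ}

/-- The Euclidean space of dimension `m + 1`. -/
abbrev Eucl (m : ℕ) : Type := EuclideanSpace ℝ (Fin (m + 1))

theorem contDiff_mon (j : Fin (m + 1) → ℕ) : ContDiff ℝ 1 fun t : Eucl m => mon j t := by
  unfold mon
  fun_prop

/-- The derivative at `t` of the monomial of exponent `j` in the direction `v`. -/
def dmon (j : Fin (m + 1) → ℕ) (t v : Eucl m) : ℝ := fderiv ℝ (fun t : Eucl m => mon j t) t v

theorem continuous_dmon (j : Fin (m + 1) → ℕ) :
    Continuous fun p : Eucl m × Eucl m => dmon j p.1 p.2 :=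
  (contDiff_mon j).continuous_fderiv_apply one_ne_zero

theorem hasFDerivAt_mon (j : Fin (m + 1) → ℕ) (t : Eucl m) :
    HasFDerivAt (fun t : Eucl m => mon j t) (fderiv ℝ (fun t : Eucl m => mon j t) t) t :=
  ((contDiff_mon j).differentiable one_ne_zero t).hasFDerivAt

/-- The derivative of `homPoly c` at `t`. -/
def homDeriv (c : DegIndex (m + 1) d → ℝ) (t : Eucl m) : Eucl m →L[ℝ] ℝ :=
  ∑ j, c j • fderiv ℝ (fun t : Eucl m => mon j.1 t) t

theorem homDeriv_apply (c : DegIndex (m + 1) d → ℝ) (t v : Eucl m) :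
    homDeriv c t v = ∑ j, c j * dmon j.1 t v := by
  simp [homDeriv, dmon]

theorem hasFDerivAt_homPoly (c : DegIndex (m + 1) d → ℝ) (t : Eucl m) :
    HasFDerivAt (homPoly c) (homDeriv c t) t := by
  have h : homPoly c = fun t : Eucl m => ∑ j, c j * mon j.1 t := rfl
  rw [h]
  exact HasFDerivAt.fun_sum fun j _ => (hasFDerivAt_mon j.1 t).const_mul (c j)

theorem inner_gradient_homPoly (c : DegIndex (m + 1) d → ℝ) (t v : Eucl m) :
    inner ℝ (gradient (homPoly c) t) v = homDeriv c t v := by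
  rw [gradient, (hasFDerivAt_homPoly c t).fderiv, InnerProductSpace.toDual_symm_apply]

theorem homDeriv_smul (hd : 1 ≤ d) (c : DegIndex (m + 1) d → ℝ) {r : ℝ} (hr : r ≠ 0)
    (t v : Eucl m) : homDeriv c (r • t) v = r ^ (d - 1) * homDeriv c t v := by
  have h1 : HasFDerivAt (fun x : Eucl m => homPoly c (r • x))
      ((homDeriv c (r • t)).comp (r • ContinuousLinearMap.id ℝ (Eucl m))) t :=
    (hasFDerivAt_homPoly c (r • t)).comp t ((hasFDerivAt_id t).const_smul r)
  have h2 : HasFDerivAt (fun x : Eucl m => homPoly c (r • x)) (r ^ d • homDeriv c t) t := by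
    simp only [homPoly_smul]
    exact (hasFDerivAt_homPoly c t).const_mul _
  have h3 := congrArg (fun L : Eucl m →L[ℝ] ℝ => L v) (h1.unique h2)
  simp only [ContinuousLinearMap.comp_apply, smul_apply,
    ContinuousLinearMap.id_apply, map_smul, smul_eq_mul] at h3
  have h4 : r ^ d = r * r ^ (d - 1) := by
    rw [← pow_succ', Nat.sub_add_cancel hd]
  rw [h4, mul_assoc] at h3
  exact mul_left_cancel₀ hr h3

/-- The exponent of the monomial `t_0^d`. -/
def idx0 (m d : ℕ) : DegIndex (m + 1) d := ⟨Pi.single 0 d, mem_piAntidiag_univ.2 (by simp)⟩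

/-- Subtract `y_l t_0^d` from the polynomials of a system. -/
def shift (c : Fin m × DegIndex (m + 1) d → ℝ) (y : Fin m → ℝ) :
    Fin m × DegIndex (m + 1) d → ℝ :=
  fun p => c p - y p.1 * if p.2 = idx0 m d then 1 else 0

theorem homPoly_shift (c : Fin m × DegIndex (m + 1) d → ℝ) (y : Fin m → ℝ) (l : Fin m)
    (t : Eucl m) :
    homPoly (fun j => shift c y (l, j)) t = homPoly (fun j => c (l, j)) t - y l * t 0 ^ d := by
  simp only [homPoly_eq_sum_mon, shift, sub_mul, Finset.sum_sub_distrib]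
  congr 1
  rw [Finset.sum_eq_single (idx0 m d)]
  · simp [idx0, mon_single]
  · intro b _ hb; simp [hb]
  · simp

/-- The quotients `Y_l(u) / u_0^d`. -/
def quot (c : Fin m × DegIndex (m + 1) d → ℝ) (u : Eucl m) (l : Fin m) : ℝ :=
  homPoly (fun j => c (l, j)) u / u 0 ^ d

theorem quot_smul (c : Fin m × DegIndex (m + 1) d → ℝ) {r : ℝ} (hr : r ≠ 0) (u : Eucl m) :
    quot c (r • u) = quot c u := by
  funext l
  simp only [quot, homPoly_smul, PiLp.smul_apply, smul_eq_mul, mul_pow]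
  rw [mul_div_mul_left _ _ (pow_ne_zero _ hr)]

/-- With `y` frozen at its value at `u`, the quotient is the shifted polynomial divided by `u_0^d`,
plus a constant. The shifted polynomial vanishes at `u`, so the derivative of the denominator does
not contribute. -/
theorem hasFDerivAt_quot (c : Fin m × DegIndex (m + 1) d → ℝ) {u : Eucl m} (hu : u 0 ≠ 0)
    (l : Fin m) :
    HasFDerivAt (fun u => quot c u l)
      ((u 0 ^ d)⁻¹ • homDeriv (fun j => shift c (quot c u) (l, j)) u) u := by
  set y := quot c u
  have hne : u 0 ^ d ≠ 0 := pow_ne_zero _ hu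
  have hP := hasFDerivAt_homPoly (fun j => shift c y (l, j)) u
  have hev : (fun u => quot c u l) =ᶠ[𝓝 u]
      fun u => homPoly (fun j => shift c y (l, j)) u * (u 0 ^ d)⁻¹ + y l := by
    have : ∀ᶠ x : Eucl m in 𝓝 u, x 0 ≠ 0 :=
      (by fun_prop : Continuous fun x : Eucl m => x 0).continuousAt.eventually_ne hu
    filter_upwards [this] with x hx
    rw [homPoly_shift, quot]
    have : x 0 ^ d ≠ 0 := pow_ne_zero _ hx
    field_simp
    ring
  have h0 : homPoly (fun j => shift c y (l, j)) u = 0 := by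
    rw [homPoly_shift]
    simp only [y, quot]
    field_simp
    ring
  have hg : DifferentiableAt ℝ (fun u : Eucl m => (u 0 ^ d)⁻¹) u := by
    refine DifferentiableAt.inv ?_ hne
    fun_prop
  have := (hP.mul hg.hasFDerivAt).add_const (y l)
  rw [h0, zero_smul, zero_add] at this
  exact this.congr_of_eventuallyEq hev

/-- The matrix with rows `u` and the gradients of the polynomials of the system at `u`. -/
def gradMat (c : Fin m × DegIndex (m + 1) d → ℝ) (u : Eucl m) :
    Matrix (Fin (m + 1)) (Fin (m + 1)) ℝ :=
  Matrix.of fun i k => Fin.cases (u k)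
    (fun l => homDeriv (fun j => c (l, j)) u (EuclideanSpace.single k 1)) i

theorem continuous_homDeriv :
    Continuous fun p : (DegIndex (m + 1) d → ℝ) × Eucl m × Eucl m => homDeriv p.1 p.2.1 p.2.2 := by
  simp only [homDeriv_apply]
  refine continuous_finsetSum _ fun j _ => ?_
  refine Continuous.mul (by fun_prop) ((continuous_dmon j.1).comp continuous_snd)

theorem continuous_det_gradMat :
    Continuous fun p : (Fin m × DegIndex (m + 1) d → ℝ) × Eucl m => (gradMat p.1 p.2).det := by
  refine Continuous.matrix_det (continuous_matrix fun i k => ?_)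
  refine Fin.cases ?_ (fun l => ?_) i
  · simp only [gradMat, Matrix.of_apply, Fin.cases_zero]
    fun_prop
  · simp only [gradMat, Matrix.of_apply, Fin.cases_succ]
    exact continuous_homDeriv.comp (f := fun p : (Fin m × DegIndex (m + 1) d → ℝ) × Eucl m =>
      ((fun j => p.1 (l, j)), p.2, (EuclideanSpace.single k 1 : Eucl m))) (by fun_prop)

theorem det_gradMat_smul (hd : 1 ≤ d) (c : Fin m × DegIndex (m + 1) d → ℝ) {r : ℝ} (hr : r ≠ 0)
    (u : Eucl m) : (gradMat c (r • u)).det = r * (r ^ (d - 1)) ^ m * (gradMat c u).det := by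
  have : gradMat c (r • u) = Matrix.of fun i k =>
      (Fin.cases r (fun _ => r ^ (d - 1)) i : ℝ) * gradMat c u i k := by
    ext i k
    refine Fin.cases ?_ (fun l => ?_) i
    · simp [gradMat]
    · simp [gradMat, homDeriv_smul hd _ hr]
  rw [this, Matrix.det_mul_column, Fin.prod_univ_succ]
  simp

end Deriv

end KSS
end

noncomputable section
namespace KSS

/-! ### The area formula on the sphere -/

section SphereArea

variable {m d : ℕ}

/-- The map `u ↦ (|u|², Y_1(u) / u_0^d, …, Y_m(u) / u_0^d)`. -/
def coneMap (c : Fin m × DegIndex (m + 1) d → ℝ) (u : Eucl m) : Eucl m :=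
  WithLp.toLp 2 (Fin.cons (‖u‖ ^ 2) (quot c u))

/-- The matrix of the derivative of `coneMap`. -/
def coneMat (c : Fin m × DegIndex (m + 1) d → ℝ) (u : Eucl m) :
    Matrix (Fin (m + 1)) (Fin (m + 1)) ℝ :=
  Matrix.of fun i k => (Fin.cases 2 (fun _ => (u 0 ^ d)⁻¹) i : ℝ) *
    gradMat (shift c (quot c u)) u i k

/-- The derivative of `coneMap`. -/
def coneDeriv (c : Fin m × DegIndex (m + 1) d → ℝ) (u : Eucl m) : Eucl m →L[ℝ] Eucl m :=
  LinearMap.toContinuousLinearMap (Matrix.toLin (EuclideanSpace.basisFun (Fin (m + 1)) ℝ).toBasis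
    (EuclideanSpace.basisFun (Fin (m + 1)) ℝ).toBasis (coneMat c u))

theorem coneDeriv_apply (c : Fin m × DegIndex (m + 1) d → ℝ) (u v : Eucl m) (i : Fin (m + 1)) :
    coneDeriv c u v i = ∑ k, coneMat c u i k * v k := by
  have : (EuclideanSpace.basisFun (Fin (m + 1)) ℝ).toBasis.repr (coneDeriv c u v) i =
      (coneMat c u).mulVec ((EuclideanSpace.basisFun (Fin (m + 1)) ℝ).toBasis.repr v) i := by
    rw [coneDeriv, LinearMap.coe_toContinuousLinearMap', Matrix.repr_toLin]
  simpa [Matrix.mulVec, dotProduct] using! this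

/-- The coordinate `‖u‖²` makes `coneMap` a map between spaces of equal dimension. It contributes
the row `2u`, and each quotient contributes a gradient divided by `u_0^d`. -/
theorem det_coneDeriv (c : Fin m × DegIndex (m + 1) d → ℝ) (u : Eucl m) :
    (coneDeriv c u).det = 2 * ((u 0 ^ d)⁻¹) ^ m * (gradMat (shift c (quot c u)) u).det := by
  have h : (coneDeriv c u).det = (coneMat c u).det := by
    rw [ContinuousLinearMap.det, coneDeriv, LinearMap.coe_toContinuousLinearMap,
      LinearMap.det_toLin]
  rw [h, coneMat, Matrix.det_mul_column, Fin.prod_univ_succ]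
  simp

theorem apply_eq_sum_single (L : Eucl m →L[ℝ] ℝ) (v : Eucl m) :
    L v = ∑ k, L (EuclideanSpace.single k 1) * v k := by
  conv_lhs => rw [← (EuclideanSpace.basisFun (Fin (m + 1)) ℝ).sum_repr v]
  simp [map_sum, mul_comm]

theorem hasFDerivAt_coneMap (c : Fin m × DegIndex (m + 1) d → ℝ) {u : Eucl m} (hu : u 0 ≠ 0) :
    HasFDerivAt (coneMap c) (coneDeriv c u) u := by
  rw [← hasFDerivWithinAt_univ, hasFDerivWithinAt_euclidean]
  intro i
  rw [hasFDerivWithinAt_univ]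
  refine Fin.cases ?_ (fun l => ?_) i
  · have h1 : HasFDerivAt (fun u : Eucl m => ‖u‖ ^ 2) (2 • innerSL ℝ u) u :=
      (hasStrictFDerivAt_norm_sq u).hasFDerivAt
    refine (h1.congr_fderiv ?_)
    ext v
    simp only [ContinuousLinearMap.comp_apply]
    change _ = coneDeriv c u v 0
    rw [coneDeriv_apply]
    simp [coneMat, gradMat, PiLp.inner_apply, Finset.mul_sum, mul_comm, mul_assoc]
  · refine (hasFDerivAt_quot c hu l).congr_fderiv ?_
    ext v
    simp only [ContinuousLinearMap.comp_apply]
    change _ = coneDeriv c u v l.succ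
    rw [coneDeriv_apply, smul_apply, apply_eq_sum_single, Finset.smul_sum]
    simp [coneMat, gradMat, mul_assoc]

theorem continuous_homPoly :
    Continuous fun p : (DegIndex (m + 1) d → ℝ) × Eucl m => homPoly p.1 p.2 := by
  unfold homPoly
  fun_prop

theorem measurable_quot :
    Measurable fun p : (Fin m × DegIndex (m + 1) d → ℝ) × Eucl m => quot p.1 p.2 := by
  refine measurable_pi_lambda _ fun l => ?_
  unfold quot
  refine Measurable.div ?_ (by fun_prop)
  exact (continuous_homPoly.comp (f := fun p : (Fin m × DegIndex (m + 1) d → ℝ) × Eucl m =>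
    ((fun j => p.1 (l, j)), p.2)) (by fun_prop)).measurable

theorem continuous_shift :
    Continuous fun p : (Fin m × DegIndex (m + 1) d → ℝ) × (Fin m → ℝ) => shift p.1 p.2 := by
  unfold shift
  fun_prop

theorem measurable_shift_quot :
    Measurable fun p : (Fin m × DegIndex (m + 1) d → ℝ) × Eucl m => shift p.1 (quot p.1 p.2) :=
  continuous_shift.measurable.comp (measurable_fst.prodMk measurable_quot)

theorem measurable_det_gradMat_shift_quot :
    Measurable fun p : (Fin m × DegIndex (m + 1) d → ℝ) × Eucl m =>
      (gradMat (shift p.1 (quot p.1 p.2)) p.2).det := by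
  have h := continuous_det_gradMat (m := m) (d := d) |>.measurable.comp
    (measurable_shift_quot.prodMk measurable_snd)
  exact h

/-- The Jacobian of `t ↦ Y(t) / t_0^d` on the sphere. -/
def quotJac (c : Fin m × DegIndex (m + 1) d → ℝ) (t : Eucl m) : ℝ :=
  |((t 0 ^ d)⁻¹) ^ m * (gradMat (shift c (quot c t)) t).det|

theorem measurable_quotJac :
    Measurable fun p : (Fin m × DegIndex (m + 1) d → ℝ) × Eucl m => quotJac p.1 p.2 := by
  unfold quotJac
  exact ((by fun_prop : Measurable fun p : (Fin m × DegIndex (m + 1) d → ℝ) × Eucl m =>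
    ((p.2 0 ^ d)⁻¹) ^ m).mul measurable_det_gradMat_shift_quot).norm

/-- The polar Jacobian `r^m` and the scaling `r · r^{(d-1)m} / r^{dm}` of the determinant combine to
`r`. Together with the `2` from `‖u‖²` this leaves the radial weight `2r`, whose integral over `(0,
1)` is `1`. -/
theorem abs_det_coneDeriv_smul (hd : 1 ≤ d) (c : Fin m × DegIndex (m + 1) d → ℝ) {r : ℝ}
    (hr : 0 < r) (t : Eucl m) :
    r ^ m * |(coneDeriv c (r • t)).det| = 2 * r * quotJac c t := by
  rw [det_coneDeriv, quot_smul c hr.ne', det_gradMat_smul hd _ hr.ne', quotJac]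
  simp only [PiLp.smul_apply, smul_eq_mul, mul_pow, abs_mul, mul_inv, abs_pow, abs_inv,
    abs_of_pos hr, abs_two]
  have h : r ^ d = r * r ^ (d - 1) := by rw [← pow_succ', Nat.sub_add_cancel hd]
  rw [h]
  have h1 : r ^ m * ((r * r ^ (d - 1))⁻¹) ^ m * (r ^ (d - 1)) ^ m = 1 := by
    rw [← mul_pow, ← mul_pow]
    have : r * (r * r ^ (d - 1))⁻¹ * r ^ (d - 1) = 1 := by
      have := hr.ne'
      have : r ^ (d - 1) ≠ 0 := pow_ne_zero _ hr.ne'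
      field_simp
    rw [this, one_pow]
  linear_combination (2 * r * ((|t 0| ^ d)⁻¹) ^ m * |(gradMat (shift c (quot c t)) t).det|) * h1

/-- The truncated cone over the complement of the equator. -/
def coneSet (m : ℕ) : Set (Eucl m) := {u | u 0 ≠ 0 ∧ ‖u‖ < 1}

theorem measurableSet_coneSet : MeasurableSet (coneSet m) := by
  have h : IsOpen (coneSet m) :=
    (isOpen_ne_fun (by fun_prop : Continuous fun u : Eucl m => u 0) continuous_const).inter
      (isOpen_lt continuous_norm continuous_const)
  exact h.measurableSet

theorem lintegral_two_mul_Ioo : ∫⁻ r in Set.Ioo (0 : ℝ) 1, ENNReal.ofReal (2 * r) = 1 := by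
  have hi : IntegrableOn (fun r : ℝ => 2 * r) (Set.Ioo 0 1) :=
    ((by fun_prop : Continuous fun r : ℝ => 2 * r).integrableOn_Icc).mono_set Set.Ioo_subset_Icc_self
  rw [← ofReal_integral_eq_lintegral_ofReal hi]
  · rw [← integral_Ioc_eq_integral_Ioo, ← intervalIntegral.integral_of_le zero_le_one]
    rw [intervalIntegral.integral_const_mul, integral_id]
    norm_num
  · filter_upwards [ae_restrict_mem measurableSet_Ioo] with r hr
    have := hr.1
    simp only [Pi.zero_apply]; positivity

/-- The number of roots, as an extended nonnegative number. -/
def numRoots (c : Fin m × DegIndex (m + 1) d → ℝ) : ℝ≥0∞ := Measure.count (roots c)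

theorem isClosed_roots_graph :
    IsClosed {p : (Fin m × DegIndex (m + 1) d → ℝ) × Sph m | p.2 ∈ roots p.1} := by
  have : {p : (Fin m × DegIndex (m + 1) d → ℝ) × Sph m | p.2 ∈ roots p.1} =
      ⋂ l, {p | homPoly (fun j => p.1 (l, j)) (p.2 : Eucl m) = 0} := by
    ext p; simp [roots, sysVal]
  rw [this]
  refine isClosed_iInter fun l => isClosed_eq ?_ continuous_const
  exact continuous_homPoly.comp (f := fun p : (Fin m × DegIndex (m + 1) d → ℝ) × Sph m =>
    ((fun j => p.1 (l, j)), (p.2 : Eucl m))) (by fun_prop)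

theorem measurable_numRoots :
    Measurable (numRoots : (Fin m × DegIndex (m + 1) d → ℝ) → ℝ≥0∞) :=
  measurable_count_section isClosed_roots_graph

theorem lintegral_eucl {F : Eucl m → ℝ≥0∞} :
    ∫⁻ w, F w = ∫⁻ p : ℝ × (Fin m → ℝ), F (WithLp.toLp 2 (Fin.cons p.1 p.2)) := by
  rw [← (PiLp.volume_preserving_toLp (Fin (m + 1))).lintegral_comp_emb
    (MeasurableEquiv.toLp 2 (Fin (m + 1) → ℝ)).measurableEmbedding,
    ← ((volume_preserving_piFinSuccAbove (fun _ : Fin (m + 1) => ℝ) 0).symm).lintegral_comp_emb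
    (MeasurableEquiv.measurableEmbedding _)]
  simp only [MeasurableEquiv.piFinSuccAbove_symm_apply, Fin.insertNthEquiv, Equiv.coe_fn_mk,
    Fin.insertNth_zero]
  rfl

/-- The quotient is homogeneous of degree zero, so the fibre over `(s, y)` consists of the points
`√s t` with `t` a root of the system shifted by `y`. -/
theorem count_coneSet_inter (c : Fin m × DegIndex (m + 1) d → ℝ)
    (hc : ∀ t : Sph m, (∀ l, homPoly (fun j => c (l, j)) (t : Eucl m) = 0) → (t : Eucl m) 0 ≠ 0)
    (hd : 1 ≤ d) (s : ℝ) (y : Fin m → ℝ) :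
    Measure.count (coneSet m ∩ coneMap c ⁻¹' {WithLp.toLp 2 (Fin.cons s y)}) =
      (Set.Ioo (0 : ℝ) 1).indicator 1 s * numRoots (shift c y) := by
  have hmem : ∀ u : Eucl m, u ∈ coneSet m ∩ coneMap c ⁻¹' {WithLp.toLp 2 (Fin.cons s y)} ↔
      u 0 ≠ 0 ∧ ‖u‖ < 1 ∧ ‖u‖ ^ 2 = s ∧ quot c u = y := by
    intro u
    simp only [coneSet, coneMap, Set.mem_inter_iff, Set.mem_ofPred_eq, Set.mem_preimage,
      Set.mem_singleton_iff, and_assoc]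
    rw [(WithLp.toLp_injective 2).eq_iff, Fin.cons_inj]
  by_cases hs : s ∈ Set.Ioo (0 : ℝ) 1
  · have hsq : 0 < √s := Real.sqrt_pos.2 hs.1
    have hinj : Function.Injective fun t : Sph m => √s • (t : Eucl m) := by
      intro t t' h
      exact Subtype.ext (smul_right_injective _ hsq.ne' h)
    have him : coneSet m ∩ coneMap c ⁻¹' {WithLp.toLp 2 (Fin.cons s y)} =
        (fun t : Sph m => √s • (t : Eucl m)) '' roots (shift c y) := by
      ext u
      rw [hmem]
      constructor
      · rintro ⟨h0, -, hn, hq⟩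
        have hnorm : ‖u‖ = √s := by rw [← hn, Real.sqrt_sq (norm_nonneg _)]
        have hu : (√s)⁻¹ • u ∈ Metric.sphere (0 : Eucl m) 1 := by
          rw [mem_sphere_zero_iff_norm, norm_smul, hnorm, norm_inv, Real.norm_eq_abs,
            abs_of_pos hsq, inv_mul_cancel₀ hsq.ne']
        refine ⟨⟨_, hu⟩, ?_, ?_⟩
        · intro l
          simp only [sysVal]
          rw [homPoly_shift, homPoly_smul, ← hq, quot]
          simp only [PiLp.smul_apply, smul_eq_mul, mul_pow]
          have : u 0 ^ d ≠ 0 := pow_ne_zero _ h0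
          field_simp
          ring
        · simp only [smul_smul]
          rw [mul_inv_cancel₀ hsq.ne', one_smul]
      · rintro ⟨t, ht, rfl⟩
        have ht' : ∀ l, homPoly (fun j => c (l, j)) (t : Eucl m) = y l * (t : Eucl m) 0 ^ d := by
          intro l
          have := ht l
          simp only [sysVal] at this
          rw [homPoly_shift] at this
          linarith
        have hn : ‖(t : Eucl m)‖ = 1 := by simp
        have h0 : (t : Eucl m) 0 ≠ 0 := by
          -- On the equator the subtracted term `y_l t_0^d` vanishes because `d ≥ 1`, so a root
          -- there of the shifted system would also be a root of the original one.
          intro h0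
          refine hc t (fun l => ?_) h0
          rw [ht' l, h0, zero_pow (by omega), mul_zero]
        have hnorm : ‖√s • (t : Eucl m)‖ = √s := by
          rw [norm_smul, hn, mul_one, Real.norm_eq_abs, abs_of_pos hsq]
        refine ⟨?_, ?_, ?_, ?_⟩
        · simp only [PiLp.smul_apply, smul_eq_mul]
          exact mul_ne_zero hsq.ne' h0
        · rw [hnorm, Real.sqrt_lt' one_pos]; simpa using hs.2
        · rw [hnorm, Real.sq_sqrt hs.1.le]
        · rw [quot_smul c hsq.ne']
          funext l
          rw [quot, ht' l]
          have : (t : Eucl m) 0 ^ d ≠ 0 := pow_ne_zero _ h0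
          field_simp
    rw [him, Measure.count_injective_image hinj, Set.indicator_of_mem hs]
    simp [numRoots]
  · have he : coneSet m ∩ coneMap c ⁻¹' {WithLp.toLp 2 (Fin.cons s y)} = ∅ := by
      rw [Set.eq_empty_iff_forall_notMem]
      intro u hu
      rw [hmem] at hu
      obtain ⟨h0, h1, h2, -⟩ := hu
      apply hs
      have hpos : 0 < ‖u‖ := norm_pos_iff.2 (fun h => h0 (by simp [h]))
      rw [← h2]
      exact ⟨by positivity, by nlinarith⟩
    rw [he, Set.indicator_of_notMem hs]
    simp

/-- This is the area formula for `t ↦ Y(t)/t_0^d` on the sphere without its equator. It follows from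
the Euclidean one for `coneMap`: the radial variable contributes a factor `1` to both sides. -/
theorem lintegral_quotJac (hd : 1 ≤ d) (c : Fin m × DegIndex (m + 1) d → ℝ)
    (hc : ∀ t : Sph m, (∀ l, homPoly (fun j => c (l, j)) (t : Eucl m) = 0) → (t : Eucl m) 0 ≠ 0)
    {h : (Fin m → ℝ) → ℝ≥0∞} (hh : Measurable h) :
    ∫⁻ t in {t : Sph m | (t : Eucl m) 0 ≠ 0}, ENNReal.ofReal (quotJac c t) * h (quot c t) ∂(surf m) =
      ∫⁻ y, numRoots (shift c y) * h y := by
  have hqm : Measurable (quot c) :=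
    measurable_quot.comp (f := fun u : Eucl m => (c, u)) (by fun_prop)
  have hdetm : Measurable fun u => (coneDeriv c u).det := by
    simp only [det_coneDeriv]
    refine Measurable.mul (by fun_prop) ?_
    have h := measurable_det_gradMat_shift_quot (m := m) (d := d) |>.comp
      (f := fun u : Eucl m => (c, u)) (by fun_prop)
    exact h
  have hHm : Measurable fun w : Eucl m => h fun l => w l.succ := hh.comp (by fun_prop)
  have key := lintegral_abs_det_mul_comp_eq_count (volume : Measure (Eucl m))
    measurableSet_coneSet (fun x hx => hasFDerivAt_coneMap c hx.1)
    (hdetm (measurableSet_singleton 0)) hHm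
  have hR : ∫⁻ w : Eucl m, Measure.count (coneSet m ∩ coneMap c ⁻¹' {w}) * h (fun l => w l.succ) =
      ∫⁻ y, numRoots (shift c y) * h y := by
    rw [lintegral_eucl]
    simp only [count_coneSet_inter c hc hd, Fin.cons_succ, mul_assoc]
    have hm2 : Measurable fun y => numRoots (shift c y) * h y :=
      (measurable_numRoots.comp (continuous_shift.measurable.comp
        (f := fun y : Fin m → ℝ => (c, y)) (by fun_prop))).mul hh
    rw [Measure.volume_eq_prod, lintegral_prod_mul (measurable_one.indicator
      measurableSet_Ioo).aemeasurable hm2.aemeasurable, lintegral_indicator measurableSet_Ioo]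
    simp
  have hL : ∫⁻ u in coneSet m, ENNReal.ofReal |(coneDeriv c u).det| *
      h (fun l => coneMap c u l.succ) =
      ∫⁻ t in {t : Sph m | (t : Eucl m) 0 ≠ 0},
        ENNReal.ofReal (quotJac c t) * h (quot c t) ∂(surf m) := by
    have hm1 : Measurable fun u : Eucl m => ENNReal.ofReal |(coneDeriv c u).det| * h (quot c u) :=
      (ENNReal.measurable_ofReal.comp hdetm.norm).mul (hh.comp hqm)
    change ∫⁻ u in coneSet m, ENNReal.ofReal |(coneDeriv c u).det| * h (quot c u) = _
    rw [← lintegral_indicator measurableSet_coneSet,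
      lintegral_polar volume (hm1.indicator measurableSet_coneSet), surf]
    have hSm : MeasurableSet {t : Sph m | (t : Eucl m) 0 ≠ 0} := by
      have : Measurable fun t : Sph m => (t : Eucl m) 0 := by fun_prop
      exact (this (measurableSet_singleton 0)).compl
    rw [← lintegral_indicator hSm]
    refine lintegral_congr fun t => ?_
    have hn : ‖(t : Eucl m)‖ = 1 := by simp
    have hfr : Module.finrank ℝ (Eucl m) - 1 = m := by simp
    rw [hfr]
    by_cases ht : (t : Eucl m) 0 ≠ 0
    · rw [Set.indicator_of_mem (by exact ht)]
      have : ∀ r ∈ Set.Ioi (0 : ℝ), ENNReal.ofReal (r ^ m) * (coneSet m).indicator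
          (fun u => ENNReal.ofReal |(coneDeriv c u).det| * h (quot c u)) (r • (t : Eucl m)) =
          (Set.Iio (1 : ℝ)).indicator (fun r => ENNReal.ofReal (2 * r) *
            (ENNReal.ofReal (quotJac c t) * h (quot c t))) r := by
        intro r hr
        have hr' : 0 < r := hr
        have hnr : ‖r • (t : Eucl m)‖ = r := by
          rw [norm_smul, hn, mul_one, Real.norm_eq_abs, abs_of_pos hr']
        by_cases hr1 : r < 1
        · rw [Set.indicator_of_mem, Set.indicator_of_mem (by exact hr1), quot_smul c hr'.ne',
            ← mul_assoc, ← mul_assoc, ← ENNReal.ofReal_mul (by positivity),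
            ← ENNReal.ofReal_mul (by positivity), abs_det_coneDeriv_smul hd c hr']
          refine ⟨?_, by rw [hnr]; exact hr1⟩
          simp only [PiLp.smul_apply, smul_eq_mul]
          exact mul_ne_zero hr'.ne' ht
        · rw [Set.indicator_of_notMem, Set.indicator_of_notMem (by exact hr1), mul_zero]
          intro hx
          have := hx.2
          rw [hnr] at this
          exact hr1 this
      rw [setLIntegral_congr_fun measurableSet_Ioi this, setLIntegral_indicator measurableSet_Iio]
      rw [lintegral_mul_const _ (by fun_prop)]
      have : Set.Iio (1 : ℝ) ∩ Set.Ioi 0 = Set.Ioo 0 1 := by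
        ext x; simp [and_comm]
      rw [this, lintegral_two_mul_Ioo, one_mul]
    · rw [Set.indicator_of_notMem (by exact ht)]
      have : ∀ r : ℝ, (coneSet m).indicator
          (fun u => ENNReal.ofReal |(coneDeriv c u).det| * h (quot c u)) (r • (t : Eucl m)) = 0 := by
        intro r
        rw [Set.indicator_of_notMem]
        intro hx
        apply hx.1
        simp only [PiLp.smul_apply, smul_eq_mul, not_not.1 ht, mul_zero]
      simp [this]
  rw [← hL, ← hR]
  exact key

end SphereArea

end KSS
end

noncomputable section
namespace KSS

/-! ### The covariance structure of the system -/

section Kernel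

variable {m d : ℕ}

/-- The standard deviation of the coefficient of exponent `j`. -/
def wt (j : DegIndex (m + 1) d) : ℝ := √(Nat.multinomial Finset.univ j.1 : ℝ)

theorem wt_mul_self (j : DegIndex (m + 1) d) : wt j * wt j = Nat.multinomial Finset.univ j.1 :=
  Real.mul_self_sqrt (Nat.cast_nonneg _)

theorem wt_pos (j : DegIndex (m + 1) d) : 0 < wt j :=
  Real.sqrt_pos.2 (by exact_mod_cast Nat.multinomial_pos _ _)

theorem wt_idx0 : wt (idx0 m d) = 1 := by
  have : Nat.multinomial Finset.univ (idx0 m d).1 = 1 := by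
    simp only [idx0, Nat.multinomial]
    rw [Finset.prod_eq_single 0]
    · simp [Nat.div_self (Nat.factorial_pos d)]
    · intro b _ hb; simp [hb]
    · simp
  rw [wt, this]; simp

/-- The coefficients with the Kostlan-Shub-Smale variances, from normalized ones. -/
def coef (z : Fin m × DegIndex (m + 1) d → ℝ) (p : Fin m × DegIndex (m + 1) d) : ℝ :=
  wt p.2 * z p

/-- The evaluation vector at `t`. -/
def ev (t : Eucl m) (j : DegIndex (m + 1) d) : ℝ := wt j * mon j.1 t

/-- The vector of the derivative at `t` in the direction `v`. -/
def dev (t v : Eucl m) (j : DegIndex (m + 1) d) : ℝ := wt j * dmon j.1 t v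

theorem homPoly_coef (z : Fin m × DegIndex (m + 1) d → ℝ) (l : Fin m) (t : Eucl m) :
    homPoly (fun j => coef z (l, j)) t = ∑ j, ev t j * z (l, j) := by
  rw [homPoly_eq_sum_mon]
  exact Finset.sum_congr rfl fun j _ => by simp only [coef, ev]; ring

theorem homDeriv_coef (z : Fin m × DegIndex (m + 1) d → ℝ) (l : Fin m) (t v : Eucl m) :
    homDeriv (fun j => coef z (l, j)) t v = ∑ j, dev t v j * z (l, j) := by
  rw [homDeriv_apply]
  exact Finset.sum_congr rfl fun j _ => by simp only [coef, dev]; ring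

/-- The multinomial theorem. The variances of the coefficients are exactly those that make the
covariance of the polynomial equal to `⟨s, t⟩^d`. -/
theorem sum_ev_mul_ev (s t : Eucl m) :
    ∑ j : DegIndex (m + 1) d, ev s j * ev t j = (inner ℝ s t) ^ d := by
  have h : ∀ j : DegIndex (m + 1) d, ev s j * ev t j =
      Nat.multinomial Finset.univ j.1 * ∏ i, (s i * t i) ^ j.1 i := by
    intro j
    rw [← wt_mul_self]
    simp only [ev, mon, mul_pow, Finset.prod_mul_distrib]
    ring
  simp only [h]
  rw [Finset.sum_coe_sort (Finset.piAntidiag (Finset.univ : Finset (Fin (m + 1))) d)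
    (fun j => (Nat.multinomial Finset.univ j : ℝ) * ∏ i, (s i * t i) ^ j i),
    ← Finset.sum_pow_eq_sum_piAntidiag]
  simp [PiLp.inner_apply, mul_comm]

theorem hasFDerivAt_ev (t : Eucl m) (j : DegIndex (m + 1) d) :
    HasFDerivAt (fun t : Eucl m => ev t j) (wt j • fderiv ℝ (fun t : Eucl m => mon j.1 t) t) t :=
  (hasFDerivAt_mon j.1 t).const_mul (wt j)

/-- Differentiate the covariance kernel in its second argument. -/
theorem sum_ev_mul_dev (s t v : Eucl m) :
    ∑ j : DegIndex (m + 1) d, ev s j * dev t v j =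
      d * (inner ℝ s t) ^ (d - 1) * inner ℝ s v := by
  have h1 : HasFDerivAt (fun t : Eucl m => ∑ j : DegIndex (m + 1) d, ev s j * ev t j)
      (∑ j : DegIndex (m + 1) d, ev s j • wt j • fderiv ℝ (fun t : Eucl m => mon j.1 t) t) t :=
    HasFDerivAt.fun_sum fun j _ => (hasFDerivAt_ev t j).const_mul _
  have h2 : HasFDerivAt (fun t : Eucl m => ∑ j : DegIndex (m + 1) d, ev s j * ev t j)
      ((d * (inner ℝ s t) ^ (d - 1)) • innerSL ℝ s) t := by
    simp only [sum_ev_mul_ev]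
    have := (innerSL ℝ s).hasFDerivAt (x := t) |>.pow d
    simpa [nsmul_eq_mul] using! this
  have h3 := congrArg (fun L : Eucl m →L[ℝ] ℝ => L v) (h1.unique h2)
  simpa [dev, dmon] using! h3

/-- Differentiate once more, in `s`. The truncated exponent `d - 1 - 1` matters only where the
factor `d - 1` is nonzero. -/
theorem sum_dev_mul_dev (s t u v : Eucl m) :
    ∑ j : DegIndex (m + 1) d, dev s u j * dev t v j =
      d * ((d - 1 : ℕ) * (inner ℝ s t) ^ (d - 1 - 1) * inner ℝ u t) * inner ℝ s v +
        d * (inner ℝ s t) ^ (d - 1) * inner ℝ u v := by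
  have h1 : HasFDerivAt (fun s : Eucl m => ∑ j : DegIndex (m + 1) d, ev s j * dev t v j)
      (∑ j : DegIndex (m + 1) d, dev t v j • wt j • fderiv ℝ (fun t : Eucl m => mon j.1 t) s) s :=
    HasFDerivAt.fun_sum fun j _ => (hasFDerivAt_ev s j).mul_const _
  have hin : ∀ w : Eucl m, HasFDerivAt (fun s : Eucl m => inner ℝ s w) (innerSL ℝ w) s := by
    intro w
    have := (innerSL ℝ w).hasFDerivAt (x := s)
    simpa [real_inner_comm] using! this
  have h2 : HasFDerivAt (fun s : Eucl m => ∑ j : DegIndex (m + 1) d, ev s j * dev t v j)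
      ((d * (inner ℝ s t) ^ (d - 1)) • innerSL ℝ v + inner ℝ s v •
        ((d : ℝ) • (((d - 1 : ℕ) : ℝ) * (inner ℝ s t) ^ (d - 1 - 1)) • innerSL ℝ t)) s := by
    simp only [sum_ev_mul_dev]
    have h3 : HasFDerivAt (fun s : Eucl m => (inner ℝ s t) ^ (d - 1))
        ((((d - 1 : ℕ) : ℝ) * (inner ℝ s t) ^ (d - 1 - 1)) • innerSL ℝ t) s := by
      simpa [nsmul_eq_mul] using! (hin t).pow (d - 1)
    exact (h3.const_mul (d : ℝ)).mul (hin v)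
  have h3 := congrArg (fun L : Eucl m →L[ℝ] ℝ => L u) (h1.unique h2)
  simp only [sum_apply, smul_apply, add_apply, smul_eq_mul, innerSL_apply_apply] at h3
  have h4 : ∑ j : DegIndex (m + 1) d, dev s u j * dev t v j =
      ∑ j : DegIndex (m + 1) d, dev t v j * (wt j * fderiv ℝ (fun t : Eucl m => mon j.1 t) s u) :=
    Finset.sum_congr rfl fun j _ => by simp only [dev, dmon]; ring
  rw [h4, h3, real_inner_comm v u, real_inner_comm t u]
  ring

/-- A family of `m` tangent vectors at `t` is orthonormal. -/
structure IsTangentFrame (t : Eucl m) (w : Fin m → Eucl m) : Prop where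
  norm_eq : inner ℝ t t = (1 : ℝ)
  inner_left : ∀ k, inner ℝ t (w k) = (0 : ℝ)
  inner_right : ∀ k k', inner ℝ (w k) (w k') = (if k = k' then 1 else 0 : ℝ)

theorem isTangentFrame_of_frame (e : Frame m) (t : Sph m) :
    IsTangentFrame (t : Eucl m) fun k => (e t k : Eucl m) where
  norm_eq := by rw [real_inner_self_eq_norm_sq]; simp
  inner_left k := (Submodule.mem_orthogonal_singleton_iff_inner_right).1 (e t k).2
  inner_right k k' := by
    rw [← Submodule.coe_inner, orthonormal_iff_ite.1 (e t).orthonormal k k']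

/-- The rows of the normalized jet of the system at `t` in a tangent frame. -/
def jetRow (t : Eucl m) (w : Fin m → Eucl m) (κ : Fin m ⊕ (Fin m × Fin m))
    (p : Fin m × DegIndex (m + 1) d) : ℝ :=
  Sum.elim (fun l => if l = p.1 then ev t p.2 else 0)
    (fun q => if q.1 = p.1 then dev t (w q.2) p.2 / √(d : ℝ) else 0) κ

/-- At `s = t` with tangent directions, the kernel is `1`, its first derivatives vanish and its
mixed second derivatives are `d δ_{kk'}`. Division by `√d` therefore makes the jet a standard
Gaussian vector; different polynomials involve disjoint sets of coefficients. -/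
theorem jetRow_gram (hd : 1 ≤ d) {t : Eucl m} {w : Fin m → Eucl m} (hw : IsTangentFrame t w)
    (κ κ' : Fin m ⊕ (Fin m × Fin m)) :
    ∑ p : Fin m × DegIndex (m + 1) d, jetRow t w κ p * jetRow t w κ' p =
      if κ = κ' then 1 else 0 := by
  have hd0 : (0 : ℝ) < d := by exact_mod_cast hd
  have hsq : √(d : ℝ) * √(d : ℝ) = d := Real.mul_self_sqrt hd0.le
  have hrow : ∀ (a b : DegIndex (m + 1) d → ℝ) (l l' : Fin m),
      ∑ p : Fin m × DegIndex (m + 1) d, (if l = p.1 then a p.2 else 0) *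
        (if l' = p.1 then b p.2 else 0) = if l = l' then ∑ j, a j * b j else 0 := by
    intro a b l l'
    rw [Fintype.sum_prod_type, Finset.sum_eq_single l]
    · by_cases h : l = l'
      · subst h; simp
      · simp [h, Ne.symm h]
    · intro i _ hi; simp [Ne.symm hi]
    · simp
  have h1 : ∑ j : DegIndex (m + 1) d, ev t j * ev t j = 1 := by
    rw [sum_ev_mul_ev, hw.norm_eq, one_pow]
  have h2 : ∀ k, ∑ j : DegIndex (m + 1) d, ev t j * (dev t (w k) j / √(d : ℝ)) = 0 := by
    intro k
    have := sum_ev_mul_dev (d := d) t t (w k)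
    rw [hw.inner_left, mul_zero] at this
    simp only [mul_div_assoc', ← Finset.sum_div, this, zero_div]
  have h3 : ∀ k k', ∑ j : DegIndex (m + 1) d,
      dev t (w k) j / √(d : ℝ) * (dev t (w k') j / √(d : ℝ)) = if k = k' then 1 else 0 := by
    intro k k'
    have := sum_dev_mul_dev (d := d) t t (w k) (w k')
    rw [hw.inner_left, hw.norm_eq, hw.inner_right] at this
    simp only [div_mul_div_comm, ← Finset.sum_div, this, hsq, one_pow, mul_zero, mul_one, zero_add]
    split_ifs
    · field_simp
    · simp
  rcases κ with l | ⟨l, k⟩ <;> rcases κ' with l' | ⟨l', k'⟩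
  · simp only [jetRow, Sum.elim_inl]
    rw [hrow, h1]; simp
  · simp only [jetRow, Sum.elim_inl, Sum.elim_inr]
    rw [hrow (ev t) (fun j => dev t (w k') j / √(d : ℝ)), h2]; simp
  · simp only [jetRow, Sum.elim_inl, Sum.elim_inr]
    rw [hrow (fun j => dev t (w k) j / √(d : ℝ)) (ev t)]
    simp only [mul_comm _ (ev t _), h2]; simp
  · simp only [jetRow, Sum.elim_inr]
    rw [hrow (fun j => dev t (w k) j / √(d : ℝ)) (fun j => dev t (w k') j / √(d : ℝ)), h3]
    simp [← ite_and]

theorem sysVal_coef (z : Fin m × DegIndex (m + 1) d → ℝ) (t : Sph m) (l : Fin m)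
    (w : Fin m → Eucl m) :
    sysVal (coef z) t l = ∑ p, jetRow (t : Eucl m) w (Sum.inl l) p * z p := by
  simp only [sysVal, homPoly_coef, jetRow, Sum.elim_inl]
  rw [Fintype.sum_prod_type, Finset.sum_eq_single l]
  · simp
  · intro i _ hi; simp [Ne.symm hi]
  · simp

/-- The normalized derivatives of a system in the directions of a frame. -/
def frameDeriv (c : Fin m × DegIndex (m + 1) d → ℝ) (t : Eucl m) (w : Fin m → Eucl m)
    (q : Fin m × Fin m) : ℝ :=
  homDeriv (fun j => c (q.1, j)) t (w q.2) / √(d : ℝ)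

/-- The orthogonal projection of the gradient is invisible when paired with a tangent vector. -/
theorem sysDeriv_eq_frameDeriv (c : Fin m × DegIndex (m + 1) d → ℝ) (e : Frame m) (t : Sph m) :
    sysDeriv c e t = frameDeriv c t fun k => (e t k : Eucl m) := by
  funext q
  rw [sysDeriv, frameDeriv, OrthonormalBasis.repr_apply_apply, sphDeriv, Submodule.coe_inner,
    ← inner_gradient_homPoly, real_inner_comm]
  congr 1
  exact (Submodule.coe_inner _ _ _).symm.trans <|
    Submodule.inner_orthogonalProjectionOnto_eq_of_mem_right (e t q.2)
    (gradient (homPoly fun j => c (q.1, j)) (t : Eucl m))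

theorem frameDeriv_coef (z : Fin m × DegIndex (m + 1) d → ℝ) (t : Eucl m) (w : Fin m → Eucl m)
    (q : Fin m × Fin m) :
    frameDeriv (coef z) t w q = ∑ p, jetRow t w (Sum.inr q) p * z p := by
  simp only [frameDeriv, homDeriv_coef, jetRow, Sum.elim_inr]
  rw [Fintype.sum_prod_type, Finset.sum_eq_single q.1]
  · simp only [if_true, Finset.sum_div]
    exact Finset.sum_congr rfl fun j _ => by ring
  · intro i _ hi; simp [Ne.symm hi]
  · simp

/-- Coordinates of the space of systems that extend the normalized jet at `t`. -/
theorem exists_jet_basis (hd : 1 ≤ d) {t : Eucl m} {w : Fin m → Eucl m}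
    (hw : IsTangentFrame t w) :
    ∃ (r : ℕ) (b : OrthonormalBasis (Coord m (Fin r)) ℝ
      (EuclideanSpace ℝ (Fin m × DegIndex (m + 1) d))),
      (∀ l p, b (Sum.inl l) p = jetRow t w (Sum.inl l) p) ∧
        ∀ q p, b (Sum.inr (Sum.inl q)) p = jetRow t w (Sum.inr q) p := by
  classical
  let V : Fin m ⊕ (Fin m × Fin m) → EuclideanSpace ℝ (Fin m × DegIndex (m + 1) d) :=
    fun κ => WithLp.toLp 2 (jetRow t w κ)
  have hV : Orthonormal ℝ V := by
    rw [orthonormal_iff_ite]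
    intro κ κ'
    rw [← jetRow_gram hd hw κ κ']
    simp [V, PiLp.inner_apply, mul_comm]
  have hcard : Fintype.card (Fin m ⊕ (Fin m × Fin m)) ≤
      Module.finrank ℝ (EuclideanSpace ℝ (Fin m × DegIndex (m + 1) d)) :=
    hV.linearIndependent.fintype_card_le_finrank
  set r := Module.finrank ℝ (EuclideanSpace ℝ (Fin m × DegIndex (m + 1) d)) -
    Fintype.card (Fin m ⊕ (Fin m × Fin m)) with hr
  -- The zero vectors are placeholders: only the indices in `s` are prescribed, and the extension to
  -- an orthonormal basis chooses the rest.
  let W : Coord m (Fin r) → EuclideanSpace ℝ (Fin m × DegIndex (m + 1) d) :=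
    Sum.elim (fun l => V (Sum.inl l)) (Sum.elim (fun q => V (Sum.inr q)) fun _ => 0)
  let s : Set (Coord m (Fin r)) := {κ | ∀ i, κ ≠ Sum.inr (Sum.inr i)}
  have hW : Orthonormal ℝ (s.domRestrict W) := by
    have hf : ∀ κ : s, ∃ κ' : Fin m ⊕ (Fin m × Fin m), κ.1 = Sum.map id Sum.inl κ' := by
      rintro ⟨κ, hκ⟩
      rcases κ with l | q | i
      · exact ⟨Sum.inl l, rfl⟩
      · exact ⟨Sum.inr q, rfl⟩
      · exact absurd rfl (hκ i)
    choose f hf using hf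
    have hfinj : Function.Injective f := by
      intro a b hab
      apply Subtype.ext
      rw [hf a, hf b, hab]
    have : s.domRestrict W = V ∘ f := by
      funext κ
      have h1 : W κ.1 = V (f κ) := by
        rw [hf κ]
        rcases f κ with l | q <;> rfl
      exact h1
    rw [this]
    exact hV.comp f hfinj
  have hfin : Module.finrank ℝ (EuclideanSpace ℝ (Fin m × DegIndex (m + 1) d)) =
      Fintype.card (Coord m (Fin r)) := by
    rw [Fintype.card_sum, Fintype.card_sum, Fintype.card_fin r]
    rw [Fintype.card_sum] at hr hcard
    omega
  obtain ⟨b, hb⟩ := hW.exists_orthonormalBasis_extension_of_card_eq hfin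
  refine ⟨r, b, fun l p => ?_, fun q p => ?_⟩
  · rw [hb (Sum.inl l) (by intro i; simp)]; rfl
  · rw [hb (Sum.inr (Sum.inl q)) (by intro i; simp)]; rfl

end Kernel

end KSS
end

noncomputable section
namespace KSS

/-! ### The Gaussian density and orthonormal coordinates -/

section Density

variable {ι κ : Type*} [Fintype ι] [Fintype κ]

/-- The density of the standard Gaussian measure. -/
def gdens (z : ι → ℝ) : ℝ := ∏ i, gaussianPDFReal 0 1 (z i)

theorem gdens_eq (z : ι → ℝ) :
    gdens z = (√(2 * Real.pi))⁻¹ ^ Fintype.card ι * Real.exp (-(∑ i, z i ^ 2) / 2) := by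
  simp only [gdens, gaussianPDFReal, Finset.prod_mul_distrib, ← Real.exp_sum]
  simp [Finset.card_univ, Finset.sum_div, neg_div]

theorem gdens_nonneg (z : ι → ℝ) : 0 ≤ gdens z :=
  Finset.prod_nonneg fun _ _ => gaussianPDFReal_nonneg _ _ _

theorem measurable_gdens : Measurable (gdens : (ι → ℝ) → ℝ) := by
  unfold gdens
  exact Finset.measurable_fun_prod _ fun i _ =>
    (measurable_gaussianPDFReal 0 1).comp (measurable_pi_apply i)

theorem stdG_eq_withDensity :
    stdG ι = (volume : Measure (ι → ℝ)).withDensity fun z => ENNReal.ofReal (gdens z) := by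
  refine Measure.pi_eq fun s hs => ?_
  rw [withDensity_apply _ (MeasurableSet.univ_pi hs), volume_pi, Measure.restrict_pi_pi]
  have hint : Integrable (fun z : ι → ℝ => gdens z)
      (Measure.pi fun i => (volume : Measure ℝ).restrict (s i)) :=
    Integrable.fintype_prod fun i => (integrable_gaussianPDFReal 0 1).integrableOn
  rw [← ofReal_integral_eq_lintegral_ofReal hint (ae_of_all _ gdens_nonneg)]
  simp only [gdens]
  rw [integral_fintype_prod_eq_prod (fun _ => gaussianPDFReal 0 1),
    ENNReal.ofReal_prod_of_nonneg fun i _ => integral_nonneg fun x => gaussianPDFReal_nonneg _ _ _]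
  exact Finset.prod_congr rfl fun i _ => (gaussianReal_apply_eq_integral 0 one_ne_zero _).symm

theorem lintegral_stdG {F : (ι → ℝ) → ℝ≥0∞} (hF : Measurable F) :
    ∫⁻ z, F z ∂(stdG ι) = ∫⁻ z, F z * ENNReal.ofReal (gdens z) := by
  rw [stdG_eq_withDensity, lintegral_withDensity_eq_lintegral_mul _ measurable_gdens.ennreal_ofReal hF]
  exact lintegral_congr fun z => mul_comm _ _

theorem lintegral_gdens : ∫⁻ z : ι → ℝ, ENNReal.ofReal (gdens z) = 1 := by
  have := lintegral_stdG (ι := ι) (F := fun _ => 1) measurable_const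
  simpa using this.symm

theorem gdens_sumElim (v : ι → ℝ) (w : κ → ℝ) : gdens (Sum.elim v w) = gdens v * gdens w := by
  simp [gdens, Fintype.prod_sum_type]

theorem gdens_zero : gdens (0 : ι → ℝ) = (√(2 * Real.pi))⁻¹ ^ Fintype.card ι := by
  simp [gdens_eq]

/-- The point with coordinates `x` in an orthonormal basis. -/
def coordOut (b : OrthonormalBasis κ ℝ (EuclideanSpace ℝ ι)) (x : κ → ℝ) (i : ι) : ℝ :=
  ∑ k, b k i * x k

theorem sum_basis_mul_basis (b : OrthonormalBasis κ ℝ (EuclideanSpace ℝ ι)) [DecidableEq ι]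
    (i j : ι) : ∑ k, b k i * b k j = if i = j then 1 else 0 := by
  have := b.sum_inner_mul_inner (EuclideanSpace.single i 1) (EuclideanSpace.single j 1)
  simp only [EuclideanSpace.inner_single_left, EuclideanSpace.inner_single_right] at this
  simpa [Pi.single_apply, eq_comm] using this

theorem sum_basis_mul_basis_right (b : OrthonormalBasis κ ℝ (EuclideanSpace ℝ ι)) [DecidableEq κ]
    (k l : κ) : ∑ i, b k i * b l i = if k = l then 1 else 0 := by
  rw [← orthonormal_iff_ite.1 b.orthonormal k l]
  simp [PiLp.inner_apply, mul_comm]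

theorem measurePreserving_coordOut (b : OrthonormalBasis κ ℝ (EuclideanSpace ℝ ι)) :
    MeasurePreserving (coordOut b) (stdG κ) (stdG ι) := by
  classical
  exact measurePreserving_of_gram_eq_one (fun i k => b k i) fun i j => sum_basis_mul_basis b i j

theorem sum_basis_mul_coordOut (b : OrthonormalBasis κ ℝ (EuclideanSpace ℝ ι)) (x : κ → ℝ) (k : κ) :
    ∑ i, b k i * coordOut b x i = x k := by
  classical
  simp only [coordOut, Finset.mul_sum]
  rw [Finset.sum_comm]
  simp only [← mul_assoc, ← Finset.sum_mul, sum_basis_mul_basis_right]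
  simp

theorem coordOut_sum_basis_mul (b : OrthonormalBasis κ ℝ (EuclideanSpace ℝ ι)) (z : ι → ℝ) :
    coordOut b (fun k => ∑ i, b k i * z i) = z := by
  classical
  funext j
  simp only [coordOut, Finset.mul_sum]
  rw [Finset.sum_comm]
  simp only [← mul_assoc, ← Finset.sum_mul, sum_basis_mul_basis]
  simp

theorem coordOut_sub (b : OrthonormalBasis κ ℝ (EuclideanSpace ℝ ι)) (x y : κ → ℝ) :
    coordOut b (x - y) = coordOut b x - coordOut b y := by
  funext j
  simp [coordOut, mul_sub]

theorem measurable_coordOut (b : OrthonormalBasis κ ℝ (EuclideanSpace ℝ ι)) :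
    Measurable (coordOut b) := by
  unfold coordOut; fun_prop

theorem volume_preserving_coordOut (b : OrthonormalBasis κ ℝ (EuclideanSpace ℝ ι)) :
    MeasurePreserving (coordOut b) volume volume := by
  have h := (PiLp.volume_preserving_ofLp ι).comp
    (b.measurePreserving_repr_symm.comp (PiLp.volume_preserving_toLp κ))
  convert! h using 1
  funext x i
  simp [coordOut, ← OrthonormalBasis.sum_repr_symm, mul_comm]

theorem gdens_coordOut (b : OrthonormalBasis κ ℝ (EuclideanSpace ℝ ι)) (x : κ → ℝ) :
    gdens (coordOut b x) = gdens x := by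
  classical
  have hcard : Fintype.card ι = Fintype.card κ := by
    rw [← Module.finrank_eq_card_basis b.toBasis, finrank_euclideanSpace]
  have hsq : ∑ i, coordOut b x i ^ 2 = ∑ k, x k ^ 2 := by
    have : ∀ i, coordOut b x i ^ 2 = ∑ k, x k * (b k i * coordOut b x i) := by
      intro i
      rw [sq]
      nth_rewrite 1 [coordOut]
      rw [Finset.sum_mul]
      exact Finset.sum_congr rfl fun k _ => by ring
    simp only [this]
    rw [Finset.sum_comm]
    simp only [← Finset.mul_sum, sum_basis_mul_coordOut, sq]
  rw [gdens_eq, gdens_eq, hcard, hsq]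

theorem comp_coordOut_mem_polyLE (b : OrthonormalBasis κ ℝ (EuclideanSpace ℝ ι)) {Q : ℕ}
    {f : (ι → ℝ) → ℝ} (hf : f ∈ polyLE ι Q) : (fun x => f (coordOut b x)) ∈ polyLE κ Q :=
  comp_mem_polyLE (fun i => sum_mul_mem_affineFun fun k => b k i) hf

theorem lintegral_comp_div {s : ℝ} (hs : s ≠ 0) {F : (ι → ℝ) → ℝ≥0∞} (hF : Measurable F) :
    ∫⁻ v : ι → ℝ, F (fun i => v i / s) = ENNReal.ofReal (|s| ^ Fintype.card ι) * ∫⁻ v, F v := by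
  have h := Measure.map_addHaar_smul (volume : Measure (ι → ℝ)) (inv_ne_zero hs)
  have h2 : ∫⁻ v : ι → ℝ, F (fun i => v i / s) = ∫⁻ v, F v ∂(Measure.map (s⁻¹ • ·) volume) := by
    rw [lintegral_map hF (by fun_prop)]
    refine lintegral_congr fun v => ?_
    congr 1
    funext i
    simp [div_eq_inv_mul]
  rw [h2, h, lintegral_smul_measure]
  simp [abs_pow]

end Density

end KSS
end

noncomputable section
namespace KSS

/-! ### The Kac-Rice formula -/

section KacRice

variable {m d : ℕ}

/-- The projection onto the systems that vanish at `t`. -/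
def proj (t : Eucl m) (z : Fin m × DegIndex (m + 1) d → ℝ) (p : Fin m × DegIndex (m + 1) d) : ℝ :=
  z p - (∑ j, ev t j * z (p.1, j)) * ev t p.2

/-- An orthonormal basis whose first elements are the evaluations at `t`. -/
abbrev IsEvBasis {ρ : Type*} [Fintype ρ] (t : Eucl m) (b : OrthonormalBasis (Coord m ρ) ℝ
    (EuclideanSpace ℝ (Fin m × DegIndex (m + 1) d))) : Prop :=
  ∀ l p, b (Sum.inl l) p = if l = p.1 then ev t p.2 else 0

variable {ρ : Type*} [Fintype ρ] {t : Eucl m} {b : OrthonormalBasis (Coord m ρ) ℝ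
    (EuclideanSpace ℝ (Fin m × DegIndex (m + 1) d))}

theorem IsEvBasis.sum_mul (hb : IsEvBasis t b) (l : Fin m) (z : Fin m × DegIndex (m + 1) d → ℝ) :
    ∑ p, b (Sum.inl l) p * z p = ∑ j, ev t j * z (l, j) := by
  simp only [hb l]
  rw [Fintype.sum_prod_type, Finset.sum_eq_single l]
  · simp
  · intro i _ hi; simp [Ne.symm hi]
  · simp

theorem IsEvBasis.sum_ev_mul_coordOut (hb : IsEvBasis t b) (l : Fin m) (x : Coord m ρ → ℝ) :
    ∑ j, ev t j * coordOut b x (l, j) = x (Sum.inl l) := by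
  rw [← hb.sum_mul, sum_basis_mul_coordOut]

/-- The evaluations at `t` are members of the basis, so removing the components along them amounts
to erasing the value coordinates. -/
theorem IsEvBasis.proj_coordOut (hb : IsEvBasis t b) (x : Coord m ρ → ℝ) :
    proj t (coordOut b x) = coordOut b (dropVal x) := by
  funext p
  rw [proj, hb.sum_ev_mul_coordOut]
  simp only [coordOut, dropVal, Fintype.sum_sum_type, Sum.elim_inl, Sum.elim_inr, Pi.zero_apply,
    mul_zero, Finset.sum_const_zero, zero_add, hb _ p]
  simp
  ring

theorem IsEvBasis.quot_coordOut (hb : IsEvBasis t b) (x : Coord m ρ → ℝ) :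
    quot (coef (coordOut b x)) t = fun l => x (Sum.inl l) / t 0 ^ d := by
  funext l
  rw [quot, homPoly_coef, hb.sum_ev_mul_coordOut]

theorem ev_idx0 (t : Eucl m) : ev t (idx0 m d) = t 0 ^ d := by
  rw [ev, wt_idx0, one_mul, idx0, mon_single]

theorem coef_shift (z : Fin m × DegIndex (m + 1) d → ℝ) (y : Fin m → ℝ) :
    coef (shift z y) = shift (coef z) y := by
  funext p
  simp only [coef, shift, mul_sub]
  split_ifs with h
  · rw [h, wt_idx0, one_mul, one_mul]
  · simp

theorem measurable_coef :
    Measurable (coef : (Fin m × DegIndex (m + 1) d → ℝ) → Fin m × DegIndex (m + 1) d → ℝ) := by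
  unfold coef; fun_prop

theorem lintegral_shift (y : Fin m → ℝ) (F : (Fin m × DegIndex (m + 1) d → ℝ) → ℝ≥0∞) :
    ∫⁻ z, F (shift z y) = ∫⁻ z, F z :=
  lintegral_sub_right_eq_self F fun p : Fin m × DegIndex (m + 1) d =>
    y p.1 * if p.2 = idx0 m d then 1 else 0

/-- The coordinates outside of the values at `t` of the system `y t_0^d`. -/
def topCoord (b : OrthonormalBasis (Coord m ρ) ℝ (EuclideanSpace ℝ (Fin m × DegIndex (m + 1) d)))
    (y : Fin m → ℝ) (κ : (Fin m × Fin m) ⊕ ρ) : ℝ :=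
  ∑ p : Fin m × DegIndex (m + 1) d, b (Sum.inr κ) p * (y p.1 * if p.2 = idx0 m d then 1 else 0)

/-- Subtracting `y_l t_0^d` with `y = v / t_0^d` cancels the values `v` at `t` and translates the
other coordinates by a vector depending on `v` only, a translation that Lebesgue measure does not
see. -/
theorem IsEvBasis.shift_coordOut (hb : IsEvBasis t b) (ht : t 0 ≠ 0) (v : Fin m → ℝ)
    (w : (Fin m × Fin m) ⊕ ρ → ℝ) :
    shift (coordOut b (Sum.elim v w)) (fun l => v l / t 0 ^ d) =
      coordOut b (Sum.elim 0 (w - topCoord b fun l => v l / t 0 ^ d)) := by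
  set y : Fin m → ℝ := fun l => v l / t 0 ^ d
  have h1 : shift (coordOut b (Sum.elim v w)) y = coordOut b (Sum.elim v w) -
      fun p : Fin m × DegIndex (m + 1) d => y p.1 * if p.2 = idx0 m d then 1 else 0 := rfl
  rw [h1, ← coordOut_sum_basis_mul b (fun p : Fin m × DegIndex (m + 1) d =>
    y p.1 * if p.2 = idx0 m d then 1 else 0), ← coordOut_sub]
  congr 1
  funext κ
  rcases κ with l | κ
  · simp only [Pi.sub_apply, Sum.elim_inl, hb.sum_mul, Pi.zero_apply]
    have : t 0 ^ d ≠ 0 := pow_ne_zero _ ht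
    simp only [mul_ite, mul_one, mul_zero, Finset.sum_ite_eq', Finset.mem_univ, if_true, ev_idx0, y]
    field_simp
    simp
  · simp [topCoord]

theorem lintegral_sum_pi {α β : Type*} [Fintype α] [Fintype β] {F : (α ⊕ β → ℝ) → ℝ≥0∞}
    (hF : Measurable F) : ∫⁻ x, F x = ∫⁻ v, ∫⁻ w, F (Sum.elim v w) := by
  have h := (volume_measurePreserving_sumPiEquivProdPi_symm fun _ : α ⊕ β => ℝ).lintegral_comp hF
  rw [← h, Measure.volume_eq_prod, lintegral_prod _ (by
    exact (hF.comp (MeasurableEquiv.measurable _)).aemeasurable)]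
  refine lintegral_congr fun v => lintegral_congr fun w => ?_
  congr 1

theorem measurable_sumElim_right {α β : Type*} (v : α → ℝ) :
    Measurable fun w : β → ℝ => (Sum.elim v w : α ⊕ β → ℝ) := by
  refine measurable_pi_lambda _ fun i => ?_
  rcases i with i | i
  · exact measurable_const
  · exact measurable_pi_apply i

/-- In the adapted coordinates the integral separates: the translation of `w` disappears by
invariance, and the substitution `v = t_0^d y` produces the factor `|t_0^d|^m`. -/
theorem IsEvBasis.lintegral_quot (hb : IsEvBasis t b) (ht : t 0 ≠ 0) {χ : (Fin m → ℝ) → ℝ≥0∞}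
    (hχ : Measurable χ) {F : (Fin m × DegIndex (m + 1) d → ℝ) → ℝ≥0∞} (hF : Measurable F) :
    ∫⁻ z, χ (quot (coef z) t) * F (shift z (quot (coef z) t)) =
      ENNReal.ofReal (|t 0 ^ d| ^ m) * (∫⁻ v, χ v) * ∫⁻ w, F (coordOut b (Sum.elim 0 w)) := by
  have hq : Measurable fun z : Fin m × DegIndex (m + 1) d → ℝ => quot (coef z) t :=
    measurable_quot.comp (f := fun z : Fin m × DegIndex (m + 1) d → ℝ => (coef z, t))
      (measurable_coef.prodMk measurable_const)
  have hs : Measurable fun z : Fin m × DegIndex (m + 1) d → ℝ => shift z (quot (coef z) t) := by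
    have h := (continuous_shift (m := m) (d := d)).measurable
    exact h.comp (measurable_id.prodMk hq)
  have hm : Measurable fun z : Fin m × DegIndex (m + 1) d → ℝ =>
      χ (quot (coef z) t) * F (shift z (quot (coef z) t)) :=
    (hχ.comp hq).mul (hF.comp hs)
  rw [← (volume_preserving_coordOut b).lintegral_comp hm]
  refine (lintegral_sum_pi (hm.comp (measurable_coordOut b))).trans ?_
  simp only [Function.comp_def, hb.quot_coordOut, Sum.elim_inl, hb.shift_coordOut ht]
  have hFm : Measurable fun w : (Fin m × Fin m) ⊕ ρ → ℝ => F (coordOut b (Sum.elim 0 w)) :=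
    hF.comp ((measurable_coordOut b).comp (measurable_sumElim_right _))
  have hin : ∀ v : Fin m → ℝ, ∫⁻ w : (Fin m × Fin m) ⊕ ρ → ℝ, χ (fun l => v l / t 0 ^ d) *
      F (coordOut b (Sum.elim 0 (w - topCoord b fun l => v l / t 0 ^ d))) =
      χ (fun l => v l / t 0 ^ d) * ∫⁻ w, F (coordOut b (Sum.elim 0 w)) := by
    intro v
    rw [lintegral_const_mul _ (by exact hFm.comp (measurable_id.sub_const _))]
    rw [lintegral_sub_right_eq_self
      (fun w : (Fin m × Fin m) ⊕ ρ → ℝ => F (coordOut b (Sum.elim 0 w)))]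
  simp only [hin]
  rw [lintegral_mul_const _ (by exact hχ.comp (by fun_prop)),
    lintegral_comp_div (pow_ne_zero _ ht) hχ, Fintype.card_fin]

/-- At `(0, w)` the Gaussian density is `(2π)^{-m/2}` times the density of `w`. On the right the
integrand ignores the value coordinates, which integrate to `1`. -/
theorem IsEvBasis.lintegral_drop (hb : IsEvBasis t b)
    {F : (Fin m × DegIndex (m + 1) d → ℝ) → ℝ≥0∞} (hF : Measurable F) :
    ∫⁻ w, F (coordOut b (Sum.elim 0 w)) * ENNReal.ofReal (gdens (coordOut b (Sum.elim 0 w))) =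
      ENNReal.ofReal ((√(2 * Real.pi))⁻¹ ^ m) * ∫⁻ z, F (proj t z) ∂(stdG _) := by
  have hpm : Measurable (proj (d := d) t) := by unfold proj; fun_prop
  have hFm : Measurable fun w : (Fin m × Fin m) ⊕ ρ → ℝ => F (coordOut b (Sum.elim 0 w)) :=
    hF.comp ((measurable_coordOut b).comp (measurable_sumElim_right _))
  have hpz := (measurePreserving_coordOut b).lintegral_comp (f := fun z => F (proj t z)) (hF.comp hpm)
  rw [← hpz]
  simp only [hb.proj_coordOut]
  have h1 : Measurable fun x : Coord m ρ → ℝ => F (coordOut b (dropVal x)) := by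
    refine hF.comp ((measurable_coordOut b).comp ?_)
    exact (measurable_sumElim_right 0).comp (by fun_prop)
  have hg : Measurable fun x : Coord m ρ → ℝ => F (coordOut b (dropVal x)) *
      ENNReal.ofReal (gdens x) := h1.mul measurable_gdens.ennreal_ofReal
  rw [lintegral_stdG h1, lintegral_sum_pi hg]
  have h0 : ∀ (v : Fin m → ℝ) (w : (Fin m × Fin m) ⊕ ρ → ℝ),
      F (coordOut b (dropVal (Sum.elim v w))) * ENNReal.ofReal (gdens (Sum.elim v w)) =
      ENNReal.ofReal (gdens v) * (F (coordOut b (Sum.elim 0 w)) * ENNReal.ofReal (gdens w)) := by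
    intro v w
    rw [gdens_sumElim, ENNReal.ofReal_mul (gdens_nonneg v)]
    have : dropVal (Sum.elim v w : Coord m ρ → ℝ) = (Sum.elim 0 w : Coord m ρ → ℝ) := rfl
    rw [this]
    ring
  have hGm : Measurable fun w : (Fin m × Fin m) ⊕ ρ → ℝ =>
      F (coordOut b (Sum.elim 0 w)) * ENNReal.ofReal (gdens w) :=
    hFm.mul measurable_gdens.ennreal_ofReal
  simp only [h0, lintegral_const_mul _ hGm]
  rw [lintegral_mul_const _ measurable_gdens.ennreal_ofReal, lintegral_gdens, one_mul]
  simp only [gdens_coordOut, gdens_sumElim, gdens_zero, Fintype.card_fin]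
  rw [← lintegral_const_mul _ hGm]
  refine lintegral_congr fun w => ?_
  rw [ENNReal.ofReal_mul (by positivity)]
  ring

end KacRice

end KSS
end

noncomputable section
namespace KSS

/-! ### The Kac-Rice formula on the sphere. -/

section KacRiceSphere

variable {m d : ℕ}

/-- Multiply by the orthogonal matrix with columns `t` and `w`. The row `t` becomes `(1, 0, …, 0)`,
so only the block of tangential derivatives remains, and it carries the factor `√d` per row. -/
theorem abs_det_gradMat (hd : 1 ≤ d) (c : Fin m × DegIndex (m + 1) d → ℝ) {t : Eucl m}
    {w : Fin m → Eucl m} (hw : IsTangentFrame t w) :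
    |(gradMat c t).det| = √(d : ℝ) ^ m * absDet (frameDeriv c t w) := by
  have hd0 : (0 : ℝ) < √(d : ℝ) := Real.sqrt_pos.2 (by exact_mod_cast hd)
  let O : Matrix (Fin (m + 1)) (Fin (m + 1)) ℝ :=
    Matrix.of fun i j => (Fin.cons t w : Fin (m + 1) → Eucl m) j i
  have hin : ∀ u v : Eucl m, ∑ i, u i * v i = inner ℝ u v := by
    intro u v; simp [PiLp.inner_apply, mul_comm]
  have hO : O.transpose * O = 1 := by
    ext i j
    simp only [Matrix.mul_apply, Matrix.transpose_apply, O, Matrix.of_apply, hin, Matrix.one_apply]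
    refine Fin.cases ?_ (fun k => ?_) i <;> refine Fin.cases ?_ (fun k' => ?_) j
    · simpa only [Fin.cons_zero, if_true] using hw.norm_eq
    · simpa [(Fin.succ_ne_zero _).symm] using hw.inner_left k'
    · simpa [real_inner_comm] using hw.inner_left k
    · simpa using hw.inner_right k k'
  have hdet : |O.det| = 1 := by
    have h := congrArg Matrix.det hO
    rw [Matrix.det_mul, Matrix.det_transpose, Matrix.det_one] at h
    have h2 : |O.det| * |O.det| = 1 := by rw [← abs_mul, h, abs_one]
    nlinarith [abs_nonneg O.det]
  have hM0 : ∀ j : Fin m, (gradMat c t * O) 0 j.succ = 0 := by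
    intro j
    simp [Matrix.mul_apply, gradMat, O, hin, hw.inner_left]
  have hM00 : (gradMat c t * O) 0 0 = 1 := by
    simp only [Matrix.mul_apply, gradMat, Matrix.of_apply, O, Fin.cases_zero, Fin.cons_zero]
    exact (hin t t).trans hw.norm_eq
  have hMs : (gradMat c t * O).submatrix Fin.succ Fin.succ =
      √(d : ℝ) • Matrix.of fun l k => frameDeriv c t w (l, k) := by
    ext l k
    simp only [Matrix.submatrix_apply, Matrix.mul_apply, gradMat, Matrix.of_apply, Fin.cases_succ, O,
      Fin.cons_succ, Matrix.smul_apply, frameDeriv, smul_eq_mul]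
    rw [mul_div_cancel₀ _ hd0.ne', apply_eq_sum_single _ (w k)]
  have : (gradMat c t * O).det = √(d : ℝ) ^ m * (Matrix.of fun l k => frameDeriv c t w (l, k)).det := by
    rw [Matrix.det_succ_row_zero, Fin.sum_univ_succ]
    simp only [hM0, hM00]
    have h0 : (Fin.succAbove (0 : Fin (m + 1))) = Fin.succ := by
      funext i; simp
    rw [h0, hMs, Matrix.det_smul]
    simp
  have h2 : |(gradMat c t).det| = |(gradMat c t * O).det| := by
    rw [Matrix.det_mul, abs_mul, hdet, mul_one]
  rw [h2, this, abs_mul, abs_of_nonneg (by positivity), absDet]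

open scoped Pointwise in
-- The cone over the equator lies in a proper subspace, which has volume zero.
theorem surf_equator : surf m {t : Sph m | (t : Eucl m) 0 = 0} = 0 := by
  have hm : MeasurableSet {t : Sph m | (t : Eucl m) 0 = 0} := by
    have : Measurable fun t : Sph m => (t : Eucl m) 0 := by fun_prop
    exact this (measurableSet_singleton 0)
  rw [surf, Measure.toSphere_apply' _ hm]
  let V : Submodule ℝ (Eucl m) := LinearMap.ker (EuclideanSpace.proj (𝕜 := ℝ) (0 : Fin (m + 1))).toLinearMap
  have hV : V ≠ ⊤ := by
    intro h
    have : EuclideanSpace.single (0 : Fin (m + 1)) (1 : ℝ) ∈ V := h ▸ Submodule.mem_top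
    simp [V] at this
  have h0 := Measure.addHaar_submodule (volume : Measure (Eucl m)) V hV
  have : volume (Set.Ioo (0 : ℝ) 1 • (Subtype.val '' {t : Sph m | (t : Eucl m) 0 = 0} : Set (Eucl m))) = 0 := by
    refine measure_mono_null ?_ h0
    rintro _ ⟨r, hr, _, ⟨t, ht, rfl⟩, rfl⟩
    have ht' : (t : Eucl m) 0 = 0 := ht
    simp [V, ht']
  rw [this, mul_zero]

theorem exists_tangentFrame (t : Sph m) : ∃ w, IsTangentFrame (t : Eucl m) w := by
  have hfr : Module.finrank ℝ (Eucl m) = m + 1 := by simp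
  have : Fact (Module.finrank ℝ (Eucl m) = m + 1) := ⟨hfr⟩
  exact ⟨_, isTangentFrame_of_frame (fun t : Sph m =>
    ((stdOrthonormalBasis ℝ (Tangent t)).reindex (finCongr
      (Submodule.finrank_orthogonal_span_singleton (𝕜 := ℝ) (n := m) (ne_zero_of_mem_unit_sphere t))))) t⟩

theorem ae_det_macMat_coef :
    ∀ᵐ z : Fin m × DegIndex (m + 1) d → ℝ, (macMat (coef z)).det ≠ 0 := by
  classical
  let D : Matrix (Fin m × DegIndex (m + 1) d) (Fin m × DegIndex (m + 1) d) ℝ :=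
    Matrix.diagonal fun p => wt p.2
  have hD : LinearMap.det (Matrix.toLin' D) ≠ 0 := by
    rw [LinearMap.det_toLin', Matrix.det_diagonal]
    exact Finset.prod_ne_zero_iff.2 fun p _ => (wt_pos p.2).ne'
  have hc : (coef : (Fin m × DegIndex (m + 1) d → ℝ) → _) = Matrix.toLin' D := by
    funext z p
    simp [coef, D, Matrix.mulVec_diagonal]
  have h0 := Measure.addHaar_preimage_linearMap
    (volume : Measure (Fin m × DegIndex (m + 1) d → ℝ)) hD {c | ¬ (macMat c).det ≠ 0}
  have h1 : volume {c : Fin m × DegIndex (m + 1) d → ℝ | ¬ (macMat c).det ≠ 0} = 0 :=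
    ae_iff.1 ae_det_macMat_ne_zero
  rw [h1, mul_zero, ← hc] at h0
  exact h0

theorem measurable_proj : Measurable fun p : Eucl m × (Fin m × DegIndex (m + 1) d → ℝ) =>
    proj p.1 p.2 := by
  have : Continuous fun p : Eucl m × (Fin m × DegIndex (m + 1) d → ℝ) => proj p.1 p.2 := by
    unfold proj ev mon
    fun_prop
  exact this.measurable

/-- The weight of the Kac-Rice formula. -/
def kacWeight (t : Eucl m) (z : Fin m × DegIndex (m + 1) d → ℝ) : ℝ :=
  (√(2 * Real.pi))⁻¹ ^ m * |(gradMat (coef z) t).det|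

theorem measurable_kacWeight :
    Measurable fun p : Eucl m × (Fin m × DegIndex (m + 1) d → ℝ) => kacWeight p.1 p.2 := by
  unfold kacWeight
  have h := (continuous_det_gradMat (m := m) (d := d)).measurable.comp
    (f := fun p : Eucl m × (Fin m × DegIndex (m + 1) d → ℝ) => (coef p.2, p.1))
    ((measurable_coef.comp measurable_snd).prodMk measurable_fst)
  exact h.norm.const_mul _

/-- The factor `|t_0|^{-dm}` of the Jacobian cancels the `|t_0|^{dm}` from the change of variables,
so the dependence on the chart `t_0 ≠ 0` disappears. -/
theorem lintegral_quotJac_mul (hd : 1 ≤ d) (t : Sph m) (ht : (t : Eucl m) 0 ≠ 0)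
    {H : (Fin m × DegIndex (m + 1) d → ℝ) → ℝ≥0∞} (hH : Measurable H) :
    ∫⁻ z, ENNReal.ofReal (quotJac (coef z) t) * (ENNReal.ofReal (gdens (quot (coef z) t)) *
      (H (shift z (quot (coef z) t)) * ENNReal.ofReal (gdens (shift z (quot (coef z) t))))) =
    ∫⁻ z, ENNReal.ofReal (kacWeight t (proj t z)) * H (proj t z) ∂(stdG _) := by
  obtain ⟨w, hw⟩ := exists_tangentFrame t
  obtain ⟨r, b, hb, -⟩ := exists_jet_basis hd hw
  have hb' : IsEvBasis (t : Eucl m) b := hb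
  have hGm : Measurable fun z : Fin m × DegIndex (m + 1) d → ℝ =>
      ENNReal.ofReal |(gradMat (coef z) (t : Eucl m)).det| := by
    have h := (continuous_det_gradMat (m := m) (d := d)).measurable.comp
      (f := fun z : Fin m × DegIndex (m + 1) d → ℝ => (coef z, (t : Eucl m)))
      (measurable_coef.prodMk measurable_const)
    exact h.norm.ennreal_ofReal
  have hs : (t : Eucl m) 0 ^ d ≠ 0 := pow_ne_zero _ ht
  set s := (t : Eucl m) 0 ^ d with hsdef
  have h1 : ∀ z : Fin m × DegIndex (m + 1) d → ℝ,
      ENNReal.ofReal (quotJac (coef z) t) * (ENNReal.ofReal (gdens (quot (coef z) t)) *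
      (H (shift z (quot (coef z) t)) * ENNReal.ofReal (gdens (shift z (quot (coef z) t))))) =
      ENNReal.ofReal ((|s| ^ m)⁻¹) * (ENNReal.ofReal (gdens (quot (coef z) t)) *
        (fun z => ENNReal.ofReal |(gradMat (coef z) (t : Eucl m)).det| * H z *
          ENNReal.ofReal (gdens z)) (shift z (quot (coef z) t))) := by
    intro z
    have : quotJac (coef z) t = (|s| ^ m)⁻¹ *
        |(gradMat (coef (shift z (quot (coef z) t))) (t : Eucl m)).det| := by
      rw [quotJac, coef_shift, abs_mul, abs_pow, abs_inv, inv_pow]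
    rw [this, ENNReal.ofReal_mul (by positivity)]
    ring
  simp only [h1]
  have hFm : Measurable fun z : Fin m × DegIndex (m + 1) d → ℝ =>
      ENNReal.ofReal |(gradMat (coef z) (t : Eucl m)).det| * H z * ENNReal.ofReal (gdens z) :=
    (hGm.mul hH).mul measurable_gdens.ennreal_ofReal
  rw [lintegral_const_mul' _ _ ENNReal.ofReal_ne_top,
    hb'.lintegral_quot ht measurable_gdens.ennreal_ofReal hFm, lintegral_gdens, mul_one,
    ← mul_assoc, ← ENNReal.ofReal_mul (by positivity), inv_mul_cancel₀ (by positivity),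
    ENNReal.ofReal_one, one_mul]
  refine (hb'.lintegral_drop (hGm.mul hH)).trans ?_
  rw [← lintegral_const_mul' _ _ ENNReal.ofReal_ne_top]
  refine lintegral_congr fun z => ?_
  rw [kacWeight, ENNReal.ofReal_mul (by positivity), mul_assoc]
  rfl

/-- The Kac-Rice formula, weighted by a nonnegative function of the whole system. Instead of
conditioning on a single level, it averages over all levels `y` and lets Tonelli's theorem exchange
the integrals over `y`, `z` and `t`. -/
theorem lintegral_numRoots_mul (hd : 1 ≤ d)
    {H : (Fin m × DegIndex (m + 1) d → ℝ) → ℝ≥0∞} (hH : Measurable H) :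
    ∫⁻ z, numRoots (coef z) * H z ∂(stdG _) =
      ∫⁻ t : Sph m, ∫⁻ z, ENNReal.ofReal (kacWeight t (proj t z)) * H (proj t z) ∂(stdG _)
        ∂(surf m) := by
  have hfin : IsFiniteMeasure (surf m) := by unfold surf; infer_instance
  let Φ : (Fin m × DegIndex (m + 1) d → ℝ) → ℝ≥0∞ := fun z => H z * ENNReal.ofReal (gdens z)
  have hΦ : Measurable Φ := hH.mul measurable_gdens.ennreal_ofReal
  have hN : Measurable fun z : Fin m × DegIndex (m + 1) d → ℝ => numRoots (coef z) :=
    measurable_numRoots.comp measurable_coef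
  have hsh : Measurable fun p : (Fin m → ℝ) × (Fin m × DegIndex (m + 1) d → ℝ) =>
      shift p.2 p.1 := by
    have h := (continuous_shift (m := m) (d := d)).measurable
    exact h.comp (measurable_snd.prodMk measurable_fst)
  have hSm : MeasurableSet {t : Sph m | (t : Eucl m) 0 ≠ 0} := by
    have : Measurable fun t : Sph m => (t : Eucl m) 0 := by fun_prop
    exact (this (measurableSet_singleton 0)).compl
  have hae : ∀ᵐ t : Sph m ∂(surf m), t ∈ {t : Sph m | (t : Eucl m) 0 ≠ 0} := by
    rw [ae_iff]
    simpa using surf_equator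
  calc ∫⁻ z, numRoots (coef z) * H z ∂(stdG _)
      = ∫⁻ z, numRoots (coef z) * Φ z := by
        refine (lintegral_stdG (hN.mul hH)).trans ?_
        exact lintegral_congr fun z => mul_assoc _ _ _
    -- By translation invariance the inner integral does not depend on `y`, so a Gaussian weight of
    -- total mass `1` can be inserted.
    _ = ∫⁻ y : Fin m → ℝ, ENNReal.ofReal (gdens y) *
          ∫⁻ z, numRoots (coef (shift z y)) * Φ (shift z y) := by
        simp only [lintegral_shift _ fun z => numRoots (coef z) * Φ z]
        rw [lintegral_mul_const _ measurable_gdens.ennreal_ofReal, lintegral_gdens, one_mul]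
    _ = ∫⁻ y : Fin m → ℝ, ∫⁻ z, numRoots (shift (coef z) y) *
          (ENNReal.ofReal (gdens y) * Φ (shift z y)) := by
        refine lintegral_congr fun y => ?_
        rw [← lintegral_const_mul' _ _ ENNReal.ofReal_ne_top]
        refine lintegral_congr fun z => ?_
        rw [coef_shift]; ring
    _ = ∫⁻ z, ∫⁻ y : Fin m → ℝ, numRoots (shift (coef z) y) *
          (ENNReal.ofReal (gdens y) * Φ (shift z y)) := by
        refine lintegral_lintegral_swap (Measurable.aemeasurable ?_)
        have h1 : Measurable fun p : (Fin m → ℝ) × (Fin m × DegIndex (m + 1) d → ℝ) =>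
            numRoots (shift (coef p.2) p.1) := by
          simp only [← coef_shift]
          exact hN.comp hsh
        exact h1.mul ((measurable_gdens.ennreal_ofReal.comp measurable_fst).mul (hΦ.comp hsh))
    -- The area formula applies for almost every `z`: a nonzero Macaulay determinant excludes roots
    -- on the equator.
    _ = ∫⁻ z, ∫⁻ t in {t : Sph m | (t : Eucl m) 0 ≠ 0}, ENNReal.ofReal (quotJac (coef z) t) *
          (ENNReal.ofReal (gdens (quot (coef z) t)) * Φ (shift z (quot (coef z) t))) ∂(surf m) ∂volume := by
        refine lintegral_congr_ae ?_
        filter_upwards [ae_det_macMat_coef (m := m) (d := d)] with z hz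
        refine (lintegral_quotJac hd (coef z) (fun t ht => zero_coord_ne_zero hz ht
          (ne_zero_of_mem_unit_sphere t)) (h := fun y => ENNReal.ofReal (gdens y) * Φ (shift z y))
          ?_).symm
        exact measurable_gdens.ennreal_ofReal.mul (hΦ.comp (hsh.comp
          (measurable_id.prodMk measurable_const)))
    _ = ∫⁻ t in {t : Sph m | (t : Eucl m) 0 ≠ 0}, ∫⁻ z, ENNReal.ofReal (quotJac (coef z) t) *
          (ENNReal.ofReal (gdens (quot (coef z) t)) * Φ (shift z (quot (coef z) t))) ∂volume ∂(surf m) := by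
        refine lintegral_lintegral_swap (Measurable.aemeasurable ?_)
        have hc : Measurable fun p : (Fin m × DegIndex (m + 1) d → ℝ) × Sph m =>
            (coef p.1, (p.2 : Eucl m)) :=
          (measurable_coef.comp measurable_fst).prodMk (measurable_subtype_coe.comp measurable_snd)
        have hq : Measurable fun p : (Fin m × DegIndex (m + 1) d → ℝ) × Sph m =>
            quot (coef p.1) (p.2 : Eucl m) := by
          have h := (measurable_quot (m := m) (d := d)).comp hc
          exact h
        have hj : Measurable fun p : (Fin m × DegIndex (m + 1) d → ℝ) × Sph m =>
            quotJac (coef p.1) (p.2 : Eucl m) := by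
          have h := (measurable_quotJac (m := m) (d := d)).comp hc
          exact h
        have hs := hΦ.comp (hsh.comp (hq.prodMk measurable_fst))
        have hg := (measurable_gdens (ι := Fin m)).ennreal_ofReal.comp hq
        exact hj.ennreal_ofReal.mul (hg.mul hs)
    _ = ∫⁻ t in {t : Sph m | (t : Eucl m) 0 ≠ 0},
          ∫⁻ z, ENNReal.ofReal (kacWeight t (proj t z)) * H (proj t z) ∂(stdG _) ∂(surf m) :=
        setLIntegral_congr_fun hSm fun t ht => lintegral_quotJac_mul hd t ht hH
    _ = _ := by rw [Measure.restrict_eq_self_of_ae_mem hae]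

end KacRiceSphere

end KSS
end

noncomputable section
namespace KSS

/-! ### Pairing the number of roots with polynomials. -/

section Expectation

variable {m d : ℕ}

instance : IsFiniteMeasure (surf m) := by unfold surf; infer_instance

theorem stdG_absolutelyContinuous {ι : Type*} [Fintype ι] : stdG ι ≪ volume := by
  rw [stdG_eq_withDensity]
  exact withDensity_absolutelyContinuous _ _

/-- A bound for the number of roots. -/
def rootBound (m d : ℕ) : ℕ := 2 * Fintype.card (DegIndex (m + 1) (m * (d - 1)))

theorem ae_stdG_det_macMat_ne_zero :
    ∀ᵐ z ∂(stdG (Fin m × DegIndex (m + 1) d)), (macMat (coef z)).det ≠ 0 :=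
  stdG_absolutelyContinuous.ae_le ae_det_macMat_coef

theorem numRoots_eq_encard (c : Fin m × DegIndex (m + 1) d → ℝ) :
    numRoots c = ((roots c).encard : ℝ≥0∞) := by
  have hm : MeasurableSet (roots c) := by
    have : roots c = (fun t : Sph m => (c, t)) ⁻¹'
      {p : (Fin m × DegIndex (m + 1) d → ℝ) × Sph m | p.2 ∈ roots p.1} := rfl
    rw [this]
    exact (isClosed_roots_graph.preimage (by fun_prop)).measurableSet
  rw [numRoots, Measure.count_apply hm]

theorem toReal_numRoots (c : Fin m × DegIndex (m + 1) d → ℝ) :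
    (numRoots c).toReal = (roots c).ncard := by
  rw [numRoots_eq_encard, Set.ncard]
  generalize (roots c).encard = n
  cases n with
  | top => simp
  | coe n => simp

theorem ae_numRoots_le :
    ∀ᵐ z ∂(stdG (Fin m × DegIndex (m + 1) d)), numRoots (coef z) ≤ rootBound m d := by
  filter_upwards [ae_stdG_det_macMat_ne_zero (m := m) (d := d)] with z hz
  rw [numRoots_eq_encard]
  have h := encard_roots_le hz
  calc ((roots (coef z)).encard : ℝ≥0∞)
      ≤ ((2 * Fintype.card (DegIndex (m + 1) (m * (d - 1))) : ℕ) : ℕ∞) := by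
        rw [ENat.toENNReal_le]; exact_mod_cast h
    _ = rootBound m d := by simp [rootBound]

theorem measurable_numRoots_coef :
    Measurable fun z : Fin m × DegIndex (m + 1) d → ℝ => numRoots (coef z) :=
  measurable_numRoots.comp measurable_coef

theorem chaosPoly_sys_mem_polyLE (q : ℕ) (t : Sph m) (w : Fin m → Eucl m) :
    (fun z : Fin m × DegIndex (m + 1) d → ℝ => chaosPoly m q (sysVal (coef z) t)
      (frameDeriv (coef z) (t : Eucl m) w)) ∈ polyLE (Fin m × DegIndex (m + 1) d) q := by
  refine chaosPoly_comp_mem_polyLE q (f := fun i z => sysVal (coef z) t i)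
    (g := fun i z => frameDeriv (coef z) (t : Eucl m) w i) (fun i => ?_) fun i => ?_
  · simp only [sysVal_coef _ _ _ w]
    exact sum_mul_mem_affineFun _
  · simp only [frameDeriv_coef]
    exact sum_mul_mem_affineFun _

/-- An orthonormal basis whose first elements are the normalized jet at `t`. -/
structure IsJetBasis {ρ : Type*} [Fintype ρ] (t : Eucl m) (w : Fin m → Eucl m)
    (b : OrthonormalBasis (Coord m ρ) ℝ
      (EuclideanSpace ℝ (Fin m × DegIndex (m + 1) d))) : Prop where
  val : ∀ l p, b (Sum.inl l) p = jetRow t w (Sum.inl l) p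
  deriv : ∀ q p, b (Sum.inr (Sum.inl q)) p = jetRow t w (Sum.inr q) p

section
variable {ρ : Type*} [Fintype ρ] {t : Sph m} {w : Fin m → Eucl m}
  {b : OrthonormalBasis (Coord m ρ) ℝ (EuclideanSpace ℝ (Fin m × DegIndex (m + 1) d))}

theorem IsJetBasis.isEvBasis (hb : IsJetBasis (t : Eucl m) w b) : IsEvBasis (t : Eucl m) b := hb.val

theorem IsJetBasis.sysVal_coordOut (hb : IsJetBasis (t : Eucl m) w b) (x : Coord m ρ → ℝ) :
    sysVal (coef (coordOut b x)) t = valCoord x := by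
  funext l
  rw [sysVal_coef _ _ _ w]
  simp only [← hb.val, sum_basis_mul_coordOut]
  rfl

theorem IsJetBasis.frameDeriv_coordOut (hb : IsJetBasis (t : Eucl m) w b) (x : Coord m ρ → ℝ) :
    frameDeriv (coef (coordOut b x)) (t : Eucl m) w = derivCoord x := by
  funext q
  rw [frameDeriv_coef]
  simp only [← hb.deriv, sum_basis_mul_coordOut]
  rfl

/-- In coordinates extending the normalized jet the Kac-Rice weight is `√d^m (2π)^{-m/2} |det|` of
the derivative coordinates and the projection is `dropVal`; `integral_absDet_dropVal` then applies.
-/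
theorem IsJetBasis.integral_kacWeight_mul (hd : 1 ≤ d) (hw : IsTangentFrame (t : Eucl m) w)
    (hb : IsJetBasis (t : Eucl m) w b) {Q : ℕ} {h : (Fin m × DegIndex (m + 1) d → ℝ) → ℝ}
    (hh : h ∈ polyLE _ Q) :
    ∫ z, kacWeight (t : Eucl m) (proj t z) * h (proj t z) ∂(stdG _) =
      √(d : ℝ) ^ m * ∫ z, (∑ q ∈ Finset.range (Q + 1), chaosPoly m q (sysVal (coef z) t)
        (frameDeriv (coef z) (t : Eucl m) w)) * h z ∂(stdG _) := by
  have hmp := measurePreserving_coordOut b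
  have hcont : Continuous fun z : Fin m × DegIndex (m + 1) d → ℝ =>
      kacWeight (t : Eucl m) (proj t z) * h (proj t z) := by
    have hp : Continuous fun z : Fin m × DegIndex (m + 1) d → ℝ => proj (t : Eucl m) z := by
      unfold proj; fun_prop
    have hc : Continuous fun z : Fin m × DegIndex (m + 1) d → ℝ => (coef z, (t : Eucl m)) := by
      unfold coef; fun_prop
    have hk : Continuous fun z : Fin m × DegIndex (m + 1) d → ℝ => kacWeight (t : Eucl m) z := by
      unfold kacWeight
      exact continuous_const.mul (continuous_det_gradMat.comp hc).abs
    exact (hk.comp hp).mul ((continuous_of_mem_polyLE hh).comp hp)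
  have hpoly : (fun z : Fin m × DegIndex (m + 1) d → ℝ => ∑ q ∈ Finset.range (Q + 1),
      chaosPoly m q (sysVal (coef z) t) (frameDeriv (coef z) (t : Eucl m) w)) ∈
      polyLE (Fin m × DegIndex (m + 1) d) Q := by
    have : (fun z : Fin m × DegIndex (m + 1) d → ℝ => ∑ q ∈ Finset.range (Q + 1),
      chaosPoly m q (sysVal (coef z) t) (frameDeriv (coef z) (t : Eucl m) w)) =
      ∑ q ∈ Finset.range (Q + 1), fun z => chaosPoly m q (sysVal (coef z) t)
        (frameDeriv (coef z) (t : Eucl m) w) := by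
      funext z; simp
    rw [this]
    exact Submodule.sum_mem _ fun q hq => polyLE_mono (Nat.lt_succ_iff.1 (Finset.mem_range.1 hq))
      (chaosPoly_sys_mem_polyLE q t w)
  have hprod : AEStronglyMeasurable (fun z : Fin m × DegIndex (m + 1) d → ℝ =>
      (∑ q ∈ Finset.range (Q + 1), chaosPoly m q (sysVal (coef z) t)
        (frameDeriv (coef z) (t : Eucl m) w)) * h z) ((stdG (Coord m ρ)).map (coordOut b)) :=
    ((continuous_of_mem_polyLE hpoly).mul (continuous_of_mem_polyLE hh)).aestronglyMeasurable
  rw [← hmp.map_eq, integral_map hmp.measurable.aemeasurable hcont.aestronglyMeasurable,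
    integral_map hmp.measurable.aemeasurable hprod]
  simp only [hb.isEvBasis.proj_coordOut, hb.sysVal_coordOut, hb.frameDeriv_coordOut]
  rw [← integral_absDet_dropVal (comp_coordOut_mem_polyLE b hh), ← integral_const_mul,
    ← integral_const_mul]
  refine integral_congr_ae (ae_of_all _ fun x => ?_)
  simp only [kacWeight, abs_det_gradMat hd _ hw, hb.frameDeriv_coordOut]
  have : derivCoord (dropVal x) = derivCoord x := rfl
  rw [this]
  ring

end

theorem exists_isJetBasis (hd : 1 ≤ d) {t : Eucl m} {w : Fin m → Eucl m}
    (hw : IsTangentFrame t w) : ∃ (r : ℕ) (b : OrthonormalBasis (Coord m (Fin r)) ℝ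
      (EuclideanSpace ℝ (Fin m × DegIndex (m + 1) d))), IsJetBasis t w b := by
  obtain ⟨r, b, h1, h2⟩ := exists_jet_basis hd hw
  exact ⟨r, b, h1, h2⟩

/-- The key identity: up to the factor `√d^m`, the number of roots and the integrated chaos
components of order at most `Q` have the same pairings with polynomials of degree at most `Q`. -/
theorem integral_numRoots_mul (hd : 1 ≤ d) (e : Frame m) {Q : ℕ}
    {h : (Fin m × DegIndex (m + 1) d → ℝ) → ℝ} (hh : h ∈ polyLE _ Q) :
    ∫ z, (numRoots (coef z)).toReal * h z ∂(stdG _) =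
      √(d : ℝ) ^ m * ∫ t, ∫ z, (∑ q ∈ Finset.range (Q + 1), chaosIntegrand q e (coef z) t) * h z
        ∂(stdG _) ∂(surf m) := by
  have hcont := continuous_of_mem_polyLE hh
  have hpm : Measurable fun p : Sph m × (Fin m × DegIndex (m + 1) d → ℝ) =>
      proj (p.1 : Eucl m) p.2 :=
    measurable_proj.comp (f := fun p : Sph m × (Fin m × DegIndex (m + 1) d → ℝ) =>
      ((p.1 : Eucl m), p.2)) (by fun_prop)
  have hkm : Measurable fun p : Sph m × (Fin m × DegIndex (m + 1) d → ℝ) =>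
      kacWeight (p.1 : Eucl m) (proj (p.1 : Eucl m) p.2) :=
    measurable_kacWeight.comp (f := fun p : Sph m × (Fin m × DegIndex (m + 1) d → ℝ) =>
      ((p.1 : Eucl m), proj (p.1 : Eucl m) p.2)) (by fun_prop)
  have hk0 : ∀ (t : Eucl m) (z : Fin m × DegIndex (m + 1) d → ℝ), 0 ≤ kacWeight t z := by
    intro t z; unfold kacWeight; positivity
  have hfin : ∀ᵐ z ∂(stdG (Fin m × DegIndex (m + 1) d)), numRoots (coef z) < ∞ :=
    ae_numRoots_le.mono fun z hz => hz.trans_lt (ENNReal.natCast_lt_top _)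
  -- Read as an equality of measures, the Kac-Rice formula passes from nonnegative functions to the
  -- signed `h`; integrability on the spherical side then comes for free from the bound on the
  -- number of roots.
  have hμ : (stdG (Fin m × DegIndex (m + 1) d)).withDensity (fun z => numRoots (coef z)) =
      (((surf m).prod (stdG (Fin m × DegIndex (m + 1) d))).withDensity fun p =>
        ENNReal.ofReal (kacWeight (p.1 : Eucl m) (proj (p.1 : Eucl m) p.2))).map
        fun p => proj (p.1 : Eucl m) p.2 := by
    refine Measure.ext_of_lintegral _ fun H hH => ?_
    rw [lintegral_withDensity_eq_lintegral_mul _ measurable_numRoots_coef hH,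
      lintegral_map hH hpm]
    refine ((lintegral_numRoots_mul hd hH).trans ?_).trans
      (lintegral_withDensity_eq_lintegral_mul _ hkm.ennreal_ofReal (hH.comp hpm)).symm
    rw [lintegral_prod _ (hkm.ennreal_ofReal.mul (hH.comp hpm)).aemeasurable]
    rfl
  have hint1 : Integrable h
      ((stdG (Fin m × DegIndex (m + 1) d)).withDensity (fun z => numRoots (coef z))) := by
    rw [integrable_withDensity_iff_integrable_smul' measurable_numRoots_coef hfin]
    refine Integrable.bdd_mul (c := rootBound m d) (integrable_of_mem_polyLE hh)
      measurable_numRoots_coef.ennreal_toReal.aestronglyMeasurable ?_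
    filter_upwards [ae_numRoots_le (m := m) (d := d)] with z hz
    rw [Real.norm_eq_abs, abs_of_nonneg ENNReal.toReal_nonneg]
    exact ENNReal.toReal_le_of_le_ofReal (by positivity) (by simpa using hz)
  have e1 : ∫ z, (numRoots (coef z)).toReal * h z ∂(stdG _) =
      ∫ z, h z ∂((stdG (Fin m × DegIndex (m + 1) d)).withDensity fun z => numRoots (coef z)) := by
    rw [integral_withDensity_eq_integral_toReal_smul measurable_numRoots_coef hfin]
    rfl
  rw [hμ] at hint1
  have hint2 := (integrable_map_measure hcont.aestronglyMeasurable hpm.aemeasurable).1 hint1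
  rw [integrable_withDensity_iff_integrable_smul' hkm.ennreal_ofReal (by simp)] at hint2
  rw [e1, hμ, integral_map hpm.aemeasurable hcont.aestronglyMeasurable,
    integral_withDensity_eq_integral_toReal_smul hkm.ennreal_ofReal (by simp)]
  refine (integral_prod _ hint2).trans ?_
  rw [← integral_const_mul]
  refine integral_congr_ae (ae_of_all _ fun t => ?_)
  obtain ⟨r, b, hb⟩ := exists_isJetBasis hd (isTangentFrame_of_frame e t)
  simp only [chaosIntegrand_eq, sysDeriv_eq_frameDeriv]
  rw [← hb.integral_kacWeight_mul hd (isTangentFrame_of_frame e t) hh]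
  refine integral_congr_ae (ae_of_all _ fun z => ?_)
  simp only [smul_eq_mul, Function.comp_apply]
  rw [ENNReal.toReal_ofReal (hk0 _ _)]

end Expectation

end KSS
end

noncomputable section
namespace KSS

/-! ### Independence of the tangent frame and measurability. -/

section Frame

variable {m d : ℕ}

/-- The tangent frame at `t` obtained by reflecting the standard basis. -/
def houseFrame (t : Eucl m) (k : Fin m) : Eucl m :=
  EuclideanSpace.single k.succ 1 -
    (2 * t k.succ / inner ℝ (t - EuclideanSpace.single 0 1) (t - EuclideanSpace.single 0 1)) •
      (t - EuclideanSpace.single 0 1)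

theorem measurable_houseFrame (k : Fin m) : Measurable fun t : Eucl m => houseFrame t k := by
  unfold houseFrame
  fun_prop

/-- The Householder reflection in `t - e_0` maps `e_0` to `t`, hence the other basis vectors to an
orthonormal basis of `t^⊥`. At `t = e_0` the subtracted vector is zero and the standard basis
remains. -/
theorem isTangentFrame_houseFrame (t : Sph m) : IsTangentFrame (t : Eucl m) (houseFrame t) := by
  have htt : inner ℝ (t : Eucl m) (t : Eucl m) = (1 : ℝ) := by
    rw [real_inner_self_eq_norm_sq]; simp
  have h00 : inner ℝ (EuclideanSpace.single 0 1 : Eucl m) (EuclideanSpace.single 0 1) = (1 : ℝ) := by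
    simp
  have h0k : ∀ k : Fin m, inner ℝ (EuclideanSpace.single 0 1 : Eucl m)
      (EuclideanSpace.single k.succ 1) = (0 : ℝ) := by
    intro k
    rw [EuclideanSpace.inner_single_left]
    simp
  have htk : ∀ i, inner ℝ (t : Eucl m) (EuclideanSpace.single i 1) = (t : Eucl m) i := by
    intro k
    rw [EuclideanSpace.inner_single_right]
    simp
  have hkt : ∀ i, inner ℝ (EuclideanSpace.single i 1) (t : Eucl m) = (t : Eucl m) i := by
    intro k
    rw [EuclideanSpace.inner_single_left]
    simp
  have hkk : ∀ k k' : Fin m, inner ℝ (EuclideanSpace.single k.succ 1 : Eucl m)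
      (EuclideanSpace.single k'.succ 1) = (if k = k' then 1 else 0 : ℝ) := by
    intro k k'
    simp [EuclideanSpace.inner_single_left]
  have hk0 : ∀ k : Fin m, inner ℝ (EuclideanSpace.single k.succ 1 : Eucl m)
      (EuclideanSpace.single 0 1) = (0 : ℝ) := by
    intro k; rw [real_inner_comm, h0k]
  have huu : inner ℝ ((t : Eucl m) - EuclideanSpace.single 0 1)
      ((t : Eucl m) - EuclideanSpace.single 0 1) = 2 - 2 * (t : Eucl m) 0 := by
    simp only [inner_sub_left, inner_sub_right, htt, h00, htk, hkt]
    ring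
  by_cases h1 : (t : Eucl m) 0 = 1
  · have hu : (t : Eucl m) - EuclideanSpace.single 0 1 = 0 := by
      rw [← inner_self_eq_zero (𝕜 := ℝ), huu, h1]; ring
    have htk0 : ∀ k : Fin m, (t : Eucl m) k.succ = 0 := by
      intro k
      rw [sub_eq_zero.1 hu]
      simp
    refine ⟨htt, fun k => ?_, fun k k' => ?_⟩
    · simp only [houseFrame, hu, smul_zero, sub_zero, htk, htk0]
    · simp only [houseFrame, hu, smul_zero, sub_zero, hkk]
  · have hne : 2 - 2 * (t : Eucl m) 0 ≠ 0 := by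
      intro h; apply h1; linarith
    refine ⟨htt, fun k => ?_, fun k k' => ?_⟩
    · simp only [houseFrame, huu, inner_sub_right, inner_smul_right, htk, htt]
      field_simp
      ring
    · simp only [houseFrame, huu, inner_sub_right, inner_sub_left, inner_smul_right, inner_smul_left,
        htk, htt, hkk, hk0, h0k, hkt, h00, RCLike.conj_to_real]
      field_simp
      ring

/-- The chaos integrand, in the frame `houseFrame`. -/
def chaosKernel (m q : ℕ) {d : ℕ} (c : Fin m × DegIndex (m + 1) d → ℝ) (t : Eucl m) : ℝ :=
  chaosPoly m q (fun l => homPoly (fun j => c (l, j)) t) (frameDeriv c t (houseFrame t))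

theorem IsTangentFrame.expand {t : Eucl m} {w : Fin m → Eucl m} (hw : IsTangentFrame t w)
    (v : Eucl m) (hv : inner ℝ t v = (0 : ℝ)) : v = ∑ k, (inner ℝ (w k) v : ℝ) • w k := by
  let W : Fin (m + 1) → Eucl m := Fin.cons t w
  have hW : Orthonormal ℝ W := by
    rw [orthonormal_iff_ite]
    intro i j
    refine Fin.cases ?_ (fun k => ?_) i <;> refine Fin.cases ?_ (fun k' => ?_) j
    · simpa only [W, Fin.cons_zero, if_true] using hw.norm_eq
    · simpa [W, (Fin.succ_ne_zero _).symm] using hw.inner_left k'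
    · simpa [W, real_inner_comm] using hw.inner_left k
    · simpa [W] using hw.inner_right k k'
  have hcard : Fintype.card (Fin (m + 1)) = Module.finrank ℝ (Eucl m) := by simp
  let b := basisOfOrthonormalOfCardEqFinrank hW hcard
  let B := b.toOrthonormalBasis (by simpa [b] using hW)
  have hB : ∀ i, B i = W i := by intro i; simp [B, b]
  conv_lhs => rw [← B.sum_repr v]
  simp only [OrthonormalBasis.repr_apply_apply, hB]
  rw [Fin.sum_univ_succ]
  simp [W, hv]

theorem frameDeriv_change (c : Fin m × DegIndex (m + 1) d → ℝ) {t : Eucl m}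
    {w w' : Fin m → Eucl m} (hw : IsTangentFrame t w) (hw' : IsTangentFrame t w') :
    ∃ O : Matrix (Fin m) (Fin m) ℝ, O.transpose * O = 1 ∧
      frameDeriv c t w' = rightMul O (frameDeriv c t w) := by
  refine ⟨Matrix.of fun j k => inner ℝ (w j) (w' k), ?_, ?_⟩
  · ext k k'
    rw [Matrix.one_apply, ← hw'.inner_right k k']
    conv_rhs => rw [hw.expand (w' k') (hw'.inner_left k')]
    simp only [Matrix.mul_apply, Matrix.transpose_apply, Matrix.of_apply, inner_sum,
      inner_smul_right]
    exact Finset.sum_congr rfl fun j _ => by rw [real_inner_comm (w j) (w' k)]; ring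
  · funext q
    simp only [frameDeriv, rightMul, Matrix.of_apply]
    conv_lhs => rw [hw.expand (w' q.2) (hw'.inner_left q.2)]
    simp only [map_sum, map_smul, smul_eq_mul, Finset.sum_div]
    exact Finset.sum_congr rfl fun j _ => by ring

theorem chaosPoly_frame (q : ℕ) (c : Fin m × DegIndex (m + 1) d → ℝ) {t : Eucl m}
    {w w' : Fin m → Eucl m} (hw : IsTangentFrame t w) (hw' : IsTangentFrame t w')
    (y : Fin m → ℝ) :
    chaosPoly m q y (frameDeriv c t w') = chaosPoly m q y (frameDeriv c t w) := by
  obtain ⟨O, hO, h⟩ := frameDeriv_change c hw hw'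
  simp only [chaosPoly, h, detPart_rightMul hO]

/-- The prescribed frame may depend on `t` without any measurability; two frames differ by an
orthogonal matrix, so the integrand is the one in the measurable frame `houseFrame`. -/
theorem chaosIntegrand_eq_chaosKernel (q : ℕ) (e : Frame m)
    (c : Fin m × DegIndex (m + 1) d → ℝ) (t : Sph m) :
    chaosIntegrand q e c t = chaosKernel m q c t := by
  rw [chaosIntegrand_eq, sysDeriv_eq_frameDeriv, chaosKernel,
    chaosPoly_frame q c (isTangentFrame_of_frame e t) (isTangentFrame_houseFrame t)]
  rfl

theorem continuous_sys :
    Continuous fun p : (Fin m × DegIndex (m + 1) d → ℝ) × Eucl m × (Fin m → Eucl m) =>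
      ((fun l => homPoly (fun j => p.1 (l, j)) p.2.1), frameDeriv p.1 p.2.1 p.2.2) := by
  refine Continuous.prodMk (continuous_pi fun l => ?_) (continuous_pi fun q => ?_)
  · exact continuous_homPoly.comp
      (f := fun p : (Fin m × DegIndex (m + 1) d → ℝ) × Eucl m × (Fin m → Eucl m) =>
        ((fun j => p.1 (l, j)), p.2.1)) (by fun_prop)
  · exact (continuous_homDeriv.comp
      (f := fun p : (Fin m × DegIndex (m + 1) d → ℝ) × Eucl m × (Fin m → Eucl m) =>
        ((fun j => p.1 (q.1, j)), p.2.1, p.2.2 q.2)) (by fun_prop)).div_const _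

theorem continuous_chaosPoly_sys (q : ℕ) :
    Continuous fun p : (Fin m × DegIndex (m + 1) d → ℝ) × Eucl m × (Fin m → Eucl m) =>
      chaosPoly m q (fun l => homPoly (fun j => p.1 (l, j)) p.2.1) (frameDeriv p.1 p.2.1 p.2.2) := by
  have h := (continuous_chaosPoly (m := m) q).comp (continuous_sys (m := m) (d := d))
  exact h

theorem measurable_chaosKernel (q : ℕ) :
    Measurable fun p : (Fin m × DegIndex (m + 1) d → ℝ) × Eucl m => chaosKernel m q p.1 p.2 := by
  have h := (continuous_chaosPoly_sys (m := m) (d := d) q).measurable.comp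
    (f := fun p : (Fin m × DegIndex (m + 1) d → ℝ) × Eucl m => (p.1, p.2, houseFrame p.2))
    (measurable_fst.prodMk (measurable_snd.prodMk
      (measurable_pi_lambda _ fun k => (measurable_houseFrame k).comp measurable_snd)))
  exact h

/-- Continuity of `houseFrame` is not needed: the expression is continuous in the point and the
frame vectors jointly, and these stay in a product of closed unit balls, which is compact. -/
theorem exists_chaosKernel_le (q : ℕ) (c : Fin m × DegIndex (m + 1) d → ℝ) :
    ∃ C : ℝ, ∀ t : Sph m, ‖chaosKernel m q c t‖ ≤ C := by
  have hK : IsCompact ((Metric.closedBall (0 : Eucl m) 1) ×ˢ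
      (Set.univ.pi fun _ : Fin m => Metric.closedBall (0 : Eucl m) 1)) :=
    (isCompact_closedBall _ _).prod (isCompact_univ_pi fun _ => isCompact_closedBall _ _)
  have hc := (continuous_chaosPoly_sys (m := m) (d := d) q).comp
    (f := fun p : Eucl m × (Fin m → Eucl m) => (c, p)) (by fun_prop)
  obtain ⟨C, hC⟩ := hK.exists_bound_of_continuousOn hc.continuousOn
  refine ⟨C, fun t => hC ((t : Eucl m), houseFrame t) ⟨by simp, fun k _ => ?_⟩⟩
  have := (isTangentFrame_houseFrame t).inner_right k k
  rw [real_inner_self_eq_norm_sq, if_pos rfl] at this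
  rw [mem_closedBall_zero_iff]
  nlinarith [norm_nonneg (houseFrame (t : Eucl m) k)]

theorem integrable_chaosIntegrand (q : ℕ) (e : Frame m) (c : Fin m × DegIndex (m + 1) d → ℝ) :
    Integrable (chaosIntegrand q e c) (surf m) := by
  have h1 : chaosIntegrand q e c = fun t : Sph m => chaosKernel m q c t :=
    funext fun t => chaosIntegrand_eq_chaosKernel q e c t
  rw [h1]
  obtain ⟨C, hC⟩ := exists_chaosKernel_le q c
  have hm : Measurable fun t : Sph m => chaosKernel m q c (t : Eucl m) :=
    (measurable_chaosKernel q).comp (f := fun t : Sph m => (c, (t : Eucl m))) (by fun_prop)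
  exact Integrable.of_bound hm.aestronglyMeasurable C (ae_of_all _ hC)

theorem measurePreserving_jet (hd : 1 ≤ d) {t : Eucl m} {w : Fin m → Eucl m}
    (hw : IsTangentFrame t w) :
    MeasurePreserving (fun (z : Fin m × DegIndex (m + 1) d → ℝ) κ => ∑ p, jetRow t w κ p * z p)
      (stdG _) (stdG (Fin m ⊕ (Fin m × Fin m))) :=
  measurePreserving_of_gram_eq_one _ (jetRow_gram hd hw)

theorem chaosKernel_coef (q : ℕ) (z : Fin m × DegIndex (m + 1) d → ℝ) (t : Sph m) :
    chaosKernel m q (coef z) t =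
      (fun x : Fin m ⊕ (Fin m × Fin m) → ℝ =>
        chaosPoly m q (fun l => x (Sum.inl l)) (fun p => x (Sum.inr p)))
        (fun κ => ∑ p, jetRow (t : Eucl m) (houseFrame t) κ p * z p) := by
  simp only [chaosKernel, ← sysVal_coef z t, ← frameDeriv_coef z (t : Eucl m)]
  rfl

/-- The second moment of the chaos integrand. -/
theorem memLp_chaosKernel (hd : 1 ≤ d) (q : ℕ) :
    MemLp (fun p : Sph m × (Fin m × DegIndex (m + 1) d → ℝ) =>
      chaosKernel m q (coef p.2) (p.1 : Eucl m)) 2 ((surf m).prod (stdG _)) := by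
  let f : (Fin m ⊕ (Fin m × Fin m) → ℝ) → ℝ := fun x =>
    chaosPoly m q (fun l => x (Sum.inl l)) (fun p => x (Sum.inr p))
  have hf : MemLp f 2 (stdG _) := memLp_two_of_mem_polyLE (Q := q)
    (chaosPoly_comp_mem_polyLE q (fun i => coord_mem_affineFun _) fun i => coord_mem_affineFun _)
  have hfc : Measurable fun x => ‖f x‖ₑ ^ (2 : ℝ) := by
    have : Continuous f := (continuous_chaosPoly q).comp
      (f := fun x : Fin m ⊕ (Fin m × Fin m) → ℝ => ((fun l => x (Sum.inl l)), fun p => x (Sum.inr p)))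
      (by fun_prop)
    exact (this.measurable.enorm).pow_const _
  have hm : Measurable fun p : Sph m × (Fin m × DegIndex (m + 1) d → ℝ) =>
      chaosKernel m q (coef p.2) (p.1 : Eucl m) := by
    have h := (measurable_chaosKernel (m := m) (d := d) q).comp
      (f := fun p : Sph m × (Fin m × DegIndex (m + 1) d → ℝ) => (coef p.2, (p.1 : Eucl m)))
      ((measurable_coef.comp measurable_snd).prodMk (measurable_subtype_coe.comp measurable_fst))
    exact h
  refine ⟨hm.aestronglyMeasurable, ?_⟩
  rw [eLpNorm_lt_top_iff_lintegral_rpow_enorm_lt_top (by norm_num) (by norm_num)]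
  have hf2 := hf.2
  rw [eLpNorm_lt_top_iff_lintegral_rpow_enorm_lt_top (by norm_num) (by norm_num)] at hf2
  simp only [ENNReal.toReal_ofNat] at hf2 ⊢
  rw [lintegral_prod _ (hm.enorm.pow_const _).aemeasurable]
  -- The jet has the same standard Gaussian law at every point, so the second moment does not depend
  -- on `t`.
  have : ∀ t : Sph m, ∫⁻ z : Fin m × DegIndex (m + 1) d → ℝ,
      ‖chaosKernel m q (coef z) (t : Eucl m)‖ₑ ^ (2 : ℝ) ∂(stdG _) =
      ∫⁻ x, ‖f x‖ₑ ^ (2 : ℝ) ∂(stdG _) := by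
    intro t
    rw [← (measurePreserving_jet hd (isTangentFrame_houseFrame t)).lintegral_comp hfc]
    simp only [chaosKernel_coef]
    rfl
  simp only [this, lintegral_const]
  exact ENNReal.mul_lt_top hf2 (measure_lt_top _ _)

end Frame

end KSS
end

noncomputable section
namespace KSS

/-! ### Hilbert space arguments -/

section ParamIntegral

variable {T X : Type*} [MeasurableSpace T] [MeasurableSpace X] {μ : Measure T} {ν : Measure X}
  [IsFiniteMeasure μ] [IsFiniteMeasure ν] {F : T × X → ℝ}

/-- Cauchy-Schwarz in `t`, using that `μ` is finite. -/
theorem memLp_integral_fst (hF : MemLp F 2 (μ.prod ν)) :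
    MemLp (fun x => ∫ t, F (t, x) ∂μ) 2 ν := by
  have hsw : MemLp (fun p : X × T => F p.swap) 2 (ν.prod μ) :=
    hF.comp_measurePreserving Measure.measurePreserving_swap
  have hm : AEStronglyMeasurable (fun x => ∫ t, F (t, x) ∂μ) ν := hsw.1.integral_prod_right'
  refine ⟨hm, ?_⟩
  have h2 := hsw.2
  rw [eLpNorm_lt_top_iff_lintegral_rpow_enorm_lt_top (by norm_num) (by norm_num)] at h2 ⊢
  simp only [ENNReal.toReal_ofNat] at h2 ⊢
  rw [lintegral_prod _ (hsw.1.enorm.pow_const _)] at h2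
  have hsec : ∀ᵐ x ∂ν, AEStronglyMeasurable (fun t => F (t, x)) μ := hsw.1.prodMk_left
  have hle : ∀ᵐ x ∂ν, ‖∫ t, F (t, x) ∂μ‖ₑ ^ (2 : ℝ) ≤
      (∫⁻ t, ‖F (t, x)‖ₑ ^ (2 : ℝ) ∂μ) * μ Set.univ := by
    filter_upwards [hsec] with x hx
    have h1 := eLpNorm_le_eLpNorm_mul_rpow_measure_univ (p := 1) (q := 2) (by norm_num) hx
    have h3 : ‖∫ t, F (t, x) ∂μ‖ₑ ≤ eLpNorm (fun t => F (t, x)) 2 μ * μ Set.univ ^ (1 / 2 : ℝ) := by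
      refine (enorm_integral_le_lintegral_enorm _).trans ?_
      rw [eLpNorm_one_eq_lintegral_enorm] at h1
      refine h1.trans (le_of_eq ?_)
      norm_num
    refine (ENNReal.rpow_le_rpow h3 (by norm_num : (0 : ℝ) ≤ 2)).trans (le_of_eq ?_)
    rw [ENNReal.mul_rpow_of_nonneg _ _ (by norm_num), ← ENNReal.rpow_mul,
      eLpNorm_eq_lintegral_rpow_enorm_toReal (by norm_num) (by norm_num), ← ENNReal.rpow_mul]
    norm_num
  refine (lintegral_mono_ae hle).trans_lt ?_
  rw [lintegral_mul_const'' _ (by exact (hsw.1.enorm.pow_const _).lintegral_prod_right')]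
  exact ENNReal.mul_lt_top h2 (measure_lt_top _ _)

theorem integral_mul_integral_fst (hF : MemLp F 2 (μ.prod ν)) {g : X → ℝ} (hg : MemLp g 2 ν) :
    ∫ x, g x * ∫ t, F (t, x) ∂μ ∂ν = ∫ t, ∫ x, g x * F (t, x) ∂ν ∂μ := by
  have hg2 : MemLp (fun p : T × X => g p.2) 2 (μ.prod ν) := hg.comp_snd μ
  have hint : Integrable (fun p : T × X => g p.2 * F p) (μ.prod ν) := hg2.integrable_mul hF
  simp only [← integral_const_mul]
  exact (integral_integral_swap hint).symm

/-- A closed subspace is its own double orthogonal complement. By Fubini, a vector orthogonal to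
every section is orthogonal to their integral, so no vector-valued integral is required. -/
theorem integral_fst_mem_of_isClosed (hF : MemLp F 2 (μ.prod ν)) {K : Submodule ℝ (Lp ℝ 2 ν)}
    (hK : IsClosed (K : Set (Lp ℝ 2 ν)))
    (hmem : ∀ t, ∃ h : MemLp (fun x => F (t, x)) 2 ν, h.toLp _ ∈ K) :
    (memLp_integral_fst hF).toLp _ ∈ K := by
  have : CompleteSpace K := hK.completeSpace_coe
  rw [← Submodule.orthogonal_orthogonal K, Submodule.mem_orthogonal']
  intro g hg
  rw [L2.inner_def]
  have hg0 : ∀ t, ∫ x, g x * F (t, x) ∂ν = 0 := by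
    intro t
    obtain ⟨h, hm⟩ := hmem t
    have := (Submodule.mem_orthogonal' K g).1 hg _ hm
    rw [L2.inner_def] at this
    rw [← this]
    refine integral_congr_ae ?_
    filter_upwards [h.coeFn_toLp] with x hx
    rw [hx]
    simp [mul_comm]
  have h1 : ∫ x, inner ℝ ((memLp_integral_fst hF).toLp _ x) (g x) ∂ν =
      ∫ x, g x * ∫ t, F (t, x) ∂μ ∂ν := by
    refine integral_congr_ae ?_
    filter_upwards [(memLp_integral_fst hF).coeFn_toLp] with x hx
    rw [hx]
    simp
  rw [h1, integral_mul_integral_fst hF (Lp.memLp g)]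
  simp [hg0]

end ParamIntegral

/-! ### Density of polynomials in the Gaussian `L²` space. -/

section Density

variable {ι : Type*} [Fintype ι]

theorem strongDual_mem_affineFun (L : StrongDual ℝ (ι → ℝ)) : (fun x => L x) ∈ affineFun ι := by
  classical
  have : (fun x => L x) = fun x : ι → ℝ => ∑ i, L (Pi.single i 1) * x i := by
    funext x
    conv_lhs => rw [← Finset.univ_sum_single x]
    rw [map_sum]
    refine Finset.sum_congr rfl fun i _ => ?_
    have : (Pi.single i (x i) : ι → ℝ) = x i • Pi.single i 1 := by
      rw [← Pi.single_smul, smul_eq_mul, mul_one]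
    rw [this, map_smul, smul_eq_mul, mul_comm]
  rw [this]
  exact sum_mul_mem_affineFun _

theorem integrable_exp_strongDual (L : StrongDual ℝ (ι → ℝ)) :
    Integrable (fun x => Real.exp (L x)) (stdG ι) := by
  classical
  have : (fun x => Real.exp (L x)) = fun x : ι → ℝ => ∏ i, Real.exp (L (Pi.single i 1) * x i) := by
    funext x
    rw [← Real.exp_sum]
    congr 1
    conv_lhs => rw [← Finset.univ_sum_single x]
    rw [map_sum]
    refine Finset.sum_congr rfl fun i _ => ?_
    have : (Pi.single i (x i) : ι → ℝ) = x i • Pi.single i 1 := by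
      rw [← Pi.single_smul, smul_eq_mul, mul_one]
    rw [this, map_smul, smul_eq_mul, mul_comm]
  rw [this]
  exact Integrable.fintype_prod (f := fun i x => Real.exp (L (Pi.single i 1) * x))
    fun i => integrable_exp_mul_gaussianReal _

theorem memLp_exp_abs_strongDual (L : StrongDual ℝ (ι → ℝ)) :
    MemLp (fun x => Real.exp |L x|) 2 (stdG ι) := by
  have hc : Continuous fun x : ι → ℝ => Real.exp |L x| := by fun_prop
  rw [memLp_two_iff_integrable_sq hc.aestronglyMeasurable]
  refine Integrable.mono' ((integrable_exp_strongDual ((2 : ℝ) • L)).add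
    (integrable_exp_strongDual ((-2 : ℝ) • L))) (hc.pow 2).aestronglyMeasurable
    (ae_of_all _ fun x => ?_)
  rw [Real.norm_eq_abs, abs_of_nonneg (by positivity), ← Real.exp_nat_mul]
  simp only [Pi.add_apply, smul_apply, smul_eq_mul]
  push_cast
  rcases abs_cases (L x) with ⟨h, -⟩ | ⟨h, -⟩ <;> rw [h]
  · linarith [Real.exp_pos (-2 * L x)]
  · have : (2 : ℝ) * -L x = -2 * L x := by ring
    rw [this]
    linarith [Real.exp_pos (2 * L x)]

/-- Expand the exponential: each term pairs `g` with a power of a linear form, and the series is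
dominated by `|g| e^{|L|}`, a product of two square integrable functions. -/
theorem integral_mul_exp_eq_zero {g : (ι → ℝ) → ℝ} (hg : MemLp g 2 (stdG ι))
    (h0 : ∀ Q, ∀ h ∈ polyLE ι Q, ∫ x, g x * h x ∂(stdG ι) = 0) (L : StrongDual ℝ (ι → ℝ)) :
    ∫ x, (g x : ℂ) * Complex.exp (L x * Complex.I) ∂(stdG ι) = 0 := by
  have hsum : HasSum (fun n : ℕ => ∫ x, (g x : ℂ) * ((L x * Complex.I) ^ n / n.factorial) ∂(stdG ι))
      (∫ x, (g x : ℂ) * Complex.exp (L x * Complex.I) ∂(stdG ι)) := by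
    have hb : ∀ x : ι → ℝ, HasSum (fun n : ℕ => |g x| * (|L x| ^ n / n.factorial))
        (|g x| * Real.exp |L x|) := by
      intro x
      have := NormedSpace.expSeries_div_hasSum_exp (𝔸 := ℝ) (|L x|)
      rw [← Real.exp_eq_exp_ℝ] at this
      exact this.mul_left _
    refine hasSum_integral_of_dominated_convergence
      (fun n x => |g x| * (|L x| ^ n / n.factorial)) (fun n => ?_) (fun n => ?_) ?_ ?_ ?_
    · refine AEStronglyMeasurable.mul (Complex.continuous_ofReal.comp_aestronglyMeasurable hg.1) ?_
      exact Continuous.aestronglyMeasurable (by fun_prop)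
    · refine ae_of_all _ fun x => le_of_eq ?_
      simp [Complex.norm_real]
    · exact ae_of_all _ fun x => (hb x).summable
    · simp only [(hb _).tsum_eq]
      exact hg.norm.integrable_mul (memLp_exp_abs_strongDual L)
    · refine ae_of_all _ fun x => ?_
      have := NormedSpace.expSeries_div_hasSum_exp (𝔸 := ℂ) (L x * Complex.I)
      rw [← Complex.exp_eq_exp_ℂ] at this
      exact this.mul_left _
  have hz : ∀ n : ℕ, ∫ x, (g x : ℂ) * ((L x * Complex.I) ^ n / n.factorial) ∂(stdG ι) = 0 := by
    intro n
    have : ∀ x, (g x : ℂ) * ((L x * Complex.I) ^ n / n.factorial) =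
        ((g x * ((fun x => L x) ^ n : (ι → ℝ) → ℝ) x : ℝ) : ℂ) *
          (Complex.I ^ n / n.factorial) := by
      intro x
      simp only [Pi.pow_apply]
      push_cast
      ring
    simp only [this]
    rw [integral_mul_const, integral_complex_ofReal,
      h0 n _ (pow_mem_polyLE (strongDual_mem_affineFun L) n)]
    simp
  simp only [hz] at hsum
  exact hsum.unique hasSum_zero

/-- The positive and negative parts of `g` are densities of two finite measures. Their
characteristic functions agree by the preceding lemma, so the measures and then the densities agree.
-/
theorem ae_eq_zero_of_integral_mul_polyLE {g : (ι → ℝ) → ℝ} (hg : MemLp g 2 (stdG ι))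
    (h0 : ∀ Q, ∀ h ∈ polyLE ι Q, ∫ x, g x * h x ∂(stdG ι) = 0) : g =ᵐ[stdG ι] 0 := by
  have hgi : Integrable g (stdG ι) := hg.integrable (by norm_num)
  have hm1 : AEMeasurable (fun x => ENNReal.ofReal (g x)) (stdG ι) := hg.1.aemeasurable.ennreal_ofReal
  have hm2 : AEMeasurable (fun x => ENNReal.ofReal (-g x)) (stdG ι) :=
    hg.1.aemeasurable.neg.ennreal_ofReal
  have hf1 : ∫⁻ x, ENNReal.ofReal (g x) ∂(stdG ι) ≠ ∞ := hgi.lintegral_lt_top.ne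
  have hf2 : ∫⁻ x, ENNReal.ofReal (-g x) ∂(stdG ι) ≠ ∞ := hgi.neg.lintegral_lt_top.ne
  have := isFiniteMeasure_withDensity hf1
  have := isFiniteMeasure_withDensity hf2
  have key : (stdG ι).withDensity (fun x => ENNReal.ofReal (g x)) =
      (stdG ι).withDensity fun x => ENNReal.ofReal (-g x) := by
    refine Measure.ext_of_charFunDual ?_
    funext L
    rw [charFunDual_apply, charFunDual_apply,
      integral_withDensity_eq_integral_toReal_smul₀ hm1 (by simp),
      integral_withDensity_eq_integral_toReal_smul₀ hm2 (by simp), ← sub_eq_zero]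
    have hbd : ∀ f : (ι → ℝ) → ℝ, Integrable f (stdG ι) → Integrable
        (fun x => (ENNReal.ofReal (f x)).toReal • Complex.exp (L x * Complex.I)) (stdG ι) := by
      intro f hf
      have h1 : Integrable (fun x => (ENNReal.ofReal (f x)).toReal) (stdG ι) := by
        simpa [ENNReal.toReal_ofReal'] using hf.pos_part
      refine h1.smul_bdd (C := 1) ?_ ?_
      · exact Continuous.aestronglyMeasurable (by fun_prop)
      · exact ae_of_all _ fun x => by rw [Complex.norm_exp_ofReal_mul_I]
    rw [← integral_sub (hbd _ hgi) (hbd (fun x => -g x) hgi.neg), ← integral_mul_exp_eq_zero hg h0 L]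
    refine integral_congr_ae (ae_of_all _ fun x => ?_)
    simp only [ENNReal.toReal_ofReal', ← sub_smul]
    rw [Complex.real_smul]
    congr 2
    rcases le_total (g x) 0 with h | h
    · rw [max_eq_right h, max_eq_left (by linarith)]; ring
    · rw [max_eq_left h, max_eq_right (by linarith)]; ring
  have h3 := (withDensity_eq_iff hm1 hm2 hf1).1 key
  filter_upwards [h3] with x hx
  rcases le_total (g x) 0 with h | h
  · rw [ENNReal.ofReal_of_nonpos h, eq_comm, ENNReal.ofReal_eq_zero] at hx
    simp only [Pi.zero_apply]; linarith
  · rw [ENNReal.ofReal_of_nonpos (by linarith : -g x ≤ 0), ENNReal.ofReal_eq_zero] at hx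
    simp only [Pi.zero_apply]; linarith

end Density

end KSS
end

noncomputable section
namespace KSS

/-! ### Projections onto polynomials of bounded degree. -/

section PolyL2

variable {ι : Type*} [Fintype ι]

/-- The closed subspace of `L²` of the polynomials of degree at most `Q`. -/
def polyL2 (ι : Type*) [Fintype ι] (Q : ℕ) : Submodule ℝ (Lp ℝ 2 (stdG ι)) :=
  (Submodule.span ℝ {x : Lp ℝ 2 (stdG ι) | ∃ f ∈ polyLE ι Q, x =ᵐ[stdG ι] f}).topologicalClosure

theorem isClosed_polyL2 (Q : ℕ) : IsClosed (polyL2 ι Q : Set (Lp ℝ 2 (stdG ι))) :=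
  Submodule.isClosed_topologicalClosure _

instance (Q : ℕ) : CompleteSpace (polyL2 ι Q) := (isClosed_polyL2 Q).completeSpace_coe

theorem toLp_mem_polyL2 {Q : ℕ} {f : (ι → ℝ) → ℝ} (hf : f ∈ polyLE ι Q) :
    (memLp_two_of_mem_polyLE hf).toLp f ∈ polyL2 ι Q :=
  Submodule.le_topologicalClosure _ (Submodule.subset_span ⟨f, hf, MemLp.coeFn_toLp _⟩)

theorem monotone_polyL2 : Monotone (polyL2 ι) := by
  intro a b hab
  refine Submodule.topologicalClosure_mono (Submodule.span_mono ?_)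
  rintro x ⟨f, hf, hx⟩
  exact ⟨f, polyLE_mono hab hf, hx⟩

theorem inner_toLp {X : Type*} [MeasurableSpace X] {ν : Measure X} (g : Lp ℝ 2 ν) {f : X → ℝ}
    (hf : MemLp f 2 ν) : inner ℝ g (hf.toLp f) = ∫ x, g x * f x ∂ν := by
  rw [L2.inner_def]
  refine integral_congr_ae ?_
  filter_upwards [hf.coeFn_toLp] with x hx
  rw [hx]
  simp [mul_comm]

theorem mem_orthogonal_polyL2 {Q : ℕ} {g : Lp ℝ 2 (stdG ι)}
    (h : ∀ f ∈ polyLE ι Q, ∫ x, g x * f x ∂(stdG ι) = 0) : g ∈ (polyL2 ι Q)ᗮ := by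
  rw [polyL2, Submodule.orthogonal_closure, Submodule.mem_orthogonal']
  intro u hu
  induction hu using Submodule.span_induction with
  | mem x hx =>
    obtain ⟨f, hf, hfx⟩ := hx
    have : x = (memLp_two_of_mem_polyLE hf).toLp f := by
      refine Lp.ext ?_
      exact hfx.trans (MemLp.coeFn_toLp _).symm
    rw [this, inner_toLp, h f hf]
  | zero => simp
  | add a b _ _ ha hb => rw [inner_add_right, ha, hb, add_zero]
  | smul r a _ ha => rw [inner_smul_right, ha, mul_zero]

theorem top_le_closure_iSup_polyL2 : ⊤ ≤ (⨆ Q, polyL2 ι Q).topologicalClosure := by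
  refine le_of_eq (Eq.symm ?_)
  rw [Submodule.topologicalClosure_eq_top_iff, Submodule.eq_bot_iff]
  intro g hg
  rw [← Submodule.iInf_orthogonal, Submodule.mem_iInf] at hg
  have h0 := ae_eq_zero_of_integral_mul_polyLE (Lp.memLp g) fun Q h hh => by
    rw [← inner_toLp g (memLp_two_of_mem_polyLE hh)]
    exact (Submodule.mem_orthogonal' _ _).1 (hg Q) _ (toLp_mem_polyL2 hh)
  exact (Lp.eq_zero_iff_ae_eq_zero).2 h0

/-- The hypotheses say that `S Q` is the orthogonal projection of `X` onto `polyL2 ι Q`. Projections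
onto an increasing family with dense union converge strongly to the identity. -/
theorem tendsto_eLpNorm_of_polyL2 {X : (ι → ℝ) → ℝ} {S : ℕ → (ι → ℝ) → ℝ}
    (hX : MemLp X 2 (stdG ι)) (hS : ∀ Q, MemLp (S Q) 2 (stdG ι))
    (hmem : ∀ Q, (hS Q).toLp _ ∈ polyL2 ι Q)
    (horth : ∀ Q, ∀ h ∈ polyLE ι Q, ∫ x, X x * h x ∂(stdG ι) = ∫ x, S Q x * h x ∂(stdG ι)) :
    Tendsto (fun Q => eLpNorm (fun x => X x - S Q x) 2 (stdG ι)) atTop (𝓝 0) := by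
  have hproj : ∀ Q, (polyL2 ι Q).starProjection (hX.toLp X) = (hS Q).toLp _ := by
    intro Q
    refine Submodule.eq_starProjection_of_mem_orthogonal (hmem Q) ?_
    refine mem_orthogonal_polyL2 fun f hf => ?_
    have hf2 := memLp_two_of_mem_polyLE hf
    have h1 : ∫ x, (hX.toLp X - (hS Q).toLp (S Q) : Lp ℝ 2 (stdG ι)) x * f x ∂(stdG ι) =
        ∫ x, (X x * f x - S Q x * f x) ∂(stdG ι) := by
      refine integral_congr_ae ?_
      filter_upwards [Lp.coeFn_sub (hX.toLp X) ((hS Q).toLp (S Q)), hX.coeFn_toLp,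
        (hS Q).coeFn_toLp] with x h1 h2 h3
      rw [h1, Pi.sub_apply, h2, h3, sub_mul]
    have i1 : Integrable (fun x => X x * f x) (stdG ι) := hX.integrable_mul hf2
    have i2 : Integrable (fun x => S Q x * f x) (stdG ι) := (hS Q).integrable_mul hf2
    rw [h1, integral_sub i1 i2, horth Q f hf, sub_self]
  have ht := Submodule.starProjection_tendsto_self (polyL2 ι) monotone_polyL2 (hX.toLp X)
    top_le_closure_iSup_polyL2
  simp only [hproj] at ht
  rw [tendsto_iff_edist_tendsto_0] at ht
  refine ht.congr fun Q => ?_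
  rw [edist_comm, Lp.edist_toLp_toLp]
  rfl

end PolyL2

/-! ### The expansion for standard coefficients and its constant term. -/

section Expansion

variable {m d : ℕ}

theorem memLp_toReal_numRoots :
    MemLp (fun z : Fin m × DegIndex (m + 1) d → ℝ => (numRoots (coef z)).toReal) 2 (stdG _) := by
  refine MemLp.of_bound measurable_numRoots_coef.ennreal_toReal.aestronglyMeasurable
    (rootBound m d) ?_
  filter_upwards [ae_numRoots_le (m := m) (d := d)] with z hz
  rw [Real.norm_eq_abs, abs_of_nonneg ENNReal.toReal_nonneg]
  exact ENNReal.toReal_le_of_le_ofReal (by positivity) (by simpa using hz)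

theorem chaosKernel_mem_polyLE (q : ℕ) (t : Sph m) :
    (fun z : Fin m × DegIndex (m + 1) d → ℝ => chaosKernel m q (coef z) (t : Eucl m)) ∈
      polyLE (Fin m × DegIndex (m + 1) d) q :=
  chaosPoly_sys_mem_polyLE q t (houseFrame t)

/-- The partial sums of the chaos integrands. -/
def chaosSum (Q : ℕ) (p : Sph m × (Fin m × DegIndex (m + 1) d → ℝ)) : ℝ :=
  √(d : ℝ) ^ m * ∑ q ∈ Finset.range (Q + 1), chaosKernel m q (coef p.2) (p.1 : Eucl m)

theorem memLp_chaosSum (hd : 1 ≤ d) (Q : ℕ) :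
    MemLp (chaosSum (m := m) (d := d) Q) 2 ((surf m).prod (stdG _)) := by
  have h := memLp_finsetSum (Finset.range (Q + 1)) fun q _ => memLp_chaosKernel (m := m) (d := d) hd q
  exact h.const_mul (√(d : ℝ) ^ m)

theorem chaosSum_mem_polyLE (Q : ℕ) (t : Sph m) :
    (fun z => chaosSum (m := m) (d := d) Q (t, z)) ∈ polyLE (Fin m × DegIndex (m + 1) d) Q := by
  have : (fun z => chaosSum (m := m) (d := d) Q (t, z)) = √(d : ℝ) ^ m •
      ∑ q ∈ Finset.range (Q + 1), fun z => chaosKernel m q (coef z) (t : Eucl m) := by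
    funext z; simp [chaosSum]
  rw [this]
  exact Submodule.smul_mem _ _ (Submodule.sum_mem _ fun q hq =>
    polyLE_mono (Nat.lt_succ_iff.1 (Finset.mem_range.1 hq)) (chaosKernel_mem_polyLE q t))

theorem tendsto_eLpNorm_numRoots_sub_chaosSum (hd : 1 ≤ d) (e : Frame m) :
    Tendsto (fun Q => eLpNorm (fun z : Fin m × DegIndex (m + 1) d → ℝ =>
      (numRoots (coef z)).toReal - ∫ t, chaosSum Q (t, z) ∂(surf m)) 2 (stdG _)) atTop (𝓝 0) := by
  refine tendsto_eLpNorm_of_polyL2 memLp_toReal_numRoots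
    (fun Q => memLp_integral_fst (memLp_chaosSum hd Q)) (fun Q => ?_) fun Q h hh => ?_
  · refine integral_fst_mem_of_isClosed (memLp_chaosSum hd Q) (isClosed_polyL2 Q) fun t => ?_
    exact ⟨_, toLp_mem_polyL2 (chaosSum_mem_polyLE Q t)⟩
  · rw [integral_numRoots_mul hd e hh]
    simp only [mul_comm _ (h _)]
    rw [integral_mul_integral_fst (memLp_chaosSum hd Q) (memLp_two_of_mem_polyLE hh),
      ← integral_const_mul]
    refine integral_congr_ae (ae_of_all _ fun t => ?_)
    simp only
    rw [← integral_const_mul]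
    refine integral_congr_ae (ae_of_all _ fun z => ?_)
    simp only [chaosIntegrand_eq_chaosKernel, chaosSum]
    ring

theorem chaosPoly_zero (y : Fin m → ℝ) (y' : Fin m × Fin m → ℝ) :
    chaosPoly m 0 y y' = chaosPoly m 0 0 0 := by
  simp [chaosPoly, diracPart, detPart, hermProd]

/-- In degree one the system is a linear map to a space of smaller dimension, so it has a nonzero
kernel vector, which is then normalized. -/
theorem exists_root_of_one (c : Fin m × DegIndex (m + 1) 1 → ℝ) : ∃ t : Sph m, t ∈ roots c := by
  have hex : ∀ j : DegIndex (m + 1) 1, ∃ i, ∀ t : Eucl m, mon j.1 t = t i := by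
    intro j
    have hj := mem_piAntidiag_univ.1 j.2
    obtain ⟨i, hi⟩ : ∃ i, j.1 i ≠ 0 := by
      by_contra! h
      simp [h] at hj
    have h1 : j.1 = Pi.single i 1 := by
      have hs := Finset.add_sum_erase Finset.univ j.1 (Finset.mem_univ i)
      rw [hj] at hs
      have h0 : ∑ k ∈ Finset.univ.erase i, j.1 k = 0 := by omega
      funext k
      by_cases hk : k = i
      · subst hk; simp; omega
      · rw [Pi.single_eq_of_ne hk]
        exact Finset.sum_eq_zero_iff.1 h0 k (by simp [hk])
    exact ⟨i, fun t => by rw [h1, mon_single, pow_one]⟩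
  choose i hi using hex
  let A : Eucl m →ₗ[ℝ] (Fin m → ℝ) := LinearMap.pi fun l =>
    ∑ j, c (l, j) • (EuclideanSpace.proj (𝕜 := ℝ) (i j)).toLinearMap
  have hA : ∀ t l, A t l = homPoly (fun j => c (l, j)) t := by
    intro t l
    simp [A, homPoly_eq_sum_mon, hi]
  obtain ⟨u, hu, hu0⟩ := (Submodule.ne_bot_iff _).1
    (LinearMap.ker_ne_bot_of_finrank_lt (f := A) (by simp))
  have hn : ‖u‖ ≠ 0 := norm_ne_zero_iff.2 hu0
  refine ⟨⟨‖u‖⁻¹ • u, by simp [norm_smul, hn]⟩, fun l => ?_⟩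
  simp only [sysVal]
  rw [homPoly_smul, ← hA, LinearMap.mem_ker.1 hu]
  simp

/-- For `d = 1` the generic bound is twice the number of monomials of degree `0`, that is `2`, and
it is attained by a root and its antipode. -/
theorem encard_roots_of_one {c : Fin m × DegIndex (m + 1) 1 → ℝ} (hc : (macMat c).det ≠ 0) :
    (roots c).encard = 2 := by
  refine le_antisymm ?_ ?_
  · refine (encard_roots_le hc).trans (le_of_eq ?_)
    have : Fintype.card (DegIndex (m + 1) (m * (1 - 1))) = 1 := by
      simp [DegIndex]
    rw [this]; rfl
  · obtain ⟨t, ht⟩ := exists_root_of_one c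
    have hne : t ≠ -t := by
      intro h
      have h1 : (t : Eucl m) = -(t : Eucl m) := congrArg Subtype.val h
      have h2 : (2 : ℝ) • (t : Eucl m) = 0 := by
        rw [two_smul]; nth_rewrite 1 [h1]; exact neg_add_cancel _
      exact ne_zero_of_mem_unit_sphere t ((smul_eq_zero.1 h2).resolve_left two_ne_zero)
    have hsub : ({t, -t} : Set (Sph m)) ⊆ roots c := by
      rintro s (rfl | rfl)
      · exact ht
      · intro l
        have := ht l
        simp only [sysVal] at this ⊢
        have hn : ((-t : Sph m) : Eucl m) = (-1 : ℝ) • (t : Eucl m) := by simp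
        rw [hn, homPoly_smul, this, mul_zero]
    rw [← Set.encard_pair hne]
    exact Set.encard_le_encard hsub

/-- The constant `b_0 f_0` does not involve `d`. Pairing with `1` in degree `d = 1`, where the
number of roots is almost surely `2`, gives its product with the area of the sphere without
computing either. -/
theorem surf_mul_chaosPoly_zero (e : Frame m) :
    (surf m).real Set.univ * chaosPoly m 0 0 0 = 2 := by
  have h := integral_numRoots_mul (m := m) (d := 1) le_rfl e (Q := 0) (one_mem_polyLE 0)
  have hN : ∫ z : Fin m × DegIndex (m + 1) 1 → ℝ,
      (numRoots (coef z)).toReal * (1 : ((Fin m × DegIndex (m + 1) 1 → ℝ) → ℝ)) z ∂(stdG _) = 2 := by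
    have : ∀ᵐ z ∂(stdG (Fin m × DegIndex (m + 1) 1)),
        (numRoots (coef z)).toReal * (1 : ((Fin m × DegIndex (m + 1) 1 → ℝ) → ℝ)) z = 2 := by
      filter_upwards [ae_stdG_det_macMat_ne_zero (m := m) (d := 1)] with z hz
      rw [numRoots_eq_encard, encard_roots_of_one hz]
      simp
    rw [integral_congr_ae this]
    simp
  rw [hN] at h
  simp only [chaosIntegrand_eq, zero_add, Finset.range_one, Finset.sum_singleton, Pi.one_apply,
    mul_one, chaosPoly_zero (sysVal _ _)] at h
  rw [h]
  simp

theorem integral_chaosKernel_zero (e : Frame m) (c : Fin m × DegIndex (m + 1) d → ℝ) :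
    ∫ t : Sph m, chaosKernel m 0 c (t : Eucl m) ∂(surf m) = 2 := by
  have : ∀ t : Sph m, chaosKernel m 0 c (t : Eucl m) = chaosPoly m 0 0 0 :=
    fun t => chaosPoly_zero _ _
  simp only [this, integral_const, smul_eq_mul]
  exact surf_mul_chaosPoly_zero e

end Expansion

end KSS
end

noncomputable section
namespace KSS

/-! ### Transport to the probability space of the coefficients -/

section Transport

variable {Ω : Type*} [MeasurableSpace Ω] {P : Measure Ω}

/-- The functions that are almost everywhere equal to an element of a subspace of `L²`. -/
def aeSubmodule (K : Submodule ℝ (Lp ℝ 2 P)) : Submodule ℝ (Ω → ℝ) where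
  carrier := {f | ∃ x ∈ K, x =ᵐ[P] f}
  add_mem' := by
    rintro f g ⟨x, hx, hxf⟩ ⟨y, hy, hyg⟩
    exact ⟨x + y, K.add_mem hx hy, (Lp.coeFn_add x y).trans (hxf.add hyg)⟩
  zero_mem' := ⟨0, K.zero_mem, Lp.coeFn_zero _ _ _⟩
  smul_mem' := by
    rintro r f ⟨x, hx, hxf⟩
    exact ⟨r • x, K.smul_mem r hx, (Lp.coeFn_smul r x).trans (hxf.const_smul r)⟩

theorem toLp_mem_of_mem_aeSubmodule {K : Submodule ℝ (Lp ℝ 2 P)} {f : Ω → ℝ}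
    (hf : f ∈ aeSubmodule K) : ∃ h : MemLp f 2 P, h.toLp f ∈ K := by
  obtain ⟨x, hx, hxf⟩ := hf
  have h : MemLp f 2 P := (memLp_congr_ae hxf).1 (Lp.memLp x)
  refine ⟨h, ?_⟩
  have : h.toLp f = x := Lp.ext (h.coeFn_toLp.trans hxf.symm)
  rwa [this]

/-- Coordinates with joint standard Gaussian law are orthonormal in `L²`, so a Hermite product of
them is one of the generators of the chaos. -/
theorem hermProd_mem_aeSubmodule {κ : Type*} [Fintype κ] [DecidableEq κ] {G : Submodule ℝ (Lp ℝ 2 P)}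
    {y : Ω → κ → ℝ} (hy : MeasurePreserving y P (stdG κ))
    (hG : ∀ k, (fun ω => y ω k) ∈ aeSubmodule G) (α : κ → ℕ) :
    (fun ω => hermProd α (y ω)) ∈ aeSubmodule (wienerChaos P G (∑ k, α k)) := by
  choose x hxG hx using hG
  have horth : Orthonormal ℝ x := by
    rw [orthonormal_iff_ite]
    intro k k'
    rw [L2.inner_def]
    have h1 : ∫ ω, inner ℝ (x k ω) (x k' ω) ∂P = ∫ ω, y ω k * y ω k' ∂P := by
      refine integral_congr_ae ?_
      filter_upwards [hx k, hx k'] with ω h h'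
      rw [h, h']
      simp [mul_comm]
    have h2 : ∫ ω, y ω k * y ω k' ∂P = ∫ v, v k * v k' ∂(stdG κ) := by
      rw [← hy.map_eq, integral_map hy.measurable.aemeasurable
        (Continuous.aestronglyMeasurable (by fun_prop))]
    -- A coordinate is a Hermite product of degree one, so its inner products are a case of Hermite
    -- orthogonality.
    have h3 : ∀ (k : κ) (v : κ → ℝ), hermProd (Pi.single k 1) v = v k := by
      intro k v
      rw [hermProd, Finset.prod_eq_single k]
      · simp [herm]
      · intro i _ hi; simp [hi]
      · simp
    have h4 := integral_hermProd_mul_hermProd (Pi.single k 1 : κ → ℕ) (Pi.single k' 1)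
    simp only [h3] at h4
    rw [h1, h2, h4]
    by_cases h : k = k'
    · subst h
      rw [if_pos rfl, if_pos rfl, Finset.prod_eq_single k]
      · simp
      · intro i _ hi; simp [hi]
      · simp
    · rw [if_neg h, if_neg]
      intro h'
      have := congrFun h' k
      simp [h] at this
  let e := Fintype.equivFin κ
  have hmem := memLp_two_of_mem_polyLE (hermProd_mem_polyLE α) |>.comp_measurePreserving hy
  refine ⟨hmem.toLp _, Submodule.le_topologicalClosure _ (Submodule.subset_span ?_), hmem.coeFn_toLp⟩
  refine ⟨Fintype.card κ, α ∘ e.symm, x ∘ e.symm, fun i => hxG _, horth.comp _ e.symm.injective,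
    Equiv.sum_comp e.symm α, ?_⟩
  have hall : ∀ᵐ ω ∂P, ∀ k, x k ω = y ω k := ae_all_iff.2 hx
  filter_upwards [hmem.coeFn_toLp, hall] with ω h1 h2
  rw [h1]
  simp only [Function.comp_apply, hermProd, h2]
  exact (Equiv.prod_comp e.symm fun k => herm (α k) (y ω k)).symm

theorem chaosPoly_mem_aeSubmodule {m : ℕ} {G : Submodule ℝ (Lp ℝ 2 P)}
    {y : Ω → Fin m ⊕ (Fin m × Fin m) → ℝ} (hy : MeasurePreserving y P (stdG _))
    (hG : ∀ k, (fun ω => y ω k) ∈ aeSubmodule G) (q : ℕ) :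
    (fun ω => chaosPoly m q (fun l => y ω (Sum.inl l)) (fun p => y ω (Sum.inr p))) ∈
      aeSubmodule (wienerChaos P G q) := by
  have : (fun ω => chaosPoly m q (fun l => y ω (Sum.inl l)) (fun p => y ω (Sum.inr p))) =
      ∑ n ∈ Finset.HasAntidiagonal.antidiagonal q,
        ∑ α ∈ Finset.piAntidiag (Finset.univ : Finset (Fin m)) n.1,
          ∑ β ∈ Finset.piAntidiag (Finset.univ : Finset (Fin m × Fin m)) n.2,
            (bCoeff α * fCoeff β) • fun ω => hermProd (Sum.elim α β) (y ω) := by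
    funext ω
    simp only [chaosPoly, diracPart, detPart, Finset.sum_mul_sum, Finset.sum_apply, Pi.smul_apply,
      smul_eq_mul, hermProd_sum, Sum.elim_inl, Sum.elim_inr]
    refine Finset.sum_congr rfl fun n _ => Finset.sum_congr rfl fun α _ =>
      Finset.sum_congr rfl fun β _ => by ring
  rw [this]
  refine Submodule.sum_mem _ fun n hn => Submodule.sum_mem _ fun α hα =>
    Submodule.sum_mem _ fun β hβ => Submodule.smul_mem _ _ ?_
  have h := hermProd_mem_aeSubmodule hy hG (Sum.elim α β)
  rw [Fintype.sum_sum_type] at h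
  simp only [Sum.elim_inl, Sum.elim_inr] at h
  rwa [(Finset.mem_piAntidiag.1 hα).1, (Finset.mem_piAntidiag.1 hβ).1,
    Finset.HasAntidiagonal.mem_antidiagonal.1 hn] at h

variable {m d : ℕ} {a : Fin m × DegIndex (m + 1) d → Ω → ℝ}

/-- Divide the coefficients by their standard deviations. They are only almost everywhere
measurable, so measurable representatives are used and the coefficients are recovered almost surely.
-/
theorem IsKSS.exists_measurePreserving [IsProbabilityMeasure P] (ha : IsKSS P a) :
    ∃ z : Ω → Fin m × DegIndex (m + 1) d → ℝ, MeasurePreserving z P (stdG _) ∧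
      ∀ᵐ ω ∂P, (fun p => a p ω) = coef (z ω) := by
  let z : Ω → Fin m × DegIndex (m + 1) d → ℝ := fun ω p =>
    (ha.hasLaw p).aemeasurable.mk (a p) ω / wt p.2
  have hzm : ∀ p, Measurable fun ω => z ω p := fun p =>
    (ha.hasLaw p).aemeasurable.measurable_mk.div_const _
  have hae : ∀ p, a p =ᵐ[P] (ha.hasLaw p).aemeasurable.mk (a p) := fun p =>
    (ha.hasLaw p).aemeasurable.ae_eq_mk
  have hind : iIndepFun (fun p ω => z ω p) P :=
    (ha.indep.congr hae).comp (fun p x => x / wt p.2) fun p => by fun_prop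
  have hlaw : ∀ p, P.map (fun ω => z ω p) = gaussianReal 0 1 := by
    intro p
    have h1 : (fun ω => z ω p) =ᵐ[P] fun ω => a p ω / wt p.2 := by
      filter_upwards [hae p] with ω hω
      simp only [z, hω]
    rw [Measure.map_congr h1, (gaussianReal_div_const (ha.hasLaw p) (wt p.2)).map_eq]
    congr 1
    · simp
    · have hw : (NNReal.mk (wt p.2 ^ 2) (sq_nonneg _)) =
          (Nat.multinomial Finset.univ p.2.1 : NNReal) := by
        apply NNReal.eq
        simp only [NNReal.coe_mk, NNReal.coe_natCast, sq, wt_mul_self]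
      rw [hw]
      refine div_self ?_
      exact_mod_cast (Nat.multinomial_pos _ _).ne'
  refine ⟨z, ⟨measurable_pi_lambda _ hzm, ?_⟩, ?_⟩
  · rw [hind.map_fun_eq_pi_map fun p => (hzm p).aemeasurable]
    simp only [hlaw]
  · filter_upwards [ae_all_iff.2 hae] with ω hω
    funext p
    have := (wt_pos p.2).ne'
    simp only [coef, z, hω p]
    field_simp

theorem linear_mem_gaussSpace {z : Ω → Fin m × DegIndex (m + 1) d → ℝ}
    (hz : MeasurePreserving z P (stdG _)) (haz : ∀ᵐ ω ∂P, (fun p => a p ω) = coef (z ω))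
    (u : Fin m × DegIndex (m + 1) d → ℝ) :
    (fun ω => ∑ p, u p * z ω p) ∈ aeSubmodule (gaussSpace P a) := by
  have : (fun ω => ∑ p, u p * z ω p) = ∑ p, (u p / wt p.2) • fun ω => coef (z ω) p := by
    funext ω
    simp only [Finset.sum_apply, Pi.smul_apply, smul_eq_mul, coef]
    refine Finset.sum_congr rfl fun p _ => ?_
    have := (wt_pos p.2).ne'
    field_simp
  rw [this]
  refine Submodule.sum_mem _ fun p _ => Submodule.smul_mem _ _ ?_
  have hm : MemLp (fun ω => coef (z ω) p) 2 P := by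
    have h1 := (memLp_two_of_mem_polyLE (mem_polyLE_one (coord_mem_affineFun p))).comp_measurePreserving hz
    exact h1.const_mul (wt p.2)
  refine ⟨hm.toLp _, Submodule.le_topologicalClosure _ (Submodule.subset_span ⟨p, ?_⟩),
    hm.coeFn_toLp⟩
  filter_upwards [hm.coeFn_toLp, haz] with ω h1 h2
  rw [h1, ← h2]

theorem chaosKernel_mem_wienerChaos (hd : 1 ≤ d) {z : Ω → Fin m × DegIndex (m + 1) d → ℝ}
    (hz : MeasurePreserving z P (stdG _)) (haz : ∀ᵐ ω ∂P, (fun p => a p ω) = coef (z ω))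
    (q : ℕ) (t : Sph m) :
    (fun ω => chaosKernel m q (coef (z ω)) (t : Eucl m)) ∈
      aeSubmodule (wienerChaos P (gaussSpace P a) q) := by
  simp only [chaosKernel_coef]
  exact chaosPoly_mem_aeSubmodule
    ((measurePreserving_jet hd (isTangentFrame_houseFrame t)).comp hz)
    (fun k => linear_mem_gaussSpace hz haz _) q

theorem chaosTerm_eq (q : ℕ) (e : Frame m) (c : Fin m × DegIndex (m + 1) d → ℝ) :
    chaosTerm q e c =
      (d : ℝ) ^ ((m : ℝ) / 4) / 2 * ∫ t : Sph m, chaosKernel m q c (t : Eucl m) ∂(surf m) := by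
  simp only [chaosTerm, chaosIntegrand_eq_chaosKernel]

/-- For each fixed `t` the integrand lies in the chaos, which is closed, so its integral over the
sphere lies there as well. -/
theorem chaosTerm_mem_wienerChaos [IsProbabilityMeasure P] (hd : 1 ≤ d)
    {z : Ω → Fin m × DegIndex (m + 1) d → ℝ}
    (hz : MeasurePreserving z P (stdG _)) (haz : ∀ᵐ ω ∂P, (fun p => a p ω) = coef (z ω))
    (q : ℕ) (e : Frame m) :
    ∃ h : MemLp (fun ω => chaosTerm q e fun p => a p ω) 2 P,
      h.toLp _ ∈ wienerChaos P (gaussSpace P a) q := by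
  have hF : MemLp (fun p : Sph m × Ω => chaosKernel m q (coef (z p.2)) (p.1 : Eucl m)) 2
      ((surf m).prod P) := by
    have h := (memLp_chaosKernel (m := m) (d := d) hd q).comp_measurePreserving
      ((MeasurePreserving.id (surf m)).prod hz)
    exact h
  have hK := integral_fst_mem_of_isClosed hF (K := wienerChaos P (gaussSpace P a) q)
    (Submodule.isClosed_topologicalClosure _) fun t =>
      toLp_mem_of_mem_aeSubmodule (chaosKernel_mem_wienerChaos hd hz haz q t)
  refine toLp_mem_of_mem_aeSubmodule ?_
  refine ⟨((d : ℝ) ^ ((m : ℝ) / 4) / 2) • (memLp_integral_fst hF).toLp _,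
    Submodule.smul_mem _ _ hK, ?_⟩
  filter_upwards [Lp.coeFn_smul ((d : ℝ) ^ ((m : ℝ) / 4) / 2) ((memLp_integral_fst hF).toLp _),
    (memLp_integral_fst hF).coeFn_toLp, haz] with ω h1 h2 h3
  rw [h1, Pi.smul_apply, h2, h3, chaosTerm_eq, smul_eq_mul]

/-- A pathwise identity with `s = d^{m/4}`: since `√d^m = s²`, the term `q = 0` of `chaosSum`
integrates to `2 s² = 2 d^{m/2}`, the centering in `normCount`, and division by `2s` turns the other
terms into `chaosTerm`. -/
theorem normCount_sub_sum_chaosTerm (hd : 1 ≤ d) (e : Frame m)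
    (z : Fin m × DegIndex (m + 1) d → ℝ) (Q : ℕ) :
    normCount (coef z) - ∑ q ∈ Finset.Icc 1 Q, chaosTerm q e (coef z) =
      (2 * (d : ℝ) ^ ((m : ℝ) / 4))⁻¹ *
        ((numRoots (coef z)).toReal - ∫ t, chaosSum Q (t, z) ∂(surf m)) := by
  have hd0 : (0 : ℝ) < d := by exact_mod_cast hd
  set s := (d : ℝ) ^ ((m : ℝ) / 4) with hs
  have hs0 : 0 < s := Real.rpow_pos_of_pos hd0 _
  have h2 : (d : ℝ) ^ ((m : ℝ) / 2) = s * s := by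
    rw [hs, ← Real.rpow_add hd0]
    congr 1; ring
  have h3 : √(d : ℝ) ^ m = s * s := by
    rw [← h2, Real.sqrt_eq_rpow, ← Real.rpow_natCast, ← Real.rpow_mul hd0.le]
    congr 1; ring
  have hint : ∀ q, Integrable (fun t : Sph m => chaosKernel m q (coef z) (t : Eucl m)) (surf m) := by
    intro q
    have := integrable_chaosIntegrand q e (coef z)
    exact this.congr (ae_of_all _ fun t => chaosIntegrand_eq_chaosKernel q e _ t)
  have hsum : ∫ t, chaosSum Q (t, z) ∂(surf m) = s * s *
      (2 + ∑ q ∈ Finset.Icc 1 Q, ∫ t : Sph m, chaosKernel m q (coef z) (t : Eucl m) ∂(surf m)) := by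
    simp only [chaosSum]
    rw [integral_const_mul, integral_finsetSum _ fun q _ => hint q, h3,
      Finset.range_eq_Ico, Finset.sum_eq_sum_Ico_succ_bot (Nat.succ_pos Q),
      integral_chaosKernel_zero e]
    rfl
  simp only [chaosTerm_eq, ← hs, ← Finset.mul_sum]
  rw [hsum, normCount, ← toReal_numRoots, h2, ← hs]
  field_simp
  ring

end Transport

end KSS
end

/-! ### The theorem for Kostlan-Shub-Smale coefficients. -/

theorem proposition3 {Ω : Type*} [MeasurableSpace Ω] (P : Measure Ω) [IsProbabilityMeasure P]
    (m d : ℕ) (hm : 1 ≤ m) (hd : 1 < d)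
    (a : Fin m × KSS.DegIndex (m + 1) d → Ω → ℝ) (ha : KSS.IsKSS P a) (e : KSS.Frame m) :
    -- the number of roots is almost surely finite, and its normalization is square integrable
    (∀ᵐ ω ∂P, (KSS.roots fun p => a p ω).Finite) ∧
    MemLp (fun ω => KSS.normCount fun p => a p ω) 2 P ∧
    -- the integrals over the sphere exist
    (∀ q, 1 ≤ q → ∀ ω,
      Integrable (KSS.chaosIntegrand q e fun p => a p ω) (KSS.surf m)) ∧
    -- the terms of the series belong to the Wiener chaoses of the coefficients
    (∀ q, 1 ≤ q → ∃ h : MemLp (fun ω => KSS.chaosTerm q e fun p => a p ω) 2 P,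
      h.toLp _ ∈ KSS.wienerChaos P (KSS.gaussSpace P a) q) ∧
    -- the series converges to the normalized number of roots in the `L²` sense
    Tendsto (fun Q : ℕ => eLpNorm (fun ω => KSS.normCount (fun p => a p ω) -
      ∑ q ∈ Finset.Icc 1 Q, KSS.chaosTerm q e fun p => a p ω) 2 P) atTop (𝓝 0) := by
  have hd1 : 1 ≤ d := hd.le
  obtain ⟨z, hz, haz⟩ := KSS.IsKSS.exists_measurePreserving ha
  refine ⟨?_, ?_, fun q _ ω => KSS.integrable_chaosIntegrand q e _,
    fun q _ => KSS.chaosTerm_mem_wienerChaos hd1 hz haz q e, ?_⟩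
  · filter_upwards [haz, hz.quasiMeasurePreserving.ae KSS.ae_stdG_det_macMat_ne_zero] with ω h1 h2
    rw [h1]
    exact Set.finite_of_encard_le_coe (k := KSS.rootBound m d)
      (by simpa [KSS.rootBound] using KSS.encard_roots_le h2)
  · have h1 := KSS.memLp_toReal_numRoots.comp_measurePreserving hz
    have h2 : MemLp (fun ω => ((KSS.numRoots (KSS.coef (z ω))).toReal -
        2 * (d : ℝ) ^ ((m : ℝ) / 2)) / (2 * (d : ℝ) ^ ((m : ℝ) / 4))) 2 P := by
      simp only [div_eq_mul_inv]
      exact (h1.sub (memLp_const _)).mul_const _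
    refine (memLp_congr_ae ?_).1 h2
    filter_upwards [haz] with ω h3
    rw [h3, KSS.normCount, KSS.toReal_numRoots]
  · have ht := KSS.tendsto_eLpNorm_numRoots_sub_chaosSum (m := m) hd1 e
    -- The error is a constant multiple of the error for standard coefficients, and its norm is
    -- unchanged by the measure preserving map `z`.
    have h1 : ∀ Q : ℕ, eLpNorm (fun ω => KSS.normCount (fun p => a p ω) -
        ∑ q ∈ Finset.Icc 1 Q, KSS.chaosTerm q e fun p => a p ω) 2 P =
        ‖(2 * (d : ℝ) ^ ((m : ℝ) / 4))⁻¹‖ₑ *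
          eLpNorm (fun z : Fin m × KSS.DegIndex (m + 1) d → ℝ =>
            (KSS.numRoots (KSS.coef z)).toReal - ∫ t, KSS.chaosSum Q (t, z) ∂(KSS.surf m)) 2
            (KSS.stdG _) := by
      intro Q
      have hm := KSS.memLp_toReal_numRoots.sub
        (KSS.memLp_integral_fst (KSS.memLp_chaosSum (m := m) hd1 Q))
      have hc := eLpNorm_comp_measurePreserving (p := 2) hm.1 hz
      refine Eq.trans ?_ (congrArg _ hc)
      rw [← eLpNorm_const_smul]
      refine eLpNorm_congr_ae ?_
      filter_upwards [haz] with ω h3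
      rw [h3, KSS.normCount_sub_sum_chaosTerm hd1 e]
      rfl
    simp only [h1]
    have h2 := ENNReal.Tendsto.const_mul (a := ‖(2 * (d : ℝ) ^ ((m : ℝ) / 4))⁻¹‖ₑ) ht
      (Or.inr enorm_ne_top)
    rwa [mul_zero] at h2
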